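/- Let $r\ge 2$ be an integer, $q=e^{\pi i/r}$, $q^x=e^{\pi i x/r}$ for $x\in\mathbb C$, $\{x\}=q^x-q^{-x}$, $\{n\}!=\{n\}\cdots\{1\}$. Let $\overline U$ be the $\mathbb C$-algebra generated by $E,F,K^{\pm1},H$ with relations $KEK^{-1}=q^2E$, $KFK^{-1}=q^{-2}F$, $[E,F]=\frac{K-K^{-1}}{q-q^{-1}}$, $HK=KH$, $[H,E]=2E$, $[H,F]=-2F$, $E^r=F^r=0$, with coproduct $\Delta E=1\otimes E+E\otimes K$, $\Delta F=K^{-1}\otimes F+F\otimes1$, $\Delta K=K\otimes K$, $\Delta H=H\otimes 1+1\otimes H$, and antipode $S(E)=-EK^{-1}$, $S(F)=-KF$, $S(K)=K^{-1}$, $S(H)=-H$. Let $\mathscr C$ be the category of finite-dimensional $\overline U$-modules on which $H$ is diagonalizable and $K=q^H$, with the tensor product, duals and unit $\mathbb I=\mathbb C$ given by the Hopf structure. For $V,W\in\mathscr C$ let $R=q^{H\otimes H/2}\sum_{n=0}^{r-1}\frac{\{1\}^{2n}}{\{n\}!}q^{n(n-1)/2}E^n\otimes F^n$, let $\tau$ be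 the flip, $c_{V,W}=\tau R:V\otimes W\to W\otimes V$ the braiding, and let the twist $\theta_V$ be the inverse of the action on $V$ of $K^{r-1}\sum_{n=0}^{r-1}\frac{\{1\}^{2n}}{\{n\}!}q^{n(n-1)/2}S(F^n)\,q^{-H^2/2}E^n$. Modules. For $\alpha\in\mathbb C$, $V_\alpha$ has basis $v_0,\dots,v_{r-1}$ with $Hv_i=(\alpha+r-1-2i)v_i$, $Fv_i=v_{i+1}$ ($v_r=0$), $Ev_i=\frac{\{i\}\{i-\alpha\}}{\{1\}^2}v_{i-1}$. For $0\le n\le r-2$, $S_n$ has basis $s_0,\dots,s_n$ with $Hs_i=(n-2i)s_i$, $Fs_i=s_{i+1}$ ($s_{n+1}=0$), $Es_i=\frac{\{i\}\{n+1-i\}}{\{1\}^2}s_{i-1}$; $P_n$ is the indecomposable projective cover of $S_n$ in $\mathscr C$. For $a\in\mathbb Z$, $\mathbb C^H_{ar}$ is one-dimensional with $H=ar$, $E=F=0$. Let $\mathscr D\subset\mathscr C$ be the full subcategory of finite direct sums of retracts of finite tensor products of the modules $V_\alpha$ ($\alpha\in(\mathbb R\setminus\mathbb Z)\cup r\mathbb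 Z$), $S_n$, $P_n$, $\mathbb C^H_{ar}$ and their duals. Half twist. A half twist is a natural automorphism $\sqrt\theta$ of the identity functor of $\mathscr C$ with $\sqrt\theta_V^{\,2}=\theta_V$, $\sqrt\theta_{V^*}=(\sqrt\theta_V)^*$ and $\sqrt\theta_{\mathbb I}=\mathrm{Id}$. Call it standard if it acts by $q^{(\alpha^2-(r-1)^2)/4}$ on $V_\alpha$ for $\alpha\in(\mathbb C\setminus\mathbb Z)\cup r\mathbb Z$, by $q^{i(i+2-2r)/4}$ on $S_i\otimes\mathbb C^H_{kr}$ for $k$ even (in particular on $S_i$), and by $q^{j(j+2-2r)/4}$, $j=r-2-i$, on $S_i\otimes\mathbb C^H_{kr}$ for $k$ odd ($0\le i\le r-2$). Put $\mathsf X_{V,W}=(\sqrt\theta_{W\otimes V})^{-1}c_{V,W}(\sqrt\theta_V\otimes\sqrt\theta_W)$. Hermitian modules. A Hermitian structure on $V\in\mathscr C$ is a non-degenerate Hermitian form (antilinear in the first variable, linear in the second) such that $(x^\dagger v,w)=(v,xw)$ for all $x\in\overline U$, where $\dagger$ is the antilinear anti-involution of $\overline U$ with $E^\dagger=F$, $F^\dagger=E$,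 $K^\dagger=K^{-1}$, $H^\dagger=H$. Let $\mathscr D^\dagger$ be the category of modules in $\mathscr D$ equipped with a Hermitian structure, with all $\overline U$-linear maps as morphisms. Theorem. A standard half twist exists. Let $\sqrt\theta$ be a standard half twist. For $W_1,W_2\in\mathscr D^\dagger$, the module $W_1\otimes W_2$ lies in $\mathscr D$, and $$(v,v')=\bigl(v,\tau(\mathsf X_{W_1,W_2}v')\bigr)_p,\qquad (x\otimes y,x'\otimes y')_p=(x,x')_{W_1}(y,y')_{W_2},$$ is a Hermitian structure on $W_1\otimes W_2$. With this tensor product of objects, the usual tensor product of linear maps, the unit $\mathbb C$ with $(1,1)=1$, and the usual associativity and unit isomorphisms of vector spaces, $\mathscr D^\dagger$ is a $\mathbb C$-linear tensor category (composition and tensor product of morphisms are $\mathbb C$-bilinear, and $c\mapsto c\,\mathrm{Id}_{\mathbb I}$ is a bijection from $\mathbb C$ to $\mathrm{End}(\mathbb I)$). It is strict in the sense that these canonical identifications $(U\otimes V)\otimes W=U\otimes(V\otimes W)$ and $\mathbb I\otimes V=V=V\otimes\mathbb I$ also identify the Hermitian forms. -/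

import Mathlib

open CategoryTheory TensorProduct

noncomputable section

namespace UnrolledSl2

/-! ### Quantum numbers at `q = exp (π i / r)` -/

/-- `q ^ x = exp (π i x / r)`. -/
def qpow (r : ℕ) (x : ℂ) : ℂ := Complex.exp (Real.pi * Complex.I * x / r)

/-- `{x} = q ^ x - q ^ (-x)`. -/
def qbr (r : ℕ) (x : ℂ) : ℂ := qpow r x - qpow r (-x)

/-- `{n}! = {n} {n-1} ⋯ {1}`. -/
def qfact (r n : ℕ) : ℂ := ∏ k ∈ Finset.range n, qbr r (k + 1)

theorem qpow_add (r : ℕ) (x y : ℂ) : qpow r (x + y) = qpow r x * qpow r y := by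
  simp only [qpow]
  rw [← Complex.exp_add]
  ring_nf

theorem qpow_zero (r : ℕ) : qpow r 0 = 1 := by simp [qpow]

theorem qpow_ne_zero (r : ℕ) (x : ℂ) : qpow r x ≠ 0 := Complex.exp_ne_zero _

theorem qpow_neg (r : ℕ) (x : ℂ) : qpow r (-x) = (qpow r x)⁻¹ := by
  simp only [qpow]
  rw [← Complex.exp_neg]
  ring_nf

theorem qbr_zero (r : ℕ) : qbr r 0 = 0 := by simp [qbr]

theorem qbr_int_mul (r : ℕ) (hr : r ≠ 0) (a : ℤ) : qbr r (a * r) = 0 := by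
  have hr' : (r : ℂ) ≠ 0 := by exact_mod_cast hr
  have h1 : (Real.pi : ℂ) * Complex.I * (a * r) / r = a * (Real.pi * Complex.I) := by
    field_simp
  have h2 : (Real.pi : ℂ) * Complex.I * (-(a * r)) / r
      = a * (Real.pi * Complex.I) - a * (2 * Real.pi * Complex.I) := by
    field_simp
    ring
  simp only [qbr, qpow]
  rw [h1, h2, Complex.exp_sub, Complex.exp_int_mul_two_pi_mul_I]
  simp

theorem qpow_two_primitive (r : ℕ) (hr : r ≠ 0) : IsPrimitiveRoot (qpow r 2) r := by
  have := Complex.isPrimitiveRoot_exp r hr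
  convert this using 1
  simp only [qpow]
  ring_nf

theorem qbr_one_ne_zero (r : ℕ) [hr : r.AtLeastTwo] : qbr r 1 ≠ 0 := by
  have h := (qpow_two_primitive r (NeZero.ne r)).ne_one hr.prop
  rw [qbr, sub_ne_zero, qpow_neg]
  intro h1
  refine h ?_
  rw [show (2 : ℂ) = 1 + 1 by norm_num, qpow_add]
  nth_rewrite 1 [h1]
  exact inv_mul_cancel₀ (qpow_ne_zero r 1)

/-! ### Facts of linear algebra -/

/-- Gaussian binomial coefficients. -/
def gaussBinom (p : ℂ) : ℕ → ℕ → ℂ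
  | _, 0 => 1
  | 0, _ + 1 => 0
  | n + 1, k + 1 => gaussBinom p n k + p ^ (k + 1) * gaussBinom p n (k + 1)

theorem gaussBinom_of_lt (p : ℂ) : ∀ n k : ℕ, n < k → gaussBinom p n k = 0
  | _, 0, h => absurd h (Nat.not_lt_zero _)
  | 0, _ + 1, _ => by simp [gaussBinom]
  | n + 1, k + 1, h => by
    rw [gaussBinom, gaussBinom_of_lt p n k (by omega), gaussBinom_of_lt p n (k + 1) (by omega)]
    simp

theorem gaussBinom_mul (p : ℂ) : ∀ n k m : ℕ, k + m = n →
    gaussBinom p n k * (∏ i ∈ Finset.range k, (p ^ (i + 1) - 1)) * (∏ i ∈ Finset.range m, (p ^ (i + 1) - 1))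
      = ∏ i ∈ Finset.range n, (p ^ (i + 1) - 1)
  | n, 0, m, h => by
    have : m = n := by omega
    subst this
    cases m <;> simp [gaussBinom]
  | 0, k + 1, m, h => by omega
  | n + 1, k + 1, 0, h => by
    have : k = n := by omega
    subst this
    have h1 := gaussBinom_mul p k k 0 (by omega)
    rw [gaussBinom, gaussBinom_of_lt p k (k + 1) (by omega), Finset.prod_range_succ]
    simp only [Finset.range_zero, Finset.prod_empty, mul_one, mul_zero, add_zero] at h1 ⊢
    rw [← mul_assoc, h1]
  | n + 1, k + 1, m + 1, h => by
    have h1 := gaussBinom_mul p n k (m + 1) (by omega)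
    have h2 := gaussBinom_mul p n (k + 1) m (by omega)
    have hn : n = k + (m + 1) := by omega
    rw [gaussBinom, Finset.prod_range_succ _ n]
    rw [Finset.prod_range_succ] at h1 h2
    rw [Finset.prod_range_succ _ k, Finset.prod_range_succ _ m]
    have e : p ^ (n + 1) = p ^ (k + 1) * p ^ (m + 1) := by rw [← pow_add]; congr 1; omega
    rw [e]
    linear_combination (p ^ (k + 1) - 1) * h1 + p ^ (k + 1) * (p ^ (m + 1) - 1) * h2

theorem add_pow_of_qcomm {A : Type*} [Ring A] [Algebra ℂ A] {p : ℂ} {x y : A}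
    (h : y * x = p • (x * y)) (n : ℕ) :
    (x + y) ^ n = ∑ k ∈ Finset.range (n + 1), gaussBinom p n k • (x ^ k * y ^ (n - k)) := by
  have hk : ∀ k : ℕ, y * x ^ k = p ^ k • (x ^ k * y) := by
    intro k
    induction k with
    | zero => simp
    | succ k ih =>
      rw [pow_succ, ← mul_assoc, ih, smul_mul_assoc, mul_assoc, h, mul_smul_comm, smul_smul,
        ← mul_assoc, pow_succ]
  induction n with
  | zero => simp [gaussBinom]
  | succ n ih =>
    rw [pow_succ', ih, add_mul, Finset.mul_sum, Finset.mul_sum]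
    have e1 : ∀ k ∈ Finset.range (n + 1), x * gaussBinom p n k • (x ^ k * y ^ (n - k))
        = gaussBinom p n k • (x ^ (k + 1) * y ^ (n - k)) := by
      intro k _
      rw [mul_smul_comm, ← mul_assoc, pow_succ']
    have e2 : ∀ k ∈ Finset.range (n + 1), y * gaussBinom p n k • (x ^ k * y ^ (n - k))
        = (p ^ k * gaussBinom p n k) • (x ^ k * y ^ (n + 1 - k)) := by
      intro k hk'
      have : n + 1 - k = (n - k) + 1 := by
        have := Finset.mem_range.1 hk'
        omega
      rw [mul_smul_comm, ← mul_assoc, hk, smul_mul_assoc, smul_smul, mul_assoc, this, pow_succ' y,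
        mul_comm]
    rw [Finset.sum_congr rfl e1, Finset.sum_congr rfl e2]
    have e3 : ∑ k ∈ Finset.range (n + 1), (p ^ k * gaussBinom p n k) • (x ^ k * y ^ (n + 1 - k))
        = ∑ k ∈ Finset.range (n + 2), (p ^ k * gaussBinom p n k) • (x ^ k * y ^ (n + 1 - k)) := by
      rw [Finset.sum_range_succ _ (n + 1), gaussBinom_of_lt p n (n + 1) (by omega)]
      simp
    rw [e3, Finset.sum_range_succ' _ (n + 1), Finset.sum_range_succ' _ (n + 1), ← add_assoc, ← Finset.sum_add_distrib]
    congr 1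
    · refine Finset.sum_congr rfl fun k _ => ?_
      rw [gaussBinom, add_smul]
      simp
    · cases n <;> simp [gaussBinom]

/-- If `y x = p x y` with `p` a primitive `r`-th root of unity, then `x ^ r = y ^ r = 0`
implies `(x + y) ^ r = 0`. -/
theorem add_pow_eq_zero_of_qcomm {A : Type*} [Ring A] [Algebra ℂ A] {r : ℕ} (hr : r ≠ 0)
    {p : ℂ} (hp : IsPrimitiveRoot p r) {x y : A} (h : y * x = p • (x * y))
    (hx : x ^ r = 0) (hy : y ^ r = 0) : (x + y) ^ r = 0 := by
  rw [add_pow_of_qcomm h]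
  refine Finset.sum_eq_zero fun k hk => ?_
  have hk' := Finset.mem_range.1 hk
  rcases Nat.eq_zero_or_pos k with rfl | hk0
  · simp [hy]
  rcases (show k = r ∨ k < r by omega) with rfl | hkr
  · simp [hx]
  have hne : ∀ m, m < r → ∏ i ∈ Finset.range m, (p ^ (i + 1) - 1) ≠ 0 := by
    intro m hm
    refine Finset.prod_ne_zero_iff.2 fun i hi => sub_ne_zero.2 ?_
    exact hp.pow_ne_one_of_pos_of_lt (by omega) (by have := Finset.mem_range.1 hi; omega)
  have h0 : ∏ i ∈ Finset.range r, (p ^ (i + 1) - 1) = 0 := by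
    obtain ⟨s, rfl⟩ := Nat.exists_eq_succ_of_ne_zero hr
    rw [Finset.prod_range_succ, hp.pow_eq_one]
    simp
  have := gaussBinom_mul p r k (r - k) (by omega)
  rw [h0, mul_assoc] at this
  rcases mul_eq_zero.1 this with h1 | h1
  · rw [h1, zero_smul]
  · exact absurd h1 (mul_ne_zero (hne _ hkr) (hne _ (by omega)))

/-- The (finite) set of eigenvalues of an endomorphism of a finite-dimensional space. -/
def weights {M : Type} [AddCommGroup M] [Module ℂ M] [FiniteDimensional ℂ M]
    (H : Module.End ℂ M) : Finset ℂ :=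
  H.finite_hasEigenvalue.toFinset

/-- The operator `g(H)`, for `H` diagonalizable: it acts by `g μ` on the `μ`-eigenspace of `H`
(see `opFun_apply`). It is the value at `H` of the polynomial interpolating `g` on the
spectrum of `H`. -/
def opFun {M : Type} [AddCommGroup M] [Module ℂ M] [FiniteDimensional ℂ M]
    (H : Module.End ℂ M) (g : ℂ → ℂ) : Module.End ℂ M :=
  Polynomial.aeval H (Lagrange.interpolate (weights H) id g)

theorem opFun_apply {M : Type} [AddCommGroup M] [Module ℂ M] [FiniteDimensional ℂ M]
    (H : Module.End ℂ M) (g : ℂ → ℂ) {μ : ℂ} {v : M} (h : H v = μ • v) :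
    opFun H g v = g μ • v := by
  rcases eq_or_ne v 0 with rfl | hv
  · simp
  have hμ : μ ∈ weights H := by
    simp only [weights, Set.Finite.mem_toFinset, Set.mem_ofPred_eq]
    exact Module.End.hasEigenvalue_of_hasEigenvector
      ⟨Module.End.mem_eigenspace_iff.2 h, hv⟩
  have h1 := Lagrange.eval_interpolate_at_node (s := weights H) (v := id) g
    Function.injective_id.injOn hμ
  rw [opFun, Module.End.aeval_apply_of_mem_apply_eq_smul h]
  simp only [id] at h1
  rw [← h1]

theorem span_eigenvectors {M : Type} [AddCommGroup M] [Module ℂ M]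
    {H : Module.End ℂ M} (h : ⨆ μ, H.eigenspace μ = ⊤) :
    Submodule.span ℂ {v : M | ∃ μ : ℂ, H v = μ • v} = ⊤ := by
  rw [eq_top_iff, ← h]
  refine iSup_le fun μ v hv => Submodule.subset_span ⟨μ, Module.End.mem_eigenspace_iff.1 hv⟩

theorem weight_of_span {M : Type} [AddCommGroup M] [Module ℂ M] [FiniteDimensional ℂ M]
    {r : ℕ} {H K : Module.End ℂ M} {S : Set M} (hS : Submodule.span ℂ S = ⊤)
    (h : ∀ v ∈ S, ∃ μ : ℂ, H v = μ • v ∧ K v = qpow r μ • v) :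
    (⨆ μ, H.eigenspace μ = ⊤) ∧ ∀ (μ : ℂ) (v : M), H v = μ • v → K v = qpow r μ • v := by
  constructor
  · rw [eq_top_iff, ← hS, Submodule.span_le]
    intro v hv
    obtain ⟨μ, h1, -⟩ := h v hv
    exact Submodule.mem_iSup_of_mem μ (Module.End.mem_eigenspace_iff.2 h1)
  · have hK : K = opFun H (qpow r) := by
      refine LinearMap.ext_on hS fun v hv => ?_
      obtain ⟨μ, h1, h2⟩ := h v hv
      rw [h2, opFun_apply H _ h1]
    intro μ v hv
    rw [hK, opFun_apply H _ hv]

/-! ### The category of finite-dimensional weight modules -/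

/-- A finite-dimensional weight module over the restricted unrolled quantum group, the
`ℂ`-algebra generated by `E, F, K, K⁻¹, H` with the relations below (so that a module is a
vector space with five operators satisfying them): `H` is diagonalizable and `K = q ^ H`. -/
structure WtMod (r : ℕ) where
  carrier : Type
  [addCommGroup : AddCommGroup carrier]
  [module : Module ℂ carrier]
  [finiteDimensional : FiniteDimensional ℂ carrier]
  E : Module.End ℂ carrier
  F : Module.End ℂ carrier
  K : Module.End ℂ carrier
  Kinv : Module.End ℂ carrier
  H : Module.End ℂ carrier
  K_Kinv : K * Kinv = 1
  Kinv_K : Kinv * K = 1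
  K_E : K * E * Kinv = qpow r 2 • E
  K_F : K * F * Kinv = qpow r (-2) • F
  E_F : E * F - F * E = (qbr r 1)⁻¹ • (K - Kinv)
  H_K : H * K = K * H
  H_E : H * E - E * H = (2 : ℂ) • E
  H_F : H * F - F * H = (-2 : ℂ) • F
  E_pow : E ^ r = 0
  F_pow : F ^ r = 0
  weight : ⨆ μ, H.eigenspace μ = ⊤
  K_eq : ∀ (μ : ℂ) (v : carrier), H v = μ • v → K v = qpow r μ • v

attribute [instance] WtMod.addCommGroup WtMod.module WtMod.finiteDimensional

instance (r : ℕ) : CoeSort (WtMod r) Type := ⟨WtMod.carrier⟩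

namespace WtMod

variable {r : ℕ}

theorem KE (V : WtMod r) : V.K * V.E = qpow r 2 • (V.E * V.K) := by
  have h := congrArg (· * V.K) V.K_E
  simpa [mul_assoc, V.Kinv_K] using h

theorem KF (V : WtMod r) : V.K * V.F = qpow r (-2) • (V.F * V.K) := by
  have h := congrArg (· * V.K) V.K_F
  simpa [mul_assoc, V.Kinv_K] using h

theorem EKinv (V : WtMod r) : V.E * V.Kinv = qpow r 2 • (V.Kinv * V.E) := by
  have h := congrArg (V.Kinv * ·) V.K_E
  simpa [← mul_assoc, V.Kinv_K] using h

theorem FKinv (V : WtMod r) : V.F * V.Kinv = qpow r (-2) • (V.Kinv * V.F) := by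
  have h := congrArg (V.Kinv * ·) V.K_F
  simpa [← mul_assoc, V.Kinv_K] using h

/-- The space of morphisms: linear maps commuting with the action. -/
def homs (V W : WtMod r) : Submodule ℂ (V →ₗ[ℂ] W) where
  carrier := {f | f ∘ₗ V.E = W.E ∘ₗ f ∧ f ∘ₗ V.F = W.F ∘ₗ f ∧
    f ∘ₗ V.K = W.K ∘ₗ f ∧ f ∘ₗ V.H = W.H ∘ₗ f}
  zero_mem' := by simp
  add_mem' := by
    rintro f g ⟨h1, h2, h3, h4⟩ ⟨k1, k2, k3, k4⟩
    simp only [Set.mem_ofPred_eq, LinearMap.add_comp, LinearMap.comp_add, *, and_self]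
  smul_mem' := by
    rintro c f ⟨h1, h2, h3, h4⟩
    simp only [Set.mem_ofPred_eq, LinearMap.smul_comp, LinearMap.comp_smul, *, and_self]

theorem id_mem_homs (V : WtMod r) : LinearMap.id ∈ homs V V :=
  ⟨rfl, rfl, rfl, rfl⟩

theorem comp_mem_homs {U V W : WtMod r} {f : U →ₗ[ℂ] V} {g : V →ₗ[ℂ] W} (hf : f ∈ homs U V)
    (hg : g ∈ homs V W) : g ∘ₗ f ∈ homs U W := by
  obtain ⟨h1, h2, h3, h4⟩ := hf
  obtain ⟨k1, k2, k3, k4⟩ := hg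
  refine ⟨?_, ?_, ?_, ?_⟩
  · rw [LinearMap.comp_assoc, h1, ← LinearMap.comp_assoc, k1, LinearMap.comp_assoc]
  · rw [LinearMap.comp_assoc, h2, ← LinearMap.comp_assoc, k2, LinearMap.comp_assoc]
  · rw [LinearMap.comp_assoc, h3, ← LinearMap.comp_assoc, k3, LinearMap.comp_assoc]
  · rw [LinearMap.comp_assoc, h4, ← LinearMap.comp_assoc, k4, LinearMap.comp_assoc]

instance : Category (WtMod r) where
  Hom V W := homs V W
  id V := ⟨LinearMap.id, id_mem_homs V⟩
  comp f g := ⟨g.1 ∘ₗ f.1, comp_mem_homs f.2 g.2⟩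

/-- The linear map underlying a morphism. -/
def lin {V W : WtMod r} (f : V ⟶ W) : V →ₗ[ℂ] W := Subtype.val f

instance : Preadditive (WtMod r) where
  homGroup V W := inferInstanceAs (AddCommGroup (homs V W))
  add_comp _ _ _ f f' g := Subtype.ext (LinearMap.comp_add (Subtype.val f) (Subtype.val f')
    (Subtype.val g))
  comp_add _ _ _ f g g' := Subtype.ext (LinearMap.add_comp (Subtype.val f) (Subtype.val g')
    (Subtype.val g))

instance : Linear ℂ (WtMod r) where
  homModule V W := inferInstanceAs (Module ℂ (homs V W))
  smul_comp _ _ _ c f g := Subtype.ext (LinearMap.comp_smul (Subtype.val g) c (Subtype.val f))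
  comp_smul _ _ _ f c g := Subtype.ext (LinearMap.smul_comp c (Subtype.val g) (Subtype.val f))

/-! ### Unit object, tensor products and duals -/

/-- The trivial module `ℂ`. -/
def unit (r : ℕ) [r.AtLeastTwo] : WtMod r where
  carrier := ℂ
  E := 0
  F := 0
  K := 1
  Kinv := 1
  H := 0
  K_Kinv := one_mul _
  Kinv_K := one_mul _
  K_E := by simp
  K_F := by simp
  E_F := by simp
  H_K := by simp
  H_E := by simp
  H_F := by simp
  E_pow := zero_pow (NeZero.ne r)
  F_pow := zero_pow (NeZero.ne r)
  weight := by
    rw [eq_top_iff]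
    exact fun v _ => Submodule.mem_iSup_of_mem 0 (Module.End.mem_eigenspace_iff.2 (by simp))
  K_eq := by
    intro μ v h
    rcases smul_eq_zero.1 (show μ • v = 0 from h.symm) with rfl | rfl
    · simp [qpow_zero]
    · simp

section Tensor

variable (V W : WtMod r)

/-- The action on a tensor product is given by the coproduct `Δ(E) = 1 ⊗ E + E ⊗ K`,
`Δ(F) = K⁻¹ ⊗ F + F ⊗ 1`, `Δ(K) = K ⊗ K`, `Δ(H) = H ⊗ 1 + 1 ⊗ H`. -/
def tensorE : Module.End ℂ (V ⊗[ℂ] W) := TensorProduct.map 1 W.E + TensorProduct.map V.E W.K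
def tensorF : Module.End ℂ (V ⊗[ℂ] W) := TensorProduct.map V.Kinv W.F + TensorProduct.map V.F 1
def tensorH : Module.End ℂ (V ⊗[ℂ] W) := TensorProduct.map V.H 1 + TensorProduct.map 1 W.H

theorem tensor_span : Submodule.span ℂ (Set.image2 (fun (v : V) (w : W) => v ⊗ₜ[ℂ] w)
    {v | ∃ μ : ℂ, V.H v = μ • v} {w | ∃ μ : ℂ, W.H w = μ • w}) = ⊤ := by
  have h := Submodule.map₂_span_span ℂ (TensorProduct.mk ℂ V W)
    {v | ∃ μ : ℂ, V.H v = μ • v} {w | ∃ μ : ℂ, W.H w = μ • w}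
  rw [span_eigenvectors V.weight, span_eigenvectors W.weight,
    TensorProduct.map₂_mk_top_top_eq_top] at h
  exact h.symm

theorem tensor_weight : (⨆ μ, (tensorH V W).eigenspace μ = ⊤) ∧
    ∀ (μ : ℂ) (v : V ⊗[ℂ] W), tensorH V W v = μ • v →
      TensorProduct.map V.K W.K v = qpow r μ • v := by
  refine weight_of_span (tensor_span V W) ?_
  rintro _ ⟨v, ⟨a, hv⟩, w, ⟨b, hw⟩, rfl⟩
  refine ⟨a + b, ?_, ?_⟩
  · simp [tensorH, hv, hw, add_smul, TensorProduct.smul_tmul']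
  · simp only [TensorProduct.map_tmul, V.K_eq a v hv, W.K_eq b w hw, qpow_add]
    rw [TensorProduct.smul_tmul_smul]

theorem map_pow_eq {M N : Type} [AddCommGroup M] [Module ℂ M] [AddCommGroup N] [Module ℂ N]
    (f : Module.End ℂ M) (g : Module.End ℂ N) (n : ℕ) :
    TensorProduct.map f g ^ n = TensorProduct.map (f ^ n) (g ^ n) :=
  TensorProduct.map_pow f g n

theorem map_sub_l {M N : Type} [AddCommGroup M] [Module ℂ M] [AddCommGroup N] [Module ℂ N]
    (f f' : Module.End ℂ M) (g : Module.End ℂ N) :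
    TensorProduct.map (f - f') g = TensorProduct.map f g - TensorProduct.map f' g := by
  ext; simp [TensorProduct.sub_tmul]

theorem map_sub_r {M N : Type} [AddCommGroup M] [Module ℂ M] [AddCommGroup N] [Module ℂ N]
    (f : Module.End ℂ M) (g g' : Module.End ℂ N) :
    TensorProduct.map f (g - g') = TensorProduct.map f g - TensorProduct.map f g' := by
  ext; simp [TensorProduct.tmul_sub]

/-- The tensor product of two weight modules. -/
def tensor [r.AtLeastTwo] : WtMod r where
  carrier := V ⊗[ℂ] W
  E := tensorE V W
  F := tensorF V W
  K := TensorProduct.map V.K W.K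
  Kinv := TensorProduct.map V.Kinv W.Kinv
  H := tensorH V W
  K_Kinv := by
    rw [← TensorProduct.map_mul, V.K_Kinv, W.K_Kinv, TensorProduct.map_one]
  Kinv_K := by
    rw [← TensorProduct.map_mul, V.Kinv_K, W.Kinv_K, TensorProduct.map_one]
  K_E := by
    simp only [tensorE, mul_add, add_mul, ← TensorProduct.map_mul, mul_one, V.K_Kinv, W.K_E,
      V.K_E, W.K_Kinv, mul_assoc, smul_add, TensorProduct.map_smul_left,
      TensorProduct.map_smul_right]
  K_F := by
    simp only [tensorF, mul_add, add_mul, ← TensorProduct.map_mul, mul_one, V.K_Kinv,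
      V.K_F, W.K_F, W.K_Kinv, one_mul, smul_add, TensorProduct.map_smul_left,
      TensorProduct.map_smul_right]
  E_F := by
    have e1 : TensorProduct.map (V.E * V.Kinv) (W.K * W.F)
        = TensorProduct.map (V.Kinv * V.E) (W.F * W.K) := by
      rw [V.EKinv, W.KF, TensorProduct.map_smul_left, TensorProduct.map_smul_right, smul_smul,
        ← qpow_add]
      simp [qpow_zero]
    have e2 : tensorE V W * tensorF V W - tensorF V W * tensorE V W
        = TensorProduct.map V.Kinv (W.E * W.F - W.F * W.E)
          + TensorProduct.map (V.E * V.F - V.F * V.E) W.K := by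
      simp only [tensorE, tensorF, mul_add, add_mul, ← TensorProduct.map_mul, mul_one, one_mul, e1,
        map_sub_l, map_sub_r]
      abel
    rw [e2, V.E_F, W.E_F, TensorProduct.map_smul_left, TensorProduct.map_smul_right, ← smul_add,
      map_sub_l, map_sub_r]
    congr 1
    abel
  H_K := by
    simp only [tensorH, mul_add, add_mul, ← TensorProduct.map_mul, mul_one, one_mul, V.H_K, W.H_K]
  H_E := by
    have e2 : tensorH V W * tensorE V W - tensorE V W * tensorH V W
        = TensorProduct.map 1 (W.H * W.E - W.E * W.H)
          + TensorProduct.map (V.H * V.E - V.E * V.H) W.K := by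
      simp only [tensorE, tensorH, mul_add, add_mul, ← TensorProduct.map_mul, mul_one, one_mul,
        map_sub_l, map_sub_r, W.H_K]
      abel
    rw [e2, V.H_E, W.H_E, TensorProduct.map_smul_left, TensorProduct.map_smul_right, ← smul_add]
    rfl
  H_F := by
    have hK : V.H * V.Kinv = V.Kinv * V.H := by
      have h := congrArg (fun x => V.Kinv * x * V.Kinv) V.H_K
      simp only [mul_assoc, V.K_Kinv, mul_one] at h
      rw [← mul_assoc V.Kinv V.K, V.Kinv_K, one_mul] at h
      exact h.symm
    have e2 : tensorH V W * tensorF V W - tensorF V W * tensorH V W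
        = TensorProduct.map V.Kinv (W.H * W.F - W.F * W.H)
          + TensorProduct.map (V.H * V.F - V.F * V.H) 1 := by
      simp only [tensorF, tensorH, mul_add, add_mul, ← TensorProduct.map_mul, mul_one, one_mul,
        map_sub_l, map_sub_r, hK]
      abel
    rw [e2, V.H_F, W.H_F, TensorProduct.map_smul_left, TensorProduct.map_smul_right, ← smul_add]
    rfl
  E_pow := by
    refine add_pow_eq_zero_of_qcomm (NeZero.ne r) (qpow_two_primitive r (NeZero.ne r)) ?_ ?_ ?_
    · rw [← TensorProduct.map_mul, ← TensorProduct.map_mul, W.KE, TensorProduct.map_smul_right,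
        mul_one, one_mul]
    · rw [map_pow_eq, W.E_pow, TensorProduct.map_zero_right]
    · rw [map_pow_eq, V.E_pow, TensorProduct.map_zero_left]
  F_pow := by
    rw [tensorF, add_comm]
    refine add_pow_eq_zero_of_qcomm (NeZero.ne r) (qpow_two_primitive r (NeZero.ne r)) ?_ ?_ ?_
    · rw [← TensorProduct.map_mul, ← TensorProduct.map_mul, V.FKinv, TensorProduct.map_smul_left,
        mul_one, one_mul, smul_smul, ← qpow_add]
      simp [qpow_zero]
    · rw [map_pow_eq, V.F_pow, TensorProduct.map_zero_left]
    · rw [map_pow_eq, W.F_pow, TensorProduct.map_zero_right]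
  weight := (tensor_weight V W).1
  K_eq := (tensor_weight V W).2

end Tensor

theorem H_Kinv (V : WtMod r) : V.H * V.Kinv = V.Kinv * V.H := by
  have h := congrArg (fun x => V.Kinv * x * V.Kinv) V.H_K
  simp only [mul_assoc, V.K_Kinv, mul_one] at h
  rw [← mul_assoc V.Kinv V.K, V.Kinv_K, one_mul] at h
  exact h.symm

theorem pow_mul_eq_zero {A : Type*} [Ring A] [Algebra ℂ A] {a b : A} {c : ℂ}
    (h : b * a = c • (a * b)) {n : ℕ} (ha : a ^ n = 0) : (a * b) ^ n = 0 := by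
  have key : ∀ k : ℕ, ∃ d : ℂ, (a * b) ^ k = d • (a ^ k * b ^ k) := by
    have hb : ∀ k : ℕ, b ^ k * a = c ^ k • (a * b ^ k) := by
      intro k
      induction k with
      | zero => simp
      | succ k ih =>
        rw [pow_succ, mul_assoc, h, mul_smul_comm, ← mul_assoc, ih, smul_mul_assoc, smul_smul,
          mul_assoc, pow_succ' c]
    intro k
    induction k with
    | zero => exact ⟨1, by simp⟩
    | succ k ih =>
      obtain ⟨d, hd⟩ := ih
      refine ⟨d * c ^ k, ?_⟩
      rw [pow_succ, hd, smul_mul_assoc, mul_assoc (a ^ k), ← mul_assoc (b ^ k), hb,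
        smul_mul_assoc, mul_smul_comm, smul_smul, pow_succ a, pow_succ b]
      simp only [mul_assoc]
  obtain ⟨d, hd⟩ := key n
  rw [hd, ha, zero_mul, smul_zero]

/-- Transposition of endomorphisms. -/
abbrev tr {V : WtMod r} (f : Module.End ℂ V) : Module.End ℂ (Module.Dual ℂ V) :=
  LinearMap.dualMap f

theorem tr_mul {V : WtMod r} (f g : Module.End ℂ V) : tr f * tr g = tr (g * f) := rfl
theorem tr_smul {V : WtMod r} (c : ℂ) (f : Module.End ℂ V) : tr (c • f) = c • tr f := by
  ext; simp
theorem tr_sub {V : WtMod r} (f g : Module.End ℂ V) : tr (f - g) = tr f - tr g := by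
  ext; simp
theorem tr_one {V : WtMod r} : tr (1 : Module.End ℂ V) = 1 := rfl
theorem tr_zero {V : WtMod r} : tr (0 : Module.End ℂ V) = 0 := by
  ext; simp
theorem tr_pow {V : WtMod r} (f : Module.End ℂ V) (n : ℕ) : tr f ^ n = tr (f ^ n) := by
  induction n with
  | zero => rfl
  | succ n ih => rw [pow_succ, ih, tr_mul, ← pow_succ']

theorem dual_weight (V : WtMod r) :
    (⨆ μ, (tr (-V.H)).eigenspace μ = ⊤) ∧
    ∀ (μ : ℂ) (v : Module.Dual ℂ V), tr (-V.H) v = μ • v → tr V.Kinv v = qpow r μ • v := by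
  classical
  obtain ⟨ι, b, hb⟩ : ∃ (ι : Type) (b : Module.Basis ι ℂ V), ∀ i, ∃ μ : ℂ, V.H (b i) = μ • b i :=
    ⟨_, Module.Basis.ofSpan (span_eigenvectors V.weight).ge, fun i =>
      Module.Basis.ofSpan_subset (span_eigenvectors V.weight).ge ⟨i, rfl⟩⟩
  have : Finite ι := Module.Finite.finite_basis b
  cases nonempty_fintype ι
  refine weight_of_span (S := Set.range b.dualBasis) b.dualBasis.span_eq ?_
  rintro _ ⟨i, rfl⟩
  obtain ⟨μ, hμ⟩ := hb i
  have hK : ∀ j ν, V.H (b j) = ν • b j → V.Kinv (b j) = qpow r (-ν) • b j := by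
    intro j ν hν
    have h1 := congrArg (V.Kinv) (V.K_eq ν (b j) hν)
    rw [← Module.End.mul_apply, V.Kinv_K, map_smul, Module.End.one_apply] at h1
    rw [qpow_neg, eq_inv_smul_iff₀ (qpow_ne_zero r ν)]
    exact h1.symm
  refine ⟨-μ, ?_, ?_⟩
  · refine b.ext fun j => ?_
    obtain ⟨ν, hν⟩ := hb j
    by_cases hij : j = i
    · subst hij
      simp [hμ]
    · simp [hν, hij]
  · refine b.ext fun j => ?_
    obtain ⟨ν, hν⟩ := hb j
    by_cases hij : j = i
    · subst hij
      simp [hK j μ hμ]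
    · simp [hK j ν hν, hij]

/-- The dual module: `(x f)(v) = f (S(x) v)` with the antipode `S(E) = -E K⁻¹`, `S(F) = -K F`,
`S(K) = K⁻¹`, `S(H) = -H`. -/
def dual (V : WtMod r) : WtMod r where
  carrier := Module.Dual ℂ V
  E := tr (-(V.E * V.Kinv))
  F := tr (-(V.K * V.F))
  K := tr V.Kinv
  Kinv := tr V.K
  H := tr (-V.H)
  K_Kinv := by rw [tr_mul, V.K_Kinv, tr_one]
  Kinv_K := by rw [tr_mul, V.Kinv_K, tr_one]
  K_E := by
    rw [tr_mul, tr_mul, ← tr_smul, smul_neg, ← smul_mul_assoc, ← V.K_E]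
    congr 1
    simp only [mul_neg, neg_mul, mul_assoc]
  K_F := by
    rw [tr_mul, tr_mul, ← tr_smul, smul_neg, ← mul_smul_comm, ← V.K_F]
    congr 1
    simp only [mul_neg, neg_mul, mul_assoc]
  E_F := by
    rw [tr_mul, tr_mul, ← tr_sub, ← tr_sub, ← tr_smul]
    congr 1
    have h1 : V.K * V.F * (V.E * V.Kinv) = V.F * V.E := by
      rw [V.KF, V.EKinv, smul_mul_assoc, mul_smul_comm, smul_smul, ← qpow_add, mul_assoc,
        ← mul_assoc V.K, V.K_Kinv]
      simp [qpow_zero]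
    have h2 : V.E * V.Kinv * (V.K * V.F) = V.E * V.F := by
      rw [mul_assoc, ← mul_assoc V.Kinv, V.Kinv_K, one_mul]
    rw [neg_mul_neg, neg_mul_neg, h1, h2, ← neg_sub, V.E_F, ← smul_neg, neg_sub]
  H_K := by
    rw [tr_mul, tr_mul, neg_mul, mul_neg, V.H_Kinv]
  H_E := by
    have h : V.H * (V.E * V.Kinv) - V.E * V.Kinv * V.H = (2 : ℂ) • (V.E * V.Kinv) := by
      rw [mul_assoc, ← V.H_Kinv, ← mul_assoc, ← mul_assoc, ← sub_mul, V.H_E, smul_mul_assoc]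
    rw [tr_mul, tr_mul, ← tr_smul, ← tr_sub]
    congr 1
    rw [smul_neg, ← h]
    simp only [mul_neg, neg_mul]
    abel
  H_F := by
    have h : V.H * (V.K * V.F) - V.K * V.F * V.H = (-2 : ℂ) • (V.K * V.F) := by
      rw [← mul_assoc, V.H_K, mul_assoc, mul_assoc, ← mul_sub, V.H_F, mul_smul_comm]
    rw [tr_mul, tr_mul, ← tr_smul, ← tr_sub]
    congr 1
    rw [smul_neg, ← h]
    simp only [mul_neg, neg_mul]
    abel
  E_pow := by
    have h : (V.E * V.Kinv) ^ r = 0 := by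
      refine pow_mul_eq_zero (c := qpow r (-2)) ?_ V.E_pow
      rw [V.EKinv, smul_smul, ← qpow_add]
      simp [qpow_zero]
    rw [tr_pow, neg_pow, h, mul_zero, tr_zero]
  F_pow := by
    have h : (V.K * V.F) ^ r = 0 := by
      rw [V.KF, smul_pow, pow_mul_eq_zero V.KF V.F_pow, smul_zero]
    rw [tr_pow, neg_pow, h, mul_zero, tr_zero]
  weight := V.dual_weight.1
  K_eq := V.dual_weight.2

/-! ### Highest weight modules -/

section HighestWeight

/-- The vector `v_k` of `ℂ ^ N` (zero when `k ≥ N`). -/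
def hwVec (N k : ℕ) : Fin N → ℂ := fun i => if (i : ℕ) = k then 1 else 0

/-- The endomorphism of `ℂ ^ N` sending the basis vector `v_i` to `f i`. -/
def hwOp (N : ℕ) (f : ℕ → Fin N → ℂ) : Module.End ℂ (Fin N → ℂ) :=
  (Pi.basisFun ℂ (Fin N)).constr ℂ fun i => f i

theorem hwVec_of_le {N k : ℕ} (h : N ≤ k) : hwVec N k = 0 := by
  funext i
  simp only [hwVec, Pi.zero_apply, ite_eq_right_iff]
  intro hi
  omega

theorem basisFun_eq (N : ℕ) (i : Fin N) : Pi.basisFun ℂ (Fin N) i = hwVec N i := by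
  funext j
  simp [hwVec, Pi.single_apply, Fin.ext_iff]

theorem hwOp_apply {N k : ℕ} (f : ℕ → Fin N → ℂ) (h : k < N) :
    hwOp N f (hwVec N k) = f k := by
  have := (Pi.basisFun ℂ (Fin N)).constr_basis ℂ (fun i : Fin N => f i) ⟨k, h⟩
  rw [basisFun_eq] at this
  exact this

theorem hw_ext {N : ℕ} {f g : Module.End ℂ (Fin N → ℂ)}
    (h : ∀ k < N, f (hwVec N k) = g (hwVec N k)) : f = g := by
  refine (Pi.basisFun ℂ (Fin N)).ext fun i => ?_
  rw [basisFun_eq]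
  exact h i i.2

/-- The coefficient `{i} {l + 1 - i} / {1} ^ 2`. -/
def hwCoeff (r : ℕ) (l : ℂ) (i : ℕ) : ℂ := qbr r i * qbr r (l + 1 - i) / qbr r 1 ^ 2

theorem hwCoeff_zero (r : ℕ) (l : ℂ) : hwCoeff r l 0 = 0 := by simp [hwCoeff, qbr_zero]

theorem hwCoeff_succ_sub (r : ℕ) [r.AtLeastTwo] (l : ℂ) (i : ℕ) :
    hwCoeff r l (i + 1) - hwCoeff r l i
      = (qbr r 1)⁻¹ * (qpow r (l - 2 * i) - qpow r (-(l - 2 * i))) := by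
  have h0 := qbr_one_ne_zero r
  have e1 : qbr r ((i + 1 : ℕ) : ℂ) = qpow r i * qpow r 1 - (qpow r i)⁻¹ * (qpow r 1)⁻¹ := by
    rw [qbr, qpow_neg, Nat.cast_add, Nat.cast_one, qpow_add, mul_inv]
  have e2 : qbr r (l + 1 - ((i + 1 : ℕ) : ℂ))
      = qpow r l * (qpow r i)⁻¹ - (qpow r l)⁻¹ * qpow r i := by
    rw [show l + 1 - ((i + 1 : ℕ) : ℂ) = l + -(i : ℂ) by push_cast; ring, qbr, qpow_neg, qpow_add,
      qpow_neg, mul_inv, inv_inv]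
  have e3 : qbr r (l + 1 - (i : ℂ)) = qpow r l * qpow r 1 * (qpow r i)⁻¹
      - (qpow r l)⁻¹ * (qpow r 1)⁻¹ * qpow r i := by
    rw [show l + 1 - (i : ℂ) = l + 1 + -(i : ℂ) by ring, qbr, qpow_neg, qpow_add, qpow_add,
      qpow_neg, mul_inv, mul_inv, inv_inv]
  have e4 : qpow r (l - 2 * i) = qpow r l * (qpow r i)⁻¹ * (qpow r i)⁻¹ := by
    rw [show l - 2 * i = l + -(i : ℂ) + -(i : ℂ) by ring, qpow_add, qpow_add, qpow_neg]
  have e5 : qbr r 1 = qpow r 1 - (qpow r 1)⁻¹ := by rw [qbr, qpow_neg]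
  have e6 : qbr r (i : ℂ) = qpow r i - (qpow r i)⁻¹ := by rw [qbr, qpow_neg]
  have ha := qpow_ne_zero r i
  have hl := qpow_ne_zero r l
  have hq := qpow_ne_zero r 1
  have h1 : qbr r ((i + 1 : ℕ) : ℂ) * qbr r (l + 1 - ((i + 1 : ℕ) : ℂ))
      - qbr r i * qbr r (l + 1 - i)
      = qbr r 1 * (qpow r (l - 2 * i) - qpow r (-(l - 2 * i))) := by
    rw [qpow_neg, e1, e2, e3, e4, e5, e6]
    field_simp
    ring
  rw [hwCoeff, hwCoeff, ← sub_div, h1]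
  field_simp

variable (r N : ℕ) (l : ℂ)

def hwE : Module.End ℂ (Fin N → ℂ) := hwOp N fun i => hwCoeff r l i • hwVec N (i - 1)
def hwF : Module.End ℂ (Fin N → ℂ) := hwOp N fun i => hwVec N (i + 1)
def hwK : Module.End ℂ (Fin N → ℂ) := hwOp N fun i => qpow r (l - 2 * i) • hwVec N i
def hwKinv : Module.End ℂ (Fin N → ℂ) := hwOp N fun i => qpow r (-(l - 2 * i)) • hwVec N i
def hwH : Module.End ℂ (Fin N → ℂ) := hwOp N fun i => (l - 2 * i) • hwVec N i

variable {N}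
variable {k : ℕ}

theorem hwE_apply (h : k < N) :
    hwE r N l (hwVec N k) = hwCoeff r l k • hwVec N (k - 1) := hwOp_apply _ h

theorem hwF_apply (k : ℕ) : hwF N (hwVec N k) = hwVec N (k + 1) := by
  rcases lt_or_ge k N with h | h
  · exact hwOp_apply _ h
  · rw [hwVec_of_le h, hwVec_of_le (by omega), map_zero]

theorem hwK_apply (k : ℕ) : hwK r N l (hwVec N k) = qpow r (l - 2 * k) • hwVec N k := by
  rcases lt_or_ge k N with h | h
  · exact hwOp_apply _ h
  · rw [hwVec_of_le h, map_zero, smul_zero]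

theorem hwKinv_apply (k : ℕ) :
    hwKinv r N l (hwVec N k) = qpow r (-(l - 2 * k)) • hwVec N k := by
  rcases lt_or_ge k N with h | h
  · exact hwOp_apply _ h
  · rw [hwVec_of_le h, map_zero, smul_zero]

theorem hwH_apply (k : ℕ) : hwH N l (hwVec N k) = (l - 2 * k) • hwVec N k := by
  rcases lt_or_ge k N with h | h
  · exact hwOp_apply _ h
  · rw [hwVec_of_le h, map_zero, smul_zero]

theorem hwF_pow (n k : ℕ) : (hwF N ^ n) (hwVec N k) = hwVec N (k + n) := by
  induction n with
  | zero => rfl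
  | succ n ih => rw [pow_succ', Module.End.mul_apply, ih, hwF_apply, add_assoc]

theorem hwE_pow (n k : ℕ) (hk : k < n) : (hwE r N l ^ n) (hwVec N k) = 0 := by
  induction n generalizing k with
  | zero => omega
  | succ n ih =>
    rcases lt_or_ge k N with h | h
    · rw [pow_succ, Module.End.mul_apply, hwE_apply r l h, map_smul]
      rcases Nat.eq_zero_or_pos k with rfl | h0
      · rw [hwCoeff_zero, zero_smul]
      · rw [ih (k - 1) (by omega), smul_zero]
    · rw [hwVec_of_le h, map_zero]

theorem hw_weight : (⨆ μ, (hwH N l).eigenspace μ = ⊤) ∧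
    ∀ (μ : ℂ) (v : Fin N → ℂ), hwH N l v = μ • v → hwK r N l v = qpow r μ • v := by
  refine weight_of_span (S := Set.range (Pi.basisFun ℂ (Fin N))) (Module.Basis.span_eq _) ?_
  rintro _ ⟨i, rfl⟩
  rw [basisFun_eq]
  exact ⟨_, hwH_apply l i, hwK_apply r l i⟩

/-- The `N`-dimensional highest weight module with highest weight `l` and basis
`v_0, …, v_{N-1}`: `H v_i = (l - 2 i) v_i`, `E v_i = ({i} {l + 1 - i} / {1} ^ 2) v_{i-1}` and
`F v_i = v_{i+1}` (with `v_N = 0`); it exists if `N ≤ r` and `{N} {l + 1 - N} = 0`. -/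
def hw (r : ℕ) [r.AtLeastTwo] (N : ℕ) (l : ℂ) (hN : N ≤ r) (hl : hwCoeff r l N = 0) :
    WtMod r where
  carrier := Fin N → ℂ
  E := hwE r N l
  F := hwF N
  K := hwK r N l
  Kinv := hwKinv r N l
  H := hwH N l
  K_Kinv := hw_ext fun k _ => by
    rw [Module.End.mul_apply, hwKinv_apply, map_smul, hwK_apply, smul_smul, ← qpow_add]
    simp [qpow_zero]
  Kinv_K := hw_ext fun k _ => by
    rw [Module.End.mul_apply, hwK_apply, map_smul, hwKinv_apply, smul_smul, ← qpow_add]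
    simp [qpow_zero]
  K_E := hw_ext fun k hk => by
    rw [Module.End.mul_apply, Module.End.mul_apply, hwKinv_apply, map_smul, map_smul,
      LinearMap.smul_apply, hwE_apply r l hk, map_smul, hwK_apply]
    rcases Nat.eq_zero_or_pos k with rfl | h0
    · simp [hwCoeff_zero]
    · obtain ⟨m, rfl⟩ := Nat.exists_eq_succ_of_ne_zero h0.ne'
      simp only [Nat.succ_eq_add_one, Nat.add_sub_cancel, smul_smul]
      rw [mul_left_comm, ← qpow_add, mul_comm]
      congr 3
      push_cast
      ring
  K_F := hw_ext fun k hk => by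
    rw [Module.End.mul_apply, Module.End.mul_apply, hwKinv_apply, map_smul, map_smul,
      LinearMap.smul_apply, hwF_apply, hwK_apply, smul_smul, ← qpow_add]
    congr 2
    push_cast
    ring
  E_F := hw_ext fun k hk => by
    have h1 : (hwE r N l * hwF N) (hwVec N k) = hwCoeff r l (k + 1) • hwVec N k := by
      rw [Module.End.mul_apply, hwF_apply]
      rcases (show k + 1 < N ∨ k + 1 = N by omega) with h | h
      · rw [hwE_apply r l h, Nat.add_sub_cancel]
      · rw [h, hl, hwVec_of_le le_rfl, map_zero, zero_smul]
    have h2 : (hwF N * hwE r N l) (hwVec N k) = hwCoeff r l k • hwVec N k := by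
      rw [Module.End.mul_apply, hwE_apply r l hk, map_smul, hwF_apply]
      rcases Nat.eq_zero_or_pos k with rfl | h0
      · simp [hwCoeff_zero]
      · rw [Nat.sub_add_cancel h0]
    rw [LinearMap.sub_apply, h1, h2, ← sub_smul, hwCoeff_succ_sub, LinearMap.smul_apply,
      LinearMap.sub_apply, hwK_apply, hwKinv_apply, ← sub_smul, smul_smul]
  H_K := hw_ext fun k _ => by
    rw [Module.End.mul_apply, Module.End.mul_apply, hwK_apply, hwH_apply, map_smul, map_smul,
      hwH_apply, hwK_apply, smul_comm]
  H_E := hw_ext fun k hk => by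
    rw [LinearMap.sub_apply, Module.End.mul_apply, Module.End.mul_apply, hwH_apply, map_smul,
      hwE_apply r l hk, map_smul, hwH_apply, LinearMap.smul_apply, hwE_apply r l hk]
    rcases Nat.eq_zero_or_pos k with rfl | h0
    · simp [hwCoeff_zero]
    · obtain ⟨m, rfl⟩ := Nat.exists_eq_succ_of_ne_zero h0.ne'
      simp only [Nat.succ_eq_add_one, Nat.add_sub_cancel, smul_smul, ← sub_smul]
      congr 1
      push_cast
      ring
  H_F := hw_ext fun k hk => by
    rw [LinearMap.sub_apply, Module.End.mul_apply, Module.End.mul_apply, hwH_apply, map_smul,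
      hwF_apply, hwH_apply, LinearMap.smul_apply, hwF_apply, ← sub_smul]
    congr 1
    push_cast
    ring
  E_pow := hw_ext fun k hk => hwE_pow r l r k (by omega)
  F_pow := hw_ext fun k hk => by
    rw [hwF_pow, hwVec_of_le (by omega), LinearMap.zero_apply]
  weight := (hw_weight r l).1
  K_eq := (hw_weight r l).2

end HighestWeight

/-- The `r`-dimensional module `V_α` of highest weight `α + r - 1`
(note `{α + r - i} = {i - α}`). -/
def Vmod (r : ℕ) [r.AtLeastTwo] (α : ℂ) : WtMod r :=
  hw r r (α + r - 1) le_rfl (by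
    have := qbr_int_mul r (NeZero.ne r) 1
    simp only [Int.cast_one, one_mul] at this
    simp [hwCoeff, this])

/-- The `(n+1)`-dimensional simple module `S_n` of highest weight `n`, for `0 ≤ n ≤ r - 2`. -/
def Smod (r : ℕ) [r.AtLeastTwo] (n : ℕ) (hn : n + 2 ≤ r) : WtMod r :=
  hw r (n + 1) n (by omega) (by simp [hwCoeff, qbr_zero])

/-- The one-dimensional module `ℂ^H_{ar}` on which `H` acts by `a r` and `E`, `F` by `0`. -/
def Cmod (r : ℕ) [r.AtLeastTwo] (a : ℤ) : WtMod r :=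
  hw r 1 (a * r) NeZero.one_le (by
    have := qbr_int_mul r (NeZero.ne r) a
    simp [hwCoeff, this])

end WtMod

/-! ### The subcategory generated by the standard modules with real weights -/

section Generated

variable {r : ℕ} [r.AtLeastTwo]

/-- `P` is an indecomposable projective cover of `S` in the category of weight modules. -/
structure IsProjCover (P S : WtMod r) : Prop where
  projective : Projective P
  not_zero : ¬ Limits.IsZero P
  indecomposable : ∀ e : P ⟶ P, e ≫ e = e → e = 0 ∨ e = 𝟙 P
  cover : ∃ f : P ⟶ S, Function.Surjective (WtMod.lin f)

/-- The generating set: `V_α` (`α ∈ (ℝ ∖ ℤ) ∪ r ℤ`), `S_n`, `P_i` (the indecomposable projective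
cover of `S_i`, `0 ≤ n, i ≤ r - 2`) and `ℂ^H_{ar}` (`a ∈ ℤ`). -/
inductive Generator : WtMod r → Prop
  | V (α : ℝ) (hα : (¬ ∃ n : ℤ, α = n) ∨ ∃ k : ℤ, α = k * r) : Generator (WtMod.Vmod r (α : ℂ))
  | S (n : ℕ) (hn : n + 2 ≤ r) : Generator (WtMod.Smod r n hn)
  | P (i : ℕ) (hi : i + 2 ≤ r) (X : WtMod r) (hX : IsProjCover X (WtMod.Smod r i hi)) :
      Generator X
  | C (a : ℤ) : Generator (WtMod.Cmod r a)

/-- Iterated tensor product `X₁ ⊗ (X₂ ⊗ ⋯)`. -/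
def listTensor : List (WtMod r) → WtMod r
  | [] => WtMod.unit r
  | X :: L => X.tensor (listTensor L)

/-- `Y` is a retract of a tensor product of generators and duals of generators. -/
def IsGeneratedRetract (Y : WtMod r) : Prop :=
  ∃ L : List (WtMod r), (∀ Z ∈ L, Generator Z ∨ ∃ Z', Generator Z' ∧ Z = Z'.dual) ∧
    Nonempty (Retract Y (listTensor L))

/-- `X` belongs to the category generated by the standard modules: it is a finite direct sum of
retracts of tensor products of generators and their duals. -/
def InD (X : WtMod r) : Prop :=
  ∃ (n : ℕ) (Y : Fin n → WtMod r) (b : Limits.Bicone Y),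
    (∀ i, IsGeneratedRetract (Y i)) ∧ Nonempty b.IsBilimit ∧ Nonempty (b.pt ≅ X)

theorem inD_unit : InD (WtMod.unit r) := by
  let b : Limits.Bicone (fun _ : Fin 1 => WtMod.unit r) :=
    { pt := WtMod.unit r
      π := fun _ => 𝟙 _
      ι := fun _ => 𝟙 _
      ι_π := fun j j' => by
        have h : j = j' := Subsingleton.elim _ _
        subst h
        simp }
  refine ⟨1, fun _ => WtMod.unit r, b, fun _ => ⟨[], by simp, ⟨Retract.refl _⟩⟩,
    ⟨Limits.isBilimitOfTotal b ?_⟩, ⟨Iso.refl _⟩⟩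
  simp [b]

end Generated

/-! ### Braiding, twist, half twist -/

section Braiding

variable {r : ℕ}

/-- The operator `q ^ (H ⊗ H / 2)`: it multiplies `v ⊗ w` by `q ^ (a b / 2)` for `v`, `w` of
weights `a`, `b` (see `qHH_tmul`). The factors `opFun V.H (Set.indicator {a} 1)` are the
projections onto the weight spaces. -/
def qHH (V W : WtMod r) : Module.End ℂ (V ⊗[ℂ] W) :=
  ∑ a ∈ weights V.H, TensorProduct.map (opFun V.H (Set.indicator {a} 1))
    (opFun W.H fun b => qpow r (a * b / 2))

theorem qHH_tmul (V W : WtMod r) {a b : ℂ} {v : V} {w : W} (hv : V.H v = a • v)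
    (hw : W.H w = b • w) : qHH V W (v ⊗ₜ w) = qpow r (a * b / 2) • (v ⊗ₜ w) := by
  rcases eq_or_ne v 0 with rfl | hv0
  · simp
  have ha : a ∈ weights V.H := by
    simp only [weights, Set.Finite.mem_toFinset, Set.mem_ofPred_eq]
    exact Module.End.hasEigenvalue_of_hasEigenvector
      ⟨Module.End.mem_eigenspace_iff.2 hv, hv0⟩
  rw [qHH, LinearMap.sum_apply, Finset.sum_eq_single_of_mem a ha]
  · rw [TensorProduct.map_tmul, opFun_apply _ _ hv, opFun_apply _ _ hw]
    simp
  · intro c _ hc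
    rw [TensorProduct.map_tmul, opFun_apply _ _ hv]
    simp [Set.indicator_of_notMem, hc.symm]

/-- The coefficient `{1} ^ (2 n) / {n}! * q ^ (n (n - 1) / 2)`. -/
def rCoeff (r n : ℕ) : ℂ :=
  qbr r 1 ^ (2 * n) / qfact r n * qpow r ((n : ℂ) * ((n : ℂ) - 1) / 2)

/-- The action of the truncated `R`-matrix
`R = q ^ (H ⊗ H / 2) ∑_{n < r} {1} ^ (2 n) / {n}! q ^ (n (n - 1) / 2) E ^ n ⊗ F ^ n`. -/
def rMatrix (V W : WtMod r) : Module.End ℂ (V ⊗[ℂ] W) :=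
  qHH V W * ∑ n ∈ Finset.range r, rCoeff r n • TensorProduct.map (V.E ^ n) (W.F ^ n)

/-- The braiding `c_{V,W} = τ R`, with `τ` the flip. -/
def braiding (V W : WtMod r) : V ⊗[ℂ] W →ₗ[ℂ] W ⊗[ℂ] V :=
  (TensorProduct.comm ℂ V W).toLinearMap ∘ₗ rMatrix V W

/-- The operator
`θ = K ^ (r - 1) ∑_{n < r} {1} ^ (2 n) / {n}! q ^ (n (n - 1) / 2) S(F ^ n) q ^ (- H ^ 2 / 2) E ^ n`,
where `S(F) = - K F`. -/
def thetaOp (V : WtMod r) : Module.End ℂ V :=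
  V.K ^ (r - 1) * ∑ n ∈ Finset.range r,
    rCoeff r n • ((-(V.K * V.F)) ^ n * opFun V.H (fun a => qpow r (-(a ^ 2) / 2)) * V.E ^ n)

/-- The twist `θ_V`, the action of `θ⁻¹`. -/
def twist (V : WtMod r) : Module.End ℂ V := Ring.inverse (thetaOp V)

/-- A half twist: a natural automorphism of the identity functor whose square is the twist, which
is compatible with duality and trivial on the unit object. -/
structure HalfTwist (r : ℕ) [r.AtLeastTwo] where
  iso : 𝟭 (WtMod r) ≅ 𝟭 (WtMod r)
  sq : ∀ V : WtMod r,
    (WtMod.lin (V := V) (W := V) (iso.hom.app V)) ∘ₗ WtMod.lin (V := V) (W := V) (iso.hom.app V)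
      = twist V
  dual : ∀ V : WtMod r, WtMod.lin (V := V.dual) (W := V.dual) (iso.hom.app V.dual)
    = LinearMap.dualMap (WtMod.lin (V := V) (W := V) (iso.hom.app V))
  unit : iso.hom.app (WtMod.unit r) = 𝟙 (WtMod.unit r)

variable [r.AtLeastTwo]

namespace HalfTwist

/-- The endomorphism `√θ_V`. -/
def app (s : HalfTwist r) (V : WtMod r) : Module.End ℂ V :=
  WtMod.lin (V := V) (W := V) (s.iso.hom.app V)

/-- The inverse of `√θ_V`. -/
def inv (s : HalfTwist r) (V : WtMod r) : Module.End ℂ V :=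
  WtMod.lin (V := V) (W := V) (s.iso.inv.app V)

/-- `⟨√θ_V⟩ = c`: the endomorphism `√θ_V - c` is nilpotent. -/
def HasValue (s : HalfTwist r) (V : WtMod r) (c : ℂ) : Prop :=
  IsNilpotent (s.app V - c • (1 : Module.End ℂ V))

/-- The half twist takes the prescribed values on the simple modules. -/
structure IsStandard (s : HalfTwist r) : Prop where
  V : ∀ α : ℂ, ((¬ ∃ n : ℤ, α = n) ∨ ∃ k : ℤ, α = k * r) →
    s.HasValue (WtMod.Vmod r α) (qpow r ((α ^ 2 - ((r : ℂ) - 1) ^ 2) / 4))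
  S : ∀ (i : ℕ) (hi : i + 2 ≤ r),
    s.HasValue (WtMod.Smod r i hi) (qpow r ((i : ℂ) * ((i : ℂ) + 2 - 2 * r) / 4))
  S_even : ∀ (i : ℕ) (hi : i + 2 ≤ r) (k : ℤ), Even k →
    s.HasValue ((WtMod.Smod r i hi).tensor (WtMod.Cmod r k))
      (qpow r ((i : ℂ) * ((i : ℂ) + 2 - 2 * r) / 4))
  S_odd : ∀ (i : ℕ) (hi : i + 2 ≤ r) (j : ℕ), i + j + 2 = r → ∀ k : ℤ, Odd k →
    s.HasValue ((WtMod.Smod r i hi).tensor (WtMod.Cmod r k))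
      (qpow r ((j : ℂ) * ((j : ℂ) + 2 - 2 * r) / 4))

/-- `X_{V,W} = (√θ_{W ⊗ V})⁻¹ c_{V,W} (√θ_V ⊗ √θ_W)`. -/
def X (s : HalfTwist r) (V W : WtMod r) : V ⊗[ℂ] W →ₗ[ℂ] W ⊗[ℂ] V :=
  (s.inv (W.tensor V) : W ⊗[ℂ] V →ₗ[ℂ] W ⊗[ℂ] V) ∘ₗ braiding V W ∘ₗ
    TensorProduct.map (s.app V) (s.app W)

end HalfTwist

end Braiding

/-! ### Hermitian modules -/

section Hermitian

variable {r : ℕ}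

/-- Sesquilinear forms, antilinear in the first variable. -/
abbrev Sesq (V : WtMod r) : Type := V →ₗ⋆[ℂ] V →ₗ[ℂ] ℂ

/-- A Hermitian structure: a non-degenerate Hermitian form compatible with the antilinear
anti-involution `E ↦ F`, `F ↦ E`, `K ↦ K⁻¹`, `H ↦ H`, that is `(x† v, w) = (v, x w)` for `x` in
the algebra (equivalently for `x` among its generators). -/
structure IsHermitianStructure (V : WtMod r) (f : Sesq V) : Prop where
  conj_symm : ∀ v w, f v w = (starRingEnd ℂ) (f w v)
  nondegenerate : ∀ v, (∀ w, f v w = 0) → v = 0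
  E : ∀ v w, f (V.F v) w = f v (V.E w)
  F : ∀ v w, f (V.E v) w = f v (V.F w)
  K : ∀ v w, f (V.Kinv v) w = f v (V.K w)
  Kinv : ∀ v w, f (V.K v) w = f v (V.Kinv w)
  H : ∀ v w, f (V.H v) w = f v (V.H w)

/-- The product form `(x ⊗ y, x' ⊗ y')_p = (x, x') (y, y')`. -/
def prodForm {V W : WtMod r} (f : Sesq V) (g : Sesq W) :
    V ⊗[ℂ] W →ₗ⋆[ℂ] V ⊗[ℂ] W →ₗ[ℂ] ℂ :=
  (TensorProduct.dualDistrib ℂ V W).comp (TensorProduct.map f g)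

theorem prodForm_tmul {V W : WtMod r} (f : Sesq V) (g : Sesq W) (x x' : V) (y y' : W) :
    prodForm f g (x ⊗ₜ y) (x' ⊗ₜ y') = f x x' * g y y' := rfl

variable [r.AtLeastTwo]

/-- The form `(v, v') = (v, τ (X_{V,W} v'))_p` on `V ⊗ W`. -/
def tensorForm (s : HalfTwist r) {V W : WtMod r} (f : Sesq V) (g : Sesq W) :
    Sesq (V.tensor W) :=
  (prodForm f g).compl₂ ((TensorProduct.comm ℂ W V).toLinearMap ∘ₗ s.X V W)

theorem tensorForm_apply (s : HalfTwist r) {V W : WtMod r} (f : Sesq V) (g : Sesq W)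
    (v v' : V ⊗[ℂ] W) :
    tensorForm s f g v v' = prodForm f g v (TensorProduct.comm ℂ W V (s.X V W v')) := rfl

/-- The form `(a, b) = ā b` on the trivial module, with `(1, 1) = 1`. -/
def unitForm (r : ℕ) [r.AtLeastTwo] : Sesq (WtMod.unit r) :=
  LinearMap.mk₂'ₛₗ (M := ℂ) (N := ℂ) (P := ℂ) (starRingEnd ℂ) (RingHom.id ℂ)
    (fun a b : ℂ => (starRingEnd ℂ) a * b)
    (by intro a b c; simp [add_mul]) (by intro a b c; simp [mul_assoc])
    (by intro a b c; simp [mul_add]) (by intro a b c; simp [mul_left_comm])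

theorem unitForm_apply (a b : ℂ) : unitForm r a b = (starRingEnd ℂ) a * b := rfl

theorem isHermitianStructure_unitForm : IsHermitianStructure (WtMod.unit r) (unitForm r) where
  conj_symm := fun (v w : ℂ) => by
    rw [unitForm_apply, unitForm_apply, map_mul, Complex.conj_conj, mul_comm]
  nondegenerate := fun (v : ℂ) h => by
    have h1 := h (1 : ℂ)
    rw [unitForm_apply, mul_one] at h1
    exact (map_eq_zero _).1 h1
  E _ _ := ((unitForm r).map_zero₂ _).trans (map_zero _).symm
  F _ _ := ((unitForm r).map_zero₂ _).trans (map_zero _).symm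
  K _ _ := rfl
  Kinv _ _ := rfl
  H _ _ := ((unitForm r).map_zero₂ _).trans (map_zero _).symm

end Hermitian

/-! ### The category of Hermitian modules in the generated subcategory -/

/-- Hermitian modules whose underlying module lies in the generated subcategory. -/
structure DDag (r : ℕ) [r.AtLeastTwo] where
  toMod : WtMod r
  form : Sesq toMod
  isHermitian : IsHermitianStructure toMod form
  mem : InD toMod

namespace DDag

variable {r : ℕ} [r.AtLeastTwo]

/-- Morphisms are all morphisms of the underlying modules. -/
instance : Category (DDag r) where
  Hom V W := V.toMod ⟶ W.toMod
  id V := 𝟙 V.toMod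
  comp f g := CategoryStruct.comp (obj := WtMod r) f g

instance : Preadditive (DDag r) where
  homGroup V W := inferInstanceAs (AddCommGroup (V.toMod ⟶ W.toMod))
  add_comp _ _ _ f f' g := Preadditive.add_comp (C := WtMod r) _ _ _ f f' g
  comp_add _ _ _ f g g' := Preadditive.comp_add (C := WtMod r) _ _ _ f g g'

instance : Linear ℂ (DDag r) where
  homModule V W := inferInstanceAs (Module ℂ (V.toMod ⟶ W.toMod))
  smul_comp _ _ _ c f g := Linear.smul_comp (C := WtMod r) _ _ _ c f g
  comp_smul _ _ _ f c g := Linear.comp_smul (C := WtMod r) _ _ _ f c g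

/-- The linear map underlying a morphism. -/
def lin {V W : DDag r} (f : V ⟶ W) : V.toMod →ₗ[ℂ] W.toMod :=
  WtMod.lin (V := V.toMod) (W := W.toMod) f

/-- A morphism of Hermitian modules preserving the Hermitian forms. -/
def IsIsometry {V W : DDag r} (f : V ⟶ W) : Prop :=
  ∀ x y, W.form (lin f x) (lin f y) = V.form x y

/-- The trivial module with its Hermitian form. -/
def unit (r : ℕ) [r.AtLeastTwo] : DDag r where
  toMod := WtMod.unit r
  form := unitForm r
  isHermitian := isHermitianStructure_unitForm
  mem := inD_unit

/-- The morphism given by a linear isomorphism commuting with the action. -/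
def isoMk {V W : DDag r} (e : V.toMod ≃ₗ[ℂ] W.toMod)
    (h : e.toLinearMap ∈ WtMod.homs V.toMod W.toMod) : V ≅ W where
  hom := (⟨e.toLinearMap, h⟩ : WtMod.homs V.toMod W.toMod)
  inv := (⟨e.symm.toLinearMap, by
    obtain ⟨h1, h2, h3, h4⟩ := h
    have key : ∀ (f : Module.End ℂ V.toMod) (g : Module.End ℂ W.toMod),
        e.toLinearMap ∘ₗ f = g ∘ₗ e.toLinearMap →
          e.symm.toLinearMap ∘ₗ g = f ∘ₗ e.symm.toLinearMap := by
      intro f g hfg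
      ext x
      have := LinearMap.congr_fun hfg (e.symm x)
      simp only [LinearMap.comp_apply, LinearEquiv.coe_coe, LinearEquiv.apply_symm_apply] at this
      simp [← this]
    exact ⟨key _ _ h1, key _ _ h2, key _ _ h3, key _ _ h4⟩⟩ : WtMod.homs W.toMod V.toMod)
  hom_inv_id := Subtype.ext (LinearMap.ext fun x => e.symm_apply_apply x)
  inv_hom_id := Subtype.ext (LinearMap.ext fun x => e.apply_symm_apply x)

theorem homs_Kinv {V W : WtMod r} {f : V →ₗ[ℂ] W} (hf : f ∈ WtMod.homs V W) (v : V) :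
    f (V.Kinv v) = W.Kinv (f v) := by
  have h := LinearMap.congr_fun hf.2.2.1 (V.Kinv v)
  simp only [LinearMap.comp_apply] at h
  rw [← Module.End.mul_apply, V.K_Kinv, Module.End.one_apply] at h
  rw [h, ← Module.End.mul_apply, W.Kinv_K, Module.End.one_apply]

theorem map_mem_homs {V V' W W' : WtMod r} {f : V →ₗ[ℂ] V'} {g : W →ₗ[ℂ] W'}
    (hf : f ∈ WtMod.homs V V') (hg : g ∈ WtMod.homs W W') :
    TensorProduct.map f g ∈ WtMod.homs (V.tensor W) (V'.tensor W') := by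
  have hi := homs_Kinv hf
  obtain ⟨h1, h2, h3, h4⟩ := hf
  obtain ⟨k1, k2, k3, k4⟩ := hg
  replace h1 := LinearMap.congr_fun h1
  replace h2 := LinearMap.congr_fun h2
  replace h3 := LinearMap.congr_fun h3
  replace h4 := LinearMap.congr_fun h4
  replace k1 := LinearMap.congr_fun k1
  replace k2 := LinearMap.congr_fun k2
  replace k3 := LinearMap.congr_fun k3
  replace k4 := LinearMap.congr_fun k4
  simp only [LinearMap.comp_apply] at h1 h2 h3 h4 k1 k2 k3 k4
  refine ⟨?_, ?_, ?_, ?_⟩ <;> refine TensorProduct.ext' fun v w => ?_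
  · change TensorProduct.map f g (WtMod.tensorE V W (v ⊗ₜ w))
      = WtMod.tensorE V' W' (TensorProduct.map f g (v ⊗ₜ w))
    simp [WtMod.tensorE, h1, k1, k3]
  · change TensorProduct.map f g (WtMod.tensorF V W (v ⊗ₜ w))
      = WtMod.tensorF V' W' (TensorProduct.map f g (v ⊗ₜ w))
    simp [WtMod.tensorF, h2, k2, hi]
  · change TensorProduct.map f g (TensorProduct.map V.K W.K (v ⊗ₜ w))
      = TensorProduct.map V'.K W'.K (TensorProduct.map f g (v ⊗ₜ w))
    simp [h3, k3]
  · change TensorProduct.map f g (WtMod.tensorH V W (v ⊗ₜ w))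
      = WtMod.tensorH V' W' (TensorProduct.map f g (v ⊗ₜ w))
    simp [WtMod.tensorH, h4, k4]

theorem assoc_mem_homs (U V W : WtMod r) :
    (TensorProduct.assoc ℂ U V W).toLinearMap ∈
      WtMod.homs ((U.tensor V).tensor W) (U.tensor (V.tensor W)) := by
  refine ⟨?_, ?_, ?_, ?_⟩ <;> refine TensorProduct.ext_threefold fun u v w => ?_
  · change TensorProduct.assoc ℂ U V W ((1 : Module.End ℂ (U ⊗[ℂ] V)) (u ⊗ₜ v) ⊗ₜ W.E w
      + WtMod.tensorE U V (u ⊗ₜ v) ⊗ₜ W.K w)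
      = u ⊗ₜ WtMod.tensorE V W (v ⊗ₜ w) + U.E u ⊗ₜ TensorProduct.map V.K W.K (v ⊗ₜ w)
    simp [WtMod.tensorE, TensorProduct.add_tmul, TensorProduct.tmul_add, add_assoc]
  · change TensorProduct.assoc ℂ U V W (TensorProduct.map U.Kinv V.Kinv (u ⊗ₜ v) ⊗ₜ W.F w
      + WtMod.tensorF U V (u ⊗ₜ v) ⊗ₜ w)
      = U.Kinv u ⊗ₜ WtMod.tensorF V W (v ⊗ₜ w) + U.F u ⊗ₜ (v ⊗ₜ w)
    simp [WtMod.tensorF, TensorProduct.add_tmul, TensorProduct.tmul_add, add_assoc]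
  · rfl
  · change TensorProduct.assoc ℂ U V W (WtMod.tensorH U V (u ⊗ₜ v) ⊗ₜ w
      + (u ⊗ₜ v) ⊗ₜ W.H w)
      = U.H u ⊗ₜ (v ⊗ₜ w) + u ⊗ₜ WtMod.tensorH V W (v ⊗ₜ w)
    simp [WtMod.tensorH, TensorProduct.add_tmul, TensorProduct.tmul_add, add_assoc]

theorem lid_mem_homs (V : WtMod r) :
    (TensorProduct.lid ℂ V).toLinearMap ∈ WtMod.homs ((WtMod.unit r).tensor V) V := by
  refine ⟨?_, ?_, ?_, ?_⟩ <;> refine TensorProduct.ext' fun (a : ℂ) v => ?_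
  · change TensorProduct.lid ℂ V (a ⊗ₜ V.E v + (0 : ℂ) ⊗ₜ V.K v) = V.E (a • v)
    simp
  · change TensorProduct.lid ℂ V (a ⊗ₜ V.F v + (0 : ℂ) ⊗ₜ v) = V.F (a • v)
    simp
  · change TensorProduct.lid ℂ V (a ⊗ₜ V.K v) = V.K (a • v)
    simp
  · change TensorProduct.lid ℂ V ((0 : ℂ) ⊗ₜ v + a ⊗ₜ V.H v) = V.H (a • v)
    simp

theorem rid_mem_homs (V : WtMod r) :
    (TensorProduct.rid ℂ V).toLinearMap ∈ WtMod.homs (V.tensor (WtMod.unit r)) V := by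
  refine ⟨?_, ?_, ?_, ?_⟩ <;> refine TensorProduct.ext' fun v (a : ℂ) => ?_
  · change TensorProduct.rid ℂ V (v ⊗ₜ (0 : ℂ) + V.E v ⊗ₜ a) = V.E (a • v)
    simp
  · change TensorProduct.rid ℂ V (V.Kinv v ⊗ₜ (0 : ℂ) + V.F v ⊗ₜ a) = V.F (a • v)
    simp
  · change TensorProduct.rid ℂ V (V.K v ⊗ₜ a) = V.K (a • v)
    simp
  · change TensorProduct.rid ℂ V (V.H v ⊗ₜ a + v ⊗ₜ (0 : ℂ)) = V.H (a • v)
    simp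

section Monoidal

variable (s : HalfTwist r)
  (hH : ∀ V W : DDag r,
    IsHermitianStructure (V.toMod.tensor W.toMod) (tensorForm s V.form W.form))
  (hD : ∀ V W : DDag r, InD (V.toMod.tensor W.toMod))

/-- The tensor product of modules with the form `(v, τ (X v'))_p`. -/
def tensor (V W : DDag r) : DDag r where
  toMod := V.toMod.tensor W.toMod
  form := tensorForm s V.form W.form
  isHermitian := hH V W
  mem := hD V W

/-- The tensor product of morphisms. -/
def tensorHom {V V' W W' : DDag r} (f : V ⟶ V') (g : W ⟶ W') :
    tensor s hH hD V W ⟶ tensor s hH hD V' W' :=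
  (⟨TensorProduct.map (lin f) (lin g), map_mem_homs (Subtype.property f) (Subtype.property g)⟩ :
    WtMod.homs (V.toMod.tensor W.toMod) (V'.toMod.tensor W'.toMod))

/-- The associativity constraint, `(u ⊗ v) ⊗ w ↦ u ⊗ (v ⊗ w)`. -/
def associator (U V W : DDag r) :
    tensor s hH hD (tensor s hH hD U V) W ≅ tensor s hH hD U (tensor s hH hD V W) :=
  isoMk (TensorProduct.assoc ℂ U.toMod V.toMod W.toMod) (assoc_mem_homs _ _ _)

/-- The left unit constraint, `a ⊗ v ↦ a v`. -/
def leftUnitor (V : DDag r) : tensor s hH hD (unit r) V ≅ V :=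
  isoMk (TensorProduct.lid ℂ V.toMod) (lid_mem_homs _)

/-- The right unit constraint, `v ⊗ a ↦ a v`. -/
def rightUnitor (V : DDag r) : tensor s hH hD V (unit r) ≅ V :=
  isoMk (TensorProduct.rid ℂ V.toMod) (rid_mem_homs _)

/-- The data of the tensor structure. -/
abbrev monoidalStruct : MonoidalCategoryStruct (DDag r) where
  tensorObj := tensor s hH hD
  whiskerLeft U {_ _} f := tensorHom s hH hD (𝟙 U) f
  whiskerRight {_ _} f U := tensorHom s hH hD f (𝟙 U)
  tensorHom f g := tensorHom s hH hD f g
  tensorUnit := unit r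
  associator := associator s hH hD
  leftUnitor := leftUnitor s hH hD
  rightUnitor := rightUnitor s hH hD

end Monoidal

end DDag

end UnrolledSl2

end

open UnrolledSl2

open CategoryTheory TensorProduct
noncomputable section
namespace UnrolledSl2

/-! ### Weight vectors and the Casimir operator -/

/-! The form on V ⊗ W is a pairing of V ⊗ W with W ⊗ V, the `flipPairing` (a ⊗ a', b' ⊗ b) ↦ φ(a, b)
ψ(a', b'), composed with X : V ⊗ W → W ⊗ V. Taking † factor by factor turns the coproduct into its
opposite, so the flipped pairing is contravariant, and it stays so after composition with the module
map X. Non-degeneracy holds because the pairing is non-degenerate and X is invertible. Hermitian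
symmetry follows from two facts: X_{W,V} X_{V,W} = id (`HalfTwist.X_X`) and X preserves the flipped
pairings (`IsContravariant.flipPairing_X`).

The first fact is the balancing identity θ_{V⊗W} = c_{W,V} c_{V,W} (θ_V ⊗ θ_W), combined with
naturality of √θ. Up to a power of K, the inverse twist is the Drinfeld element u = ∑ S(b) a, which
can be read off from evaluation ∘ braiding : V ⊗ V* → 𝟙. Balancing thereby becomes an isotopy of
string diagrams (`double_braiding_nestedPairing`). That the associativity isomorphisms are
isometries is likewise a categorical identity for X (`twistedBraiding_tensor`), a consequence of
naturality and the Yang–Baxter equation.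

Unitarity of X is checked on its factors. Since |q| = 1, conjugation sends q^x to q^(-x̄), so
q^(H⊗H/2) preserves the pairing, and the coefficients of the quasi R-matrix are conjugate to those
of its inverse (`conj_rCoeff`). For √θ an explicit formula is needed, and it comes from the Casimir
operator C. On vectors of weight μ, F^n E^n is a polynomial in C, hence so is the inverse twist
`thetaOp`. As E^r = 0, C is annihilated there by a polynomial of degree r whose roots are at most
double, so every module is spanned by weight vectors killed by some (C - c)². On such a vector
`thetaOp` is a scalar β⁻² plus an operator of square zero, and the first-order expansion of x ↦
x^(-1/2) yields a natural square root `sqrtTwist` of the twist, with the standard values.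

Every standard half twist equals this one (`HalfTwist.IsStandard.app_eq`): both are scalars on
highest weight vectors, fixed by the prescribed values, and two commuting square roots of the twist
that agree there agree everywhere. Unitarity is thus a statement about `sqrtTwist`. There C is
self-adjoint, the scalars β have conjugates equal to their inverses, and conjugating the
coefficients of the polynomial for θ⁻¹ gives a polynomial that acts as θ (`map_conj_thetaPoly`,
`aeval_thetaPolyInv`). -/

theorem aeval_apply_comm {M N : Type} [AddCommGroup M] [Module ℂ M] [AddCommGroup N] [Module ℂ N]
    {a : Module.End ℂ M} {b : Module.End ℂ N} {f : M →ₗ[ℂ] N} (h : ∀ v, f (a v) = b (f v))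
    (p : Polynomial ℂ) (v : M) :
    f (Polynomial.aeval a p v) = Polynomial.aeval b p (f v) := by
  induction p using Polynomial.induction_on' with
  | add p q hp hq => simp [hp, hq]
  | monomial n c =>
    have hn : ∀ n : ℕ, f ((a ^ n) v) = (b ^ n) (f v) := by
      intro n
      induction n with
      | zero => rfl
      | succ n ih => rw [pow_succ', Module.End.mul_apply, h, ih, pow_succ', Module.End.mul_apply]
    simp [Polynomial.aeval_monomial, hn]

namespace WtMod

variable {r : ℕ}

theorem ext_weight {V : WtMod r} {M : Type*} [AddCommGroup M] [Module ℂ M] {f g : V →ₗ[ℂ] M}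
    (h : ∀ (μ : ℂ) (v : V), V.H v = μ • v → f v = g v) : f = g :=
  LinearMap.ext_on (span_eigenvectors V.weight) fun v ⟨μ, hv⟩ => h μ v hv

theorem ext_weight_conj {V : WtMod r} {M : Type*} [AddCommGroup M] [Module ℂ M]
    {f g : V →ₗ⋆[ℂ] M} (h : ∀ (μ : ℂ) (v : V), V.H v = μ • v → f v = g v) : f = g :=
  LinearMap.ext_on (span_eigenvectors V.weight) fun v ⟨μ, hv⟩ => h μ v hv

theorem tensor_ext_weight_conj {V W : WtMod r} {M : Type*} [AddCommGroup M] [Module ℂ M]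
    {f g : V ⊗[ℂ] W →ₗ⋆[ℂ] M} (h : ∀ (a b : ℂ) (v : V) (w : W), V.H v = a • v → W.H w = b • w →
      f (v ⊗ₜ w) = g (v ⊗ₜ w)) : f = g := by
  refine LinearMap.ext_on (tensor_span V W) ?_
  rintro _ ⟨v, ⟨a, hv⟩, w, ⟨b, hw⟩, rfl⟩
  exact h a b v w hv hw

theorem tensor_ext_weight {V W : WtMod r} {M : Type*} [AddCommGroup M] [Module ℂ M]
    {f g : V ⊗[ℂ] W →ₗ[ℂ] M} (h : ∀ (a b : ℂ) (v : V) (w : W), V.H v = a • v → W.H w = b • w →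
      f (v ⊗ₜ w) = g (v ⊗ₜ w)) : f = g := by
  refine LinearMap.ext_on (tensor_span V W) ?_
  rintro _ ⟨v, ⟨a, hv⟩, w, ⟨b, hw⟩, rfl⟩
  exact h a b v w hv hw

variable {V : WtMod r} {μ : ℂ} {v : V}

theorem Kinv_apply (hv : V.H v = μ • v) : V.Kinv v = qpow r (-μ) • v := by
  have h1 := congrArg V.Kinv (V.K_eq μ v hv)
  rw [← Module.End.mul_apply, V.Kinv_K, map_smul, Module.End.one_apply] at h1
  rw [qpow_neg, eq_inv_smul_iff₀ (qpow_ne_zero r μ)]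
  exact h1.symm

theorem H_E_apply (hv : V.H v = μ • v) : V.H (V.E v) = (μ + 2) • V.E v := by
  have h := LinearMap.congr_fun V.H_E v
  simp only [LinearMap.sub_apply, Module.End.mul_apply, LinearMap.smul_apply, hv, map_smul] at h
  rw [sub_eq_iff_eq_add.1 h, add_smul, add_comm]

theorem H_F_apply (hv : V.H v = μ • v) : V.H (V.F v) = (μ - 2) • V.F v := by
  have h := LinearMap.congr_fun V.H_F v
  simp only [LinearMap.sub_apply, Module.End.mul_apply, LinearMap.smul_apply, hv, map_smul] at h
  rw [sub_eq_iff_eq_add.1 h, sub_smul, neg_smul]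
  abel

theorem H_E_pow_apply (hv : V.H v = μ • v) (n : ℕ) :
    V.H ((V.E ^ n) v) = (μ + 2 * n) • (V.E ^ n) v := by
  induction n with
  | zero => simp [hv]
  | succ n ih =>
    rw [pow_succ', Module.End.mul_apply, H_E_apply ih]
    push_cast
    ring_nf

theorem H_F_pow_apply (hv : V.H v = μ • v) (n : ℕ) :
    V.H ((V.F ^ n) v) = (μ - 2 * n) • (V.F ^ n) v := by
  induction n with
  | zero => simp [hv]
  | succ n ih =>
    rw [pow_succ', Module.End.mul_apply, H_F_apply ih]
    push_cast
    ring_nf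

end WtMod

/-- The eigenvalue `(q ^ (l + 1) + q ^ (-(l + 1))) / {1} ^ 2` of the Casimir operator on a highest
weight vector of weight `l`. -/
def casEig (r : ℕ) (l : ℂ) : ℂ := (qpow r (l + 1) + qpow r (-(l + 1))) / qbr r 1 ^ 2

/-- Differences of Casimir eigenvalues factor into quantum numbers. This is the source of every
coefficient {n}{b - n + 1}/{1}² in the commutators of E with F^n. -/
theorem casEig_sub (r : ℕ) (b : ℂ) (n : ℂ) :
    casEig r b - casEig r (b - 2 * n) = qbr r n * qbr r (b - n + 1) / qbr r 1 ^ 2 := by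
  rw [casEig, casEig, ← sub_div]
  congr 1
  have e1 : qpow r (b + 1) = qpow r n * qpow r (b - n + 1) := by rw [← qpow_add]; ring_nf
  have e2 : qpow r (b - 2 * n + 1) = (qpow r n)⁻¹ * qpow r (b - n + 1) := by
    rw [← qpow_neg, ← qpow_add]; ring_nf
  simp only [qbr, qpow_neg]
  rw [e1, e2]
  have := qpow_ne_zero r n
  have := qpow_ne_zero r (b - n + 1)
  field_simp
  ring

theorem qbr_sub_qbr_neg (r : ℕ) (μ : ℂ) : qpow r μ - qpow r (-μ) = qbr r μ := rfl

namespace WtMod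

variable {r : ℕ}

/-- The Casimir operator `F E + (q K + q⁻¹ K⁻¹) / {1} ^ 2`. -/
def cas (V : WtMod r) : Module.End ℂ V :=
  V.F * V.E + (qbr r 1 ^ 2)⁻¹ • (qpow r 1 • V.K + qpow r (-1) • V.Kinv)

variable {V : WtMod r} {μ : ℂ} {v : V}

theorem cas_apply (hv : V.H v = μ • v) : V.cas v = V.F (V.E v) + casEig r μ • v := by
  simp only [cas, LinearMap.add_apply, Module.End.mul_apply, LinearMap.smul_apply, V.K_eq μ v hv,
    Kinv_apply hv, smul_smul, ← add_smul, casEig, ← qpow_add]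
  congr 2
  rw [div_eq_inv_mul, add_comm 1 μ, ← neg_add, add_comm 1 μ]

theorem F_E_apply (hv : V.H v = μ • v) : V.F (V.E v) = V.cas v - casEig r μ • v := by
  rw [cas_apply hv, add_sub_cancel_right]

/-- Both F E and E F are C minus a scalar on a weight space; the scalar for E F is the one for F E
at the weight of F v. This makes words of weight zero polynomials in C. -/
theorem E_F_apply [r.AtLeastTwo] (hv : V.H v = μ • v) :
    V.E (V.F v) = V.cas v - casEig r (μ - 2) • v := by
  have h := LinearMap.congr_fun V.E_F v
  simp only [LinearMap.sub_apply, Module.End.mul_apply, LinearMap.smul_apply, V.K_eq μ v hv,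
    Kinv_apply hv, ← sub_smul, smul_smul] at h
  have h2 := casEig_sub r μ 1
  rw [sub_eq_iff_eq_add.1 h, F_E_apply hv]
  have h0 := qbr_one_ne_zero r
  have h3 : (qbr r 1)⁻¹ * (qpow r μ - qpow r (-μ)) = casEig r μ - casEig r (μ - 2) := by
    rw [mul_one] at h2
    rw [h2, sub_add_cancel, qbr_sub_qbr_neg]
    field_simp
  rw [h3, sub_smul]
  abel

theorem H_cas_apply (hv : V.H v = μ • v) : V.H (V.cas v) = μ • V.cas v := by
  rw [cas_apply hv, map_add, map_smul, hv, H_F_apply (H_E_apply hv), smul_add, smul_comm]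
  ring_nf

/-- The scalar subtracted from C in E F at weight μ + 2 is the one subtracted in F E at weight μ, so
both sides equal E F E v plus the same multiple of E v. -/
theorem cas_E [r.AtLeastTwo] (v : V) : V.cas (V.E v) = V.E (V.cas v) := by
  refine LinearMap.congr_fun (ext_weight (f := V.cas ∘ₗ V.E) (g := V.E ∘ₗ V.cas) ?_) v
  intro μ v hv
  simp only [LinearMap.comp_apply]
  have h := E_F_apply (H_E_apply hv)
  rw [add_sub_cancel_right] at h
  rw [cas_apply hv, map_add, map_smul, h, sub_add_cancel]

theorem cas_F [r.AtLeastTwo] (v : V) : V.cas (V.F v) = V.F (V.cas v) := by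
  refine LinearMap.congr_fun (ext_weight (f := V.cas ∘ₗ V.F) (g := V.F ∘ₗ V.cas) ?_) v
  intro μ v hv
  simp only [LinearMap.comp_apply]
  rw [cas_apply (H_F_apply hv), E_F_apply hv, map_sub, map_smul, sub_add_cancel]

theorem aeval_cas_E [r.AtLeastTwo] (p : Polynomial ℂ) (v : V) :
    V.E (Polynomial.aeval V.cas p v) = Polynomial.aeval V.cas p (V.E v) :=
  aeval_apply_comm (fun v => (cas_E v).symm) p v

theorem aeval_cas_F [r.AtLeastTwo] (p : Polynomial ℂ) (v : V) :
    V.F (Polynomial.aeval V.cas p v) = Polynomial.aeval V.cas p (V.F v) :=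
  aeval_apply_comm (fun v => (cas_F v).symm) p v

theorem E_pow_comm_cas [r.AtLeastTwo] (n : ℕ) (v : V) : (V.E ^ n) (V.cas v) = V.cas ((V.E ^ n) v) := by
  induction n with
  | zero => rfl
  | succ n ih => rw [pow_succ', Module.End.mul_apply, ih, Module.End.mul_apply, cas_E]

theorem F_pow_comm_cas [r.AtLeastTwo] (n : ℕ) (v : V) : (V.F ^ n) (V.cas v) = V.cas ((V.F ^ n) v) := by
  induction n with
  | zero => rfl
  | succ n ih => rw [pow_succ', Module.End.mul_apply, ih, Module.End.mul_apply, cas_F]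

theorem H_aeval_cas (hv : V.H v = μ • v) (p : Polynomial ℂ) :
    V.H (Polynomial.aeval V.cas p v) = μ • Polynomial.aeval V.cas p v := by
  have hc : ∀ v, V.H (V.cas v) = V.cas (V.H v) := by
    intro v
    refine LinearMap.congr_fun (ext_weight (f := V.H ∘ₗ V.cas) (g := V.cas ∘ₗ V.H) ?_) v
    intro μ v hv
    simp only [LinearMap.comp_apply]
    rw [H_cas_apply hv, hv, map_smul]
  rw [aeval_apply_comm hc, hv, map_smul]

end WtMod

/-- The polynomial `∏_{j < n} (X - c(μ + 2 j))`, with `c` the Casimir eigenvalue. -/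
def casPoly (r n : ℕ) (μ : ℂ) : Polynomial ℂ :=
  ∏ j ∈ Finset.range n, (Polynomial.X - Polynomial.C (casEig r (μ + 2 * j)))

theorem casPoly_succ (r n : ℕ) (μ : ℂ) : casPoly r (n + 1) μ
    = casPoly r n μ * (Polynomial.X - Polynomial.C (casEig r (μ + 2 * n))) :=
  Finset.prod_range_succ _ _

/-! ### Words in `E` and `F` as polynomials in the Casimir operator -/

namespace WtMod

variable {r : ℕ} [r.AtLeastTwo] {V : WtMod r} {μ : ℂ} {v : V}

/-- The innermost F E is applied to a vector of weight μ + 2n, where it equals C - c(μ + 2n). Since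
C commutes with F, this factor can be pulled out. -/
theorem F_pow_E_pow_apply (hv : V.H v = μ • v) (n : ℕ) :
    (V.F ^ n) ((V.E ^ n) v) = Polynomial.aeval V.cas (casPoly r n μ) v := by
  induction n with
  | zero => simp [casPoly]
  | succ n ih =>
    rw [pow_succ, Module.End.mul_apply, pow_succ' V.E, Module.End.mul_apply,
      F_E_apply (H_E_pow_apply hv n), map_sub, map_smul, F_pow_comm_cas, ih, casPoly_succ, mul_comm _ (_ - _),
      map_mul, Module.End.mul_apply, map_sub, Polynomial.aeval_X, Polynomial.aeval_C,
      LinearMap.sub_apply, Module.algebraMap_end_apply]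

theorem aeval_casPoly (hv : V.H v = μ • v) : Polynomial.aeval V.cas (casPoly r r μ) v = 0 := by
  rw [← F_pow_E_pow_apply hv, V.E_pow, LinearMap.zero_apply, map_zero]

/-- A vector in the image of E is already killed by E^(r-1), so the last root of the annihilating
polynomial is lost. This excludes the one label for which the values on the weights μ and μ + 2
would not match in `blockFun_mem_homs`. -/
theorem aeval_casPoly_E (hv : V.H v = μ • v) :
    Polynomial.aeval V.cas (casPoly r (r - 1) (μ + 2)) (V.E v) = 0 := by
  have h : r - 1 + 1 = r := Nat.sub_add_cancel (Nat.one_le_of_lt (Nat.AtLeastTwo.prop))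
  rw [← F_pow_E_pow_apply (H_E_apply hv), ← Module.End.mul_apply (V.E ^ (r - 1)), ← pow_succ, h,
    V.E_pow, LinearMap.zero_apply, map_zero]

theorem aeval_casPoly_F (hv : V.H v = μ • v) :
    Polynomial.aeval V.cas (casPoly r (r - 1) μ) (V.F v) = 0 := by
  have h : r - 1 + 1 = r := Nat.sub_add_cancel (Nat.one_le_of_lt (Nat.AtLeastTwo.prop))
  rw [← aeval_cas_F, ← F_pow_E_pow_apply hv, ← Module.End.mul_apply, ← pow_succ', h,
    V.F_pow, LinearMap.zero_apply]

/-- Both words equal F^n applied to C minus a scalar; the scalars are those at the two ends of the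
string, and `casEig_sub` factors their difference. -/
theorem E_F_pow_apply (hv : V.H v = μ • v) (n : ℕ) :
    V.E ((V.F ^ (n + 1)) v) = (V.F ^ (n + 1)) (V.E v)
      + (qbr r (n + 1) * qbr r (μ - n) / qbr r 1 ^ 2) • (V.F ^ n) v := by
  have h := casEig_sub r μ (n + 1)
  rw [show μ - ((n : ℂ) + 1) + 1 = μ - n by ring] at h
  rw [← h, pow_succ' V.F, Module.End.mul_apply, E_F_apply (H_F_pow_apply hv n),
    ← pow_succ' V.F, pow_succ V.F, Module.End.mul_apply, F_E_apply hv, map_sub, map_smul,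
    F_pow_comm_cas, sub_smul,
    show μ - 2 * ((n : ℂ) + 1) = μ - 2 * n - 2 by ring]
  abel

theorem F_E_pow_apply (hv : V.H v = μ • v) (n : ℕ) :
    V.F ((V.E ^ (n + 1)) v) = (V.E ^ (n + 1)) (V.F v)
      - (qbr r (n + 1) * qbr r (μ + n) / qbr r 1 ^ 2) • (V.E ^ n) v := by
  have h := casEig_sub r (μ + 2 * n) (n + 1)
  rw [show μ + 2 * (n : ℂ) - (n + 1) + 1 = μ + n by ring,
    show μ + 2 * (n : ℂ) - 2 * (n + 1) = μ - 2 by ring] at h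
  rw [← h, pow_succ' V.E, Module.End.mul_apply, F_E_apply (H_E_pow_apply hv n),
    ← pow_succ' V.E, pow_succ V.E, Module.End.mul_apply, E_F_apply hv, map_sub, map_smul,
    E_pow_comm_cas, sub_smul]
  abel

end WtMod
end UnrolledSl2

end

open CategoryTheory TensorProduct
noncomputable section
namespace UnrolledSl2

/-! ### The monoidal category of weight modules -/

namespace WtMod

variable {r : ℕ}

/-- The morphism with a given underlying linear map. -/
def ofLin {V W : WtMod r} (f : V →ₗ[ℂ] W) (hf : f ∈ homs V W) : V ⟶ W := (⟨f, hf⟩ : homs V W)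

theorem hom_ext {V W : WtMod r} {f g : V ⟶ W} (h : lin f = lin g) : f = g := Subtype.ext h

theorem lin_mem {V W : WtMod r} (f : V ⟶ W) : lin f ∈ homs V W := Subtype.property f

theorem symm_mem_homs {V W : WtMod r} (e : V ≃ₗ[ℂ] W) (h : e.toLinearMap ∈ homs V W) :
    e.symm.toLinearMap ∈ homs W V := by
  obtain ⟨h1, h2, h3, h4⟩ := h
  have key : ∀ (f : Module.End ℂ V) (g : Module.End ℂ W),
      e.toLinearMap ∘ₗ f = g ∘ₗ e.toLinearMap →
        e.symm.toLinearMap ∘ₗ g = f ∘ₗ e.symm.toLinearMap := by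
    intro f g hfg
    ext x
    have := LinearMap.congr_fun hfg (e.symm x)
    simp only [LinearMap.comp_apply, LinearEquiv.coe_coe, LinearEquiv.apply_symm_apply] at this
    simp [← this]
  exact ⟨key _ _ h1, key _ _ h2, key _ _ h3, key _ _ h4⟩

/-- The isomorphism given by a linear isomorphism commuting with the action. -/
def isoOfLin {V W : WtMod r} (e : V ≃ₗ[ℂ] W) (h : e.toLinearMap ∈ homs V W) : V ≅ W where
  hom := ofLin e.toLinearMap h
  inv := ofLin e.symm.toLinearMap (symm_mem_homs e h)
  hom_inv_id := hom_ext (LinearMap.ext fun x => e.symm_apply_apply x)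
  inv_hom_id := hom_ext (LinearMap.ext fun x => e.apply_symm_apply x)

variable {V W : WtMod r} (f : V ⟶ W) (v : V)

theorem lin_E : lin f (V.E v) = W.E (lin f v) := LinearMap.congr_fun (lin_mem f).1 v
theorem lin_F : lin f (V.F v) = W.F (lin f v) := LinearMap.congr_fun (lin_mem f).2.1 v
theorem lin_K : lin f (V.K v) = W.K (lin f v) := LinearMap.congr_fun (lin_mem f).2.2.1 v
theorem lin_H : lin f (V.H v) = W.H (lin f v) := LinearMap.congr_fun (lin_mem f).2.2.2 v

theorem lin_Kinv : lin f (V.Kinv v) = W.Kinv (lin f v) := by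
  have h := lin_K f (V.Kinv v)
  rw [← Module.End.mul_apply, V.K_Kinv, Module.End.one_apply] at h
  rw [h, ← Module.End.mul_apply, W.Kinv_K, Module.End.one_apply]

theorem lin_E_pow (n : ℕ) : lin f ((V.E ^ n) v) = (W.E ^ n) (lin f v) := by
  induction n with
  | zero => rfl
  | succ n ih => rw [pow_succ', Module.End.mul_apply, lin_E, ih, pow_succ', Module.End.mul_apply]

theorem lin_F_pow (n : ℕ) : lin f ((V.F ^ n) v) = (W.F ^ n) (lin f v) := by
  induction n with
  | zero => rfl
  | succ n ih => rw [pow_succ', Module.End.mul_apply, lin_F, ih, pow_succ', Module.End.mul_apply]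

theorem lin_cas : lin f (V.cas v) = W.cas (lin f v) := by
  simp only [cas, LinearMap.add_apply, LinearMap.smul_apply, Module.End.mul_apply, map_add,
    map_smul, lin_E, lin_F, lin_K, lin_Kinv]

theorem lin_weight {μ : ℂ} {v : V} (hv : V.H v = μ • v) : W.H (lin f v) = μ • lin f v := by
  rw [← lin_H, hv, map_smul]

end WtMod

namespace WtMod

variable {r : ℕ} [r.AtLeastTwo]

/-- All weight modules are made into a monoidal category, later braided, so that the string-diagram
arguments can be carried out for abstract braided categories and then specialized. -/
instance : MonoidalCategoryStruct (WtMod r) where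
  tensorObj V W := V.tensor W
  whiskerLeft U {_ _} f := ofLin (TensorProduct.map (lin (𝟙 U)) (lin f))
    (DDag.map_mem_homs (lin_mem (𝟙 U)) (lin_mem f))
  whiskerRight {_ _} f U := ofLin (TensorProduct.map (lin f) (lin (𝟙 U)))
    (DDag.map_mem_homs (lin_mem f) (lin_mem (𝟙 U)))
  tensorHom f g := ofLin (TensorProduct.map (lin f) (lin g))
    (DDag.map_mem_homs (lin_mem f) (lin_mem g))
  tensorUnit := unit r
  associator U V W := isoOfLin (TensorProduct.assoc ℂ U V W) (DDag.assoc_mem_homs U V W)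
  leftUnitor V := isoOfLin (TensorProduct.lid ℂ V) (DDag.lid_mem_homs V)
  rightUnitor V := isoOfLin (TensorProduct.rid ℂ V) (DDag.rid_mem_homs V)

instance : MonoidalCategory (WtMod r) := MonoidalCategory.ofTensorHom
  (id_tensorHom_id := fun V W => hom_ext (TensorProduct.map_id (R := ℂ) (M := V) (N := W)))
  (id_tensorHom := fun _ _ _ _ => rfl)
  (tensorHom_id := fun _ _ => rfl)
  (tensorHom_comp_tensorHom := fun f₁ f₂ g₁ g₂ => hom_ext (TensorProduct.ext' fun _ _ => rfl))
  (associator_naturality := fun f₁ f₂ f₃ => hom_ext (TensorProduct.ext_threefold fun _ _ _ => rfl))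
  (leftUnitor_naturality := fun {V W} f => hom_ext (TensorProduct.ext' fun (a : ℂ) v => by
    change a • lin f v = lin f (a • v)
    rw [map_smul]))
  (rightUnitor_naturality := fun {V W} f => hom_ext (TensorProduct.ext' fun v (a : ℂ) => by
    change a • lin f v = lin f (a • v)
    rw [map_smul]))
  (pentagon := fun U V W Z => hom_ext (TensorProduct.ext_fourfold fun _ _ _ _ => rfl))
  (triangle := fun V W => hom_ext (TensorProduct.ext_threefold fun v (a : ℂ) w => by
    change v ⊗ₜ[ℂ] (a • w) = (a • v) ⊗ₜ w
    rw [TensorProduct.smul_tmul]))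

instance : MonoidalPreadditive (WtMod r) where
  whiskerLeft_zero := hom_ext (TensorProduct.map_zero_right _)
  zero_whiskerRight := hom_ext (TensorProduct.map_zero_left _)
  whiskerLeft_add _ _ := hom_ext (TensorProduct.map_add_right _ _ _)
  add_whiskerRight _ _ := hom_ext (TensorProduct.map_add_left _ _ _)

instance : MonoidalLinear ℂ (WtMod r) where
  whiskerLeft_smul _ {_ _} c _ := hom_ext (TensorProduct.map_smul_right c _ _)
  smul_whiskerRight c {_ _} _ _ := hom_ext (TensorProduct.map_smul_left c _ _)

end WtMod

/-! ### The tensor structure on Hermitian modules -/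

namespace DDag

variable {r : ℕ} [r.AtLeastTwo] (s : HalfTwist r)
  (hH : ∀ V W : DDag r,
    IsHermitianStructure (V.toMod.tensor W.toMod) (tensorForm s V.form W.form))
  (hD : ∀ V W : DDag r, InD (V.toMod.tensor W.toMod))

/-- The underlying modules form a monoidal category, with morphisms those of modules. -/
abbrev monoidal : MonoidalCategory (DDag r) :=
  { monoidalStruct s hH hD with
    tensorHom_def := fun {U V _ _} f g =>
      MonoidalCategory.tensorHom_def (C := WtMod r) (X₁ := U.toMod) (Y₁ := V.toMod) f g
    id_tensorHom_id := fun V W => MonoidalCategory.id_tensorHom_id (C := WtMod r) V.toMod W.toMod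
    tensorHom_comp_tensorHom := fun f₁ f₂ g₁ g₂ =>
      MonoidalCategory.tensorHom_comp_tensorHom (C := WtMod r) f₁ f₂ g₁ g₂
    whiskerLeft_id := fun V W => MonoidalCategory.whiskerLeft_id (C := WtMod r) V.toMod W.toMod
    id_whiskerRight := fun V W => MonoidalCategory.id_whiskerRight (C := WtMod r) V.toMod W.toMod
    associator_naturality := fun f₁ f₂ f₃ =>
      MonoidalCategory.associator_naturality (C := WtMod r) f₁ f₂ f₃
    leftUnitor_naturality := fun f => MonoidalCategory.leftUnitor_naturality (C := WtMod r) f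
    rightUnitor_naturality := fun f => MonoidalCategory.rightUnitor_naturality (C := WtMod r) f
    pentagon := fun U V W Z =>
      MonoidalCategory.pentagon (C := WtMod r) U.toMod V.toMod W.toMod Z.toMod
    triangle := fun V W => MonoidalCategory.triangle (C := WtMod r) V.toMod W.toMod }

/-- The forms do not enter the axioms: the morphisms are all module maps, so each axiom is literally
that of `WtMod r`. -/
theorem exists_monoidalLinear : ∃ M : MonoidalCategory (DDag r),
    M.toMonoidalCategoryStruct = monoidalStruct s hH hD ∧
      ∃ _ : MonoidalPreadditive (DDag r), MonoidalLinear ℂ (DDag r) := by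
  refine ⟨monoidal s hH hD, rfl, ?_⟩
  let _ := monoidal s hH hD
  have P : MonoidalPreadditive (DDag r) :=
    { whiskerLeft_zero := fun {X Y Z} => MonoidalPreadditive.whiskerLeft_zero (C := WtMod r)
        (X := X.toMod) (Y := Y.toMod) (Z := Z.toMod)
      zero_whiskerRight := fun {X Y Z} => MonoidalPreadditive.zero_whiskerRight (C := WtMod r)
        (X := X.toMod) (Y := Y.toMod) (Z := Z.toMod)
      whiskerLeft_add := fun f g => MonoidalPreadditive.whiskerLeft_add (C := WtMod r) f g
      add_whiskerRight := fun f g => MonoidalPreadditive.add_whiskerRight (C := WtMod r) f g }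
  exact ⟨P,
    { whiskerLeft_smul := fun X {_ _} c f =>
        MonoidalLinear.whiskerLeft_smul (C := WtMod r) X.toMod c f
      smul_whiskerRight := fun c {_ _} f X =>
        MonoidalLinear.smul_whiskerRight (C := WtMod r) c f X.toMod }⟩

theorem bijective_smul_id_unit : Function.Bijective fun c : ℂ => c • 𝟙 (unit r) := by
  constructor
  · intro a b h
    have h1 : (a • LinearMap.id : ℂ →ₗ[ℂ] ℂ) = b • LinearMap.id := congrArg lin h
    simpa using LinearMap.congr_fun h1 1
  · intro f
    let g : ℂ →ₗ[ℂ] ℂ := lin f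
    refine ⟨g 1, Subtype.ext (?_ : (g 1 • LinearMap.id : ℂ →ₗ[ℂ] ℂ) = g)⟩
    ext
    simp

end DDag
end UnrolledSl2

end

open CategoryTheory TensorProduct
noncomputable section
namespace UnrolledSl2

/-! ### Coefficients of the R-matrix -/

theorem qbr_nat_ne_zero {r n : ℕ} (h0 : 0 < n) (h : n < r) : qbr r n ≠ 0 := by
  have h1 := (qpow_two_primitive r (by omega)).pow_ne_one_of_pos_of_lt h0.ne' h
  have h2 : qpow r 2 ^ n = qpow r n * qpow r n := by
    rw [← qpow_add]
    clear h1
    simp only [qpow]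
    rw [← Complex.exp_nat_mul]
    ring_nf
  rw [h2] at h1
  rw [qbr, qpow_neg, sub_ne_zero]
  intro h3
  refine h1 ?_
  nth_rewrite 1 [h3]
  exact inv_mul_cancel₀ (qpow_ne_zero r n)

theorem qfact_succ (r n : ℕ) : qfact r (n + 1) = qfact r n * qbr r (n + 1) :=
  Finset.prod_range_succ _ _

theorem qfact_ne_zero {r n : ℕ} (h : n < r) : qfact r n ≠ 0 :=
  Finset.prod_ne_zero_iff.2 fun k hk => by
    have := qbr_nat_ne_zero (r := r) (n := k + 1) (by omega) (by have := Finset.mem_range.1 hk; omega)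
    exact_mod_cast this

theorem rCoeff_zero (r : ℕ) : rCoeff r 0 = 1 := by simp [rCoeff, qfact, qpow_zero]

/-- This recursion is exactly what the intertwining property of R with E and F requires. The bound n
+ 1 < r ensures that {n + 1} is nonzero. -/
theorem rCoeff_succ {r n : ℕ} (h : n + 1 < r) :
    rCoeff r (n + 1) * qbr r (n + 1) = rCoeff r n * qbr r 1 ^ 2 * qpow r n := by
  have h1 : qbr r (n + 1) ≠ 0 := by
    have := qbr_nat_ne_zero (r := r) (n := n + 1) (by omega) h
    exact_mod_cast this
  have h2 := qfact_ne_zero (r := r) (n := n) (by omega)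
  have h3 : qpow r (((n + 1 : ℕ) : ℂ) * (((n + 1 : ℕ) : ℂ) - 1) / 2)
      = qpow r ((n : ℂ) * ((n : ℂ) - 1) / 2) * qpow r n := by
    rw [← qpow_add]; push_cast; ring_nf
  rw [rCoeff, rCoeff, h3, qfact_succ]
  field_simp
  ring

/-- The coefficient `(-1) ^ n {1} ^ (2 n) / {n}! * q ^ (- n (n - 1) / 2)` of the inverse of the
quasi R-matrix. -/
def rCoeffInv (r n : ℕ) : ℂ :=
  (-1) ^ n * (qbr r 1 ^ (2 * n) / qfact r n * qpow r (-((n : ℂ) * ((n : ℂ) - 1) / 2)))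

theorem rCoeffInv_zero (r : ℕ) : rCoeffInv r 0 = 1 := by simp [rCoeffInv, qfact, qpow_zero]

theorem rCoeffInv_succ {r n : ℕ} (h : n + 1 < r) :
    rCoeffInv r (n + 1) * qbr r (n + 1) = -(rCoeffInv r n * qbr r 1 ^ 2 * qpow r (-n)) := by
  have h1 : qbr r (n + 1) ≠ 0 := by
    have := qbr_nat_ne_zero (r := r) (n := n + 1) (by omega) h
    exact_mod_cast this
  have h2 := qfact_ne_zero (r := r) (n := n) (by omega)
  have h3 : qpow r (-(((n + 1 : ℕ) : ℂ) * (((n + 1 : ℕ) : ℂ) - 1) / 2))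
      = qpow r (-((n : ℂ) * ((n : ℂ) - 1) / 2)) * qpow r (-n) := by
    rw [← qpow_add]; push_cast; ring_nf
  rw [rCoeffInv, rCoeffInv, h3, qfact_succ]
  field_simp
  ring

/-- The identity exp_q(x) exp_{q⁻¹}(-x) = 1 for q-exponentials, in degree n + 1. If S_n denotes the
sum in degree n, the recursions give {n+1} S_{n+1} = {1}² {n} S_n; since {0} = 0, S_1 vanishes and
then so do all later ones. -/
theorem sum_rCoeff_mul_rCoeffInv {r n : ℕ} (h : n + 1 < r) :
    ∑ x ∈ Finset.HasAntidiagonal.antidiagonal (n + 1), rCoeff r x.1 * rCoeffInv r x.2 = 0 := by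
  have key : ∀ n, n + 1 < r →
      qbr r (n + 1) * ∑ x ∈ Finset.HasAntidiagonal.antidiagonal (n + 1), rCoeff r x.1 * rCoeffInv r x.2
        = qbr r 1 ^ 2 * qbr r n * ∑ x ∈ Finset.HasAntidiagonal.antidiagonal n, rCoeff r x.1 * rCoeffInv r x.2 := by
    intro n hn
    have e1 : ∀ x ∈ Finset.HasAntidiagonal.antidiagonal (n + 1), qbr r (n + 1) * (rCoeff r x.1 * rCoeffInv r x.2)
        = qpow r x.2 * (rCoeff r x.1 * qbr r x.1) * rCoeffInv r x.2
          + qpow r (-x.1) * rCoeff r x.1 * (rCoeffInv r x.2 * qbr r x.2) := by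
      intro x hx
      have hx' : (n : ℂ) + 1 = x.2 + x.1 := by
        have := Finset.HasAntidiagonal.mem_antidiagonal.1 hx
        rw [add_comm (x.2 : ℂ)]
        exact_mod_cast this.symm
      -- The q-analogue of n + 1 = x₁ + x₂, acting as a Leibniz rule: each half lowers one of the
      -- two indices.
      have : qbr r (n + 1) = qpow r x.2 * qbr r x.1 + qpow r (-x.1) * qbr r x.2 := by
        rw [hx', qbr, qbr, qbr, neg_add, qpow_add, qpow_add, qpow_neg, qpow_neg]
        ring
      rw [this]
      ring
    rw [Finset.mul_sum, Finset.sum_congr rfl e1, Finset.sum_add_distrib,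
      Finset.Nat.sum_antidiagonal_succ, Finset.Nat.sum_antidiagonal_succ']
    simp only [Nat.cast_zero, qbr_zero, mul_zero, zero_mul, zero_add, Nat.cast_add,
      Nat.cast_one]
    rw [← Finset.sum_add_distrib, Finset.mul_sum]
    refine Finset.sum_congr rfl fun x hx => ?_
    have hx1 := Finset.HasAntidiagonal.mem_antidiagonal.1 hx
    have hx' : (n : ℂ) = x.1 + x.2 := by exact_mod_cast hx1.symm
    rw [rCoeff_succ (by omega), rCoeffInv_succ (by omega), qbr.eq_def r (n : ℂ), hx', neg_add,
      qpow_add, qpow_add]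
    ring
  have hne : ∀ n : ℕ, n + 1 < r → qbr r (n + 1) ≠ 0 := by
    intro n hn
    have := qbr_nat_ne_zero (r := r) (n := n + 1) (by omega) hn
    exact_mod_cast this
  induction n with
  | zero =>
    have h1 := key 0 h
    rw [Nat.cast_zero, qbr_zero, mul_zero, zero_mul] at h1
    have := hne 0 h
    rw [Nat.cast_zero] at this
    exact (mul_eq_zero.1 h1).resolve_left this
  | succ n ih =>
    have h1 := key (n + 1) h
    rw [ih (by omega), mul_zero] at h1
    exact (mul_eq_zero.1 h1).resolve_left (hne _ h)

theorem qpow_two_pow (r n : ℕ) : qpow r 2 ^ n = qpow r n * qpow r n := by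
  rw [← qpow_add]
  simp only [qpow]
  rw [← Complex.exp_nat_mul]
  ring_nf

theorem prod_qpow_two_pow_sub_one (r n : ℕ) :
    ∏ i ∈ Finset.range n, (qpow r 2 ^ (i + 1) - 1)
      = qpow r ((n : ℂ) * (n + 1) / 2) * qfact r n := by
  induction n with
  | zero => simp [qfact, qpow_zero]
  | succ n ih =>
    rw [Finset.prod_range_succ, ih, qfact_succ, qpow_two_pow, qbr, qpow_neg]
    have h3 : qpow r (((n + 1 : ℕ) : ℂ) * ((n + 1 : ℕ) + 1) / 2)
      = qpow r ((n : ℂ) * (n + 1) / 2) * qpow r (n + 1) := by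
      rw [← qpow_add]; push_cast; ring_nf
    rw [h3]
    have := qpow_ne_zero r ((n : ℂ) + 1)
    push_cast
    field_simp

/-- The addition law of the q-exponential. It is what makes R compatible with the coproduct of E^n
and F^n in the hexagons. -/
theorem rCoeff_mul_rCoeff {r k l : ℕ} (h : k + l < r) : rCoeff r k * rCoeff r l
    = rCoeff r (k + l) * gaussBinom (qpow r 2) (k + l) k * qpow r (-(2 * k * l)) := by
  have h1 := gaussBinom_mul (qpow r 2) (k + l) k l rfl
  simp only [prod_qpow_two_pow_sub_one] at h1
  have hk := qfact_ne_zero (r := r) (n := k) (by omega)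
  have hl := qfact_ne_zero (r := r) (n := l) (by omega)
  have hn := qfact_ne_zero h
  have e1 : qpow r (((k + l : ℕ) : ℂ) * ((k + l : ℕ) + 1) / 2)
      = qpow r (k * (k + 1) / 2) * qpow r (l * (l + 1) / 2) * qpow r (k * l) := by
    rw [← qpow_add, ← qpow_add]; push_cast; ring_nf
  have e2 : qpow r (((k + l : ℕ) : ℂ) * ((k + l : ℕ) - 1) / 2)
      = qpow r (k * (k - 1) / 2) * qpow r (l * (l - 1) / 2) * qpow r (k * l) := by
    rw [← qpow_add, ← qpow_add]; push_cast; ring_nf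
  have e3 : qpow r (-(2 * k * l)) = (qpow r (k * l))⁻¹ * (qpow r (k * l))⁻¹ := by
    rw [← qpow_neg, ← qpow_add]; ring_nf
  have n1 := qpow_ne_zero r (k * (k + 1) / 2)
  have n2 := qpow_ne_zero r (l * (l + 1) / 2)
  have n3 := qpow_ne_zero r (k * l)
  rw [e1] at h1
  have h2 : gaussBinom (qpow r 2) (k + l) k
      = qpow r (k * l) * qfact r (k + l) / (qfact r k * qfact r l) := by
    field_simp
    refine mul_left_cancel₀ (mul_ne_zero n1 n2) ?_
    linear_combination h1
  rw [h2, rCoeff, rCoeff, rCoeff, e2, e3]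
  field_simp
  ring

/-! ### Sums over ranges -/

theorem sum_range_eq_shift {M : Type*} [AddCommGroup M] (f : ℕ → M) (n : ℕ) (h : f n = 0) :
    ∑ i ∈ Finset.range n, f i = f 0 + ∑ i ∈ Finset.range n, f (i + 1) := by
  rw [add_comm, ← Finset.sum_range_succ', Finset.sum_range_succ, h, add_zero]

/-- The triangle k + l < r and the square k, l < r give the same sum because E^r = F^r = 0 kills the
other half of the square. -/
theorem sum_range_sum_range {M : Type*} [AddCommGroup M] (r : ℕ) (G : ℕ → ℕ → M)
    (h : ∀ k l, r ≤ k + l → G k l = 0) :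
    ∑ n ∈ Finset.range r, ∑ k ∈ Finset.range (n + 1), G k (n - k)
      = ∑ k ∈ Finset.range r, ∑ l ∈ Finset.range r, G k l := by
  rw [Finset.sum_range_diag_flip]
  refine Finset.sum_congr rfl fun k hk => ?_
  refine Finset.sum_subset (Finset.range_subset_range.2 (Nat.sub_le _ _)) fun l _ hl => h k l ?_
  rw [Finset.mem_range, not_lt] at hl
  omega

theorem sum_rCoeff_sum_rCoeffInv {A : Type*} [Ring A] [Algebra ℂ A] {r : ℕ} (hr : r ≠ 0) {x : A}
    (hx : x ^ r = 0) : (∑ n ∈ Finset.range r, rCoeff r n • x ^ n)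
      * (∑ n ∈ Finset.range r, rCoeffInv r n • x ^ n) = 1 := by
  rw [Finset.sum_mul_sum, ← sum_range_sum_range]
  · obtain ⟨m, hm⟩ := Nat.exists_eq_succ_of_ne_zero hr
    have h : ∀ n ∈ Finset.range r, ∑ k ∈ Finset.range (n + 1),
        rCoeff r k • x ^ k * rCoeffInv r (n - k) • x ^ (n - k)
          = (∑ p ∈ Finset.HasAntidiagonal.antidiagonal n, rCoeff r p.1 * rCoeffInv r p.2) • x ^ n := by
      intro n _
      rw [Finset.Nat.sum_antidiagonal_eq_sum_range_succ
        (f := fun k l => rCoeff r k * rCoeffInv r l), Finset.sum_smul]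
      refine Finset.sum_congr rfl fun k hk => ?_
      rw [smul_mul_smul_comm, ← pow_add, Nat.add_sub_cancel' (Finset.mem_range_succ_iff.1 hk)]
    rw [Finset.sum_congr rfl h, Finset.sum_eq_single_of_mem 0 (Finset.mem_range.2 (by omega))]
    · simp [rCoeff_zero, rCoeffInv_zero]
    · intro n hn h0
      obtain ⟨k, rfl⟩ := Nat.exists_eq_succ_of_ne_zero h0
      rw [sum_rCoeff_mul_rCoeffInv (Finset.mem_range.1 hn), zero_smul]
  · intro k l hkl
    rw [smul_mul_smul_comm, ← pow_add, pow_eq_zero_of_le hkl hx, smul_zero]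

theorem sum_rCoeffInv_sum_rCoeff {A : Type*} [Ring A] [Algebra ℂ A] {r : ℕ} (hr : r ≠ 0) {x : A}
    (hx : x ^ r = 0) : (∑ n ∈ Finset.range r, rCoeffInv r n • x ^ n)
      * (∑ n ∈ Finset.range r, rCoeff r n • x ^ n) = 1 := by
  have h : Commute (∑ n ∈ Finset.range r, rCoeffInv r n • x ^ n)
      (∑ n ∈ Finset.range r, rCoeff r n • x ^ n) :=
    Commute.sum_left _ _ _ fun _ _ => Commute.sum_right _ _ _ fun _ _ =>
      ((Commute.pow_pow_self x _ _).smul_left _).smul_right _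
  rw [h.eq, sum_rCoeff_sum_rCoeffInv hr hx]

/-! ### The R-matrix on weight vectors -/

section Braiding

variable {r : ℕ}

theorem rMatrix_tmul (V W : WtMod r) {a b : ℂ} {v : V} {w : W} (hv : V.H v = a • v)
    (hw : W.H w = b • w) : rMatrix V W (v ⊗ₜ w) = ∑ n ∈ Finset.range r,
      (rCoeff r n * qpow r ((a + 2 * n) * (b - 2 * n) / 2)) • ((V.E ^ n) v ⊗ₜ[ℂ] (W.F ^ n) w) := by
  rw [rMatrix, Module.End.mul_apply, LinearMap.sum_apply, map_sum]
  refine Finset.sum_congr rfl fun n _ => ?_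
  rw [LinearMap.smul_apply, map_smul, TensorProduct.map_tmul,
    qHH_tmul V W (WtMod.H_E_pow_apply hv n) (WtMod.H_F_pow_apply hw n), smul_smul]

theorem braiding_tmul (V W : WtMod r) {a b : ℂ} {v : V} {w : W} (hv : V.H v = a • v)
    (hw : W.H w = b • w) : braiding V W (v ⊗ₜ w) = ∑ n ∈ Finset.range r,
      (rCoeff r n * qpow r ((a + 2 * n) * (b - 2 * n) / 2)) • ((W.F ^ n) w ⊗ₜ[ℂ] (V.E ^ n) v) := by
  rw [braiding, LinearMap.comp_apply, rMatrix_tmul V W hv hw, map_sum]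
  exact Finset.sum_congr rfl fun n _ => by
    rw [map_smul, LinearEquiv.coe_coe, TensorProduct.comm_tmul]

theorem braiding_natural {V V' W W' : WtMod r} (f : V ⟶ V') (g : W ⟶ W') :
    braiding V' W' ∘ₗ TensorProduct.map (WtMod.lin f) (WtMod.lin g)
      = TensorProduct.map (WtMod.lin g) (WtMod.lin f) ∘ₗ braiding V W := by
  refine WtMod.tensor_ext_weight fun a b v w hv hw => ?_
  rw [LinearMap.comp_apply, LinearMap.comp_apply, TensorProduct.map_tmul,
    braiding_tmul _ _ (WtMod.lin_weight f hv) (WtMod.lin_weight g hw), braiding_tmul _ _ hv hw,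
    map_sum]
  exact Finset.sum_congr rfl fun n _ => by
    rw [map_smul, TensorProduct.map_tmul, WtMod.lin_E_pow, WtMod.lin_F_pow]

/-- The operator `q ^ (- H ⊗ H / 2)`. -/
def qHHInv (V W : WtMod r) : Module.End ℂ (V ⊗[ℂ] W) :=
  ∑ a ∈ weights V.H, TensorProduct.map (opFun V.H (Set.indicator {a} 1))
    (opFun W.H fun b => qpow r (-(a * b / 2)))

theorem qHHInv_tmul (V W : WtMod r) {a b : ℂ} {v : V} {w : W} (hv : V.H v = a • v)
    (hw : W.H w = b • w) : qHHInv V W (v ⊗ₜ w) = qpow r (-(a * b / 2)) • (v ⊗ₜ w) := by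
  rcases eq_or_ne v 0 with rfl | hv0
  · simp
  have ha : a ∈ weights V.H := by
    simp only [weights, Set.Finite.mem_toFinset, Set.mem_ofPred_eq]
    exact Module.End.hasEigenvalue_of_hasEigenvector
      ⟨Module.End.mem_eigenspace_iff.2 hv, hv0⟩
  rw [qHHInv, LinearMap.sum_apply, Finset.sum_eq_single_of_mem a ha]
  · rw [TensorProduct.map_tmul, opFun_apply _ _ hv, opFun_apply _ _ hw]
    simp
  · intro c _ hc
    rw [TensorProduct.map_tmul, opFun_apply _ _ hv]
    simp [Set.indicator_of_notMem, hc.symm]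

theorem qHH_mul_qHHInv (V W : WtMod r) : qHH V W * qHHInv V W = 1 := by
  refine WtMod.tensor_ext_weight fun a b v w hv hw => ?_
  rw [Module.End.mul_apply, qHHInv_tmul V W hv hw, map_smul, qHH_tmul V W hv hw, smul_smul,
    qpow_neg, inv_mul_cancel₀ (qpow_ne_zero _ _), one_smul, Module.End.one_apply]

theorem qHHInv_mul_qHH (V W : WtMod r) : qHHInv V W * qHH V W = 1 := by
  refine WtMod.tensor_ext_weight fun a b v w hv hw => ?_
  rw [Module.End.mul_apply, qHH_tmul V W hv hw, map_smul, qHHInv_tmul V W hv hw, smul_smul,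
    qpow_neg, mul_inv_cancel₀ (qpow_ne_zero _ _), one_smul, Module.End.one_apply]

/-- The inverse of the R-matrix. -/
def rMatrixInv (V W : WtMod r) : Module.End ℂ (V ⊗[ℂ] W) :=
  (∑ n ∈ Finset.range r, rCoeffInv r n • TensorProduct.map (V.E ^ n) (W.F ^ n)) * qHHInv V W

variable [r.AtLeastTwo]

omit [r.AtLeastTwo] in
theorem map_E_F_pow (V W : WtMod r) : TensorProduct.map V.E W.F ^ r = 0 := by
  rw [TensorProduct.map_pow, V.E_pow, TensorProduct.map_zero_left]

theorem rMatrix_mul_rMatrixInv (V W : WtMod r) : rMatrix V W * rMatrixInv V W = 1 := by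
  have h := sum_rCoeff_sum_rCoeffInv (NeZero.ne r) (map_E_F_pow V W)
  simp only [TensorProduct.map_pow] at h
  rw [rMatrix, rMatrixInv, mul_assoc, ← mul_assoc (∑ n ∈ _, _) (∑ n ∈ _, _), h, one_mul,
    qHH_mul_qHHInv]

theorem rMatrixInv_mul_rMatrix (V W : WtMod r) : rMatrixInv V W * rMatrix V W = 1 := by
  have h := sum_rCoeffInv_sum_rCoeff (NeZero.ne r) (map_E_F_pow V W)
  simp only [TensorProduct.map_pow] at h
  rw [rMatrix, rMatrixInv, mul_assoc, ← mul_assoc (qHHInv V W), qHHInv_mul_qHH, one_mul, h]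

/-- The braiding as a linear isomorphism. -/
def braidingEquiv (V W : WtMod r) : V ⊗[ℂ] W ≃ₗ[ℂ] W ⊗[ℂ] V :=
  (LinearEquiv.ofLinearMap (rMatrix V W) (rMatrixInv V W) (rMatrix_mul_rMatrixInv V W)
    (rMatrixInv_mul_rMatrix V W) : V ⊗[ℂ] W ≃ₗ[ℂ] V ⊗[ℂ] W).trans (TensorProduct.comm ℂ V W)

/-- This is R Δ(E) = Δ^op(E) R. The terms where E falls on F^n w are shifted by one index, using E^r
= 0, and then compared through the commutator of E with F^(n+1). -/
theorem braiding_E (V W : WtMod r) :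
    braiding V W ∘ₗ WtMod.tensorE V W = WtMod.tensorE W V ∘ₗ braiding V W := by
  refine WtMod.tensor_ext_weight fun a b v w hv hw => ?_
  simp only [LinearMap.comp_apply, WtMod.tensorE, LinearMap.add_apply, TensorProduct.map_tmul,
    Module.End.one_apply, map_add, W.K_eq b w hw, TensorProduct.tmul_smul, map_smul]
  rw [braiding_tmul V W hv (WtMod.H_E_apply hw), braiding_tmul V W (WtMod.H_E_apply hv) hw,
    braiding_tmul V W hv hw, map_sum, map_sum]
  have h0 : qbr r 1 ≠ 0 := qbr_one_ne_zero r
  simp only [map_smul, TensorProduct.map_tmul, Module.End.one_apply]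
  set f : ℕ → W ⊗[ℂ] V := fun n => (rCoeff r n * qpow r ((a + 2 * n) * (b - 2 * n) / 2)) •
    (W.E ((W.F ^ n) w) ⊗ₜ[ℂ] V.K ((V.E ^ n) v)) with hf
  set g : ℕ → W ⊗[ℂ] V := fun n => (rCoeff r n * qpow r ((a + 2 * n) * (b + 2 - 2 * n) / 2)) •
    ((W.F ^ n) (W.E w) ⊗ₜ[ℂ] (V.E ^ n) v) with hg
  have e1 : ∑ n ∈ Finset.range r, f n = f 0 + ∑ n ∈ Finset.range r, f (n + 1) :=
    sum_range_eq_shift f r (by simp [hf, V.E_pow])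
  have e2 : ∑ n ∈ Finset.range r, g n = g 0 + ∑ n ∈ Finset.range r, g (n + 1) :=
    sum_range_eq_shift g r (by simp [hg, V.E_pow])
  change ∑ n ∈ Finset.range r, g n + _ = _ + ∑ n ∈ Finset.range r, f n
  have hK : ∀ n : ℕ, V.K ((V.E ^ n) v) = qpow r (a + 2 * n) • (V.E ^ n) v := fun n =>
    V.K_eq _ _ (WtMod.H_E_pow_apply hv n)
  have e0 : f 0 = g 0 := by
    simp only [hf, hg, hK, TensorProduct.tmul_smul, smul_smul, pow_zero, Module.End.one_apply,
      mul_assoc, ← qpow_add]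
    ring_nf
  -- The two terms of index 0 coincide and cancel; the remaining identity holds termwise.
  rw [e1, e2, e0, add_assoc, add_left_comm _ (g 0) (∑ n ∈ Finset.range r, f (n + 1)), add_right_inj, Finset.smul_sum,
    ← Finset.sum_add_distrib, ← Finset.sum_add_distrib]
  refine Finset.sum_congr rfl fun n hn => ?_
  rcases (show n + 1 < r ∨ n + 1 = r by have := Finset.mem_range.1 hn; omega) with h | h
  · simp only [hf, hg]
    rw [WtMod.E_F_pow_apply hw, hK (n + 1), TensorProduct.add_tmul,
      ← Module.End.mul_apply (V.E ^ n), ← pow_succ, ← Module.End.mul_apply V.E, ← pow_succ']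
    simp only [TensorProduct.tmul_smul, ← TensorProduct.smul_tmul']
    have hB : rCoeff r (n + 1) * qpow r ((a + 2 * (n + 1 : ℕ)) * (b + 2 - 2 * (n + 1 : ℕ)) / 2)
        = rCoeff r (n + 1) * qpow r ((a + 2 * (n + 1 : ℕ)) * (b - 2 * (n + 1 : ℕ)) / 2)
          * qpow r (a + 2 * (n + 1 : ℕ)) := by
      rw [mul_assoc, ← qpow_add]
      push_cast
      ring_nf
    have hA : qpow r b * (rCoeff r n * qpow r ((a + 2 + 2 * n) * (b - 2 * n) / 2))
        = rCoeff r n * qpow r ((a + 2 * n) * (b - 2 * n) / 2)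
          + rCoeff r (n + 1) * qpow r ((a + 2 * (n + 1 : ℕ)) * (b - 2 * (n + 1 : ℕ)) / 2)
            * qpow r (a + 2 * (n + 1 : ℕ)) * (qbr r (n + 1) * qbr r (b - n) / qbr r 1 ^ 2) := by
      have hs := rCoeff_succ h
      have e3 : qpow r b * (rCoeff r n * qpow r ((a + 2 + 2 * n) * (b - 2 * n) / 2))
          = rCoeff r n * (qpow r n * qpow r ((a + 2 * (n + 1 : ℕ)) * (b - 2 * (n + 1 : ℕ)) / 2)
            * qpow r (a + 2 * (n + 1 : ℕ)) * qpow r (b - n)) := by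
        rw [mul_left_comm, ← qpow_add, ← qpow_add, ← qpow_add, ← qpow_add]
        push_cast
        ring_nf
      have e4 : qpow r ((a + 2 * n) * (b - 2 * n) / 2)
          = (qpow r n * qpow r ((a + 2 * (n + 1 : ℕ)) * (b - 2 * (n + 1 : ℕ)) / 2)
            * qpow r (a + 2 * (n + 1 : ℕ)) * qpow r (-(b - n))) := by
        rw [← qpow_add, ← qpow_add, ← qpow_add]
        push_cast
        ring_nf
      rw [e3, e4, qbr.eq_def r (b - n)]
      field_simp
      linear_combination (-(qpow r (b - ↑n) - qpow r (-(b - ↑n)))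
        * qpow r ((a + 2 * (n + 1 : ℕ)) * (b - 2 * (n + 1 : ℕ)) / 2)
        * qpow r (a + 2 * (n + 1 : ℕ))) * hs
    -- `hA` and `hB` compare the coefficients of the two vectors F^n w ⊗ E^(n+1) v and F^(n+1) E w ⊗
    -- E^(n+1) v.
    linear_combination (norm := module) hA • ((W.F ^ n) w ⊗ₜ[ℂ] (V.E ^ (n + 1)) v)
      + hB • ((W.F ^ (n + 1)) (W.E w) ⊗ₜ[ℂ] (V.E ^ (n + 1)) v)
  -- At the last index the recursion for the coefficients is not available, but every term carries
  -- E^r v.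
  · have hE : (V.E ^ (n + 1)) v = 0 := by rw [h, V.E_pow, LinearMap.zero_apply]
    simp [hf, hg, hE, ← Module.End.mul_apply (V.E ^ n), ← Module.End.mul_apply V.E, ← pow_succ, ← pow_succ']

theorem braiding_F (V W : WtMod r) :
    braiding V W ∘ₗ WtMod.tensorF V W = WtMod.tensorF W V ∘ₗ braiding V W := by
  refine WtMod.tensor_ext_weight fun a b v w hv hw => ?_
  simp only [LinearMap.comp_apply, WtMod.tensorF, LinearMap.add_apply, TensorProduct.map_tmul,
    Module.End.one_apply, map_add, WtMod.Kinv_apply hv, ← TensorProduct.smul_tmul', map_smul]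
  rw [braiding_tmul V W hv (WtMod.H_F_apply hw), braiding_tmul V W (WtMod.H_F_apply hv) hw,
    braiding_tmul V W hv hw, map_sum, map_sum]
  have h0 : qbr r 1 ≠ 0 := qbr_one_ne_zero r
  simp only [map_smul, TensorProduct.map_tmul, Module.End.one_apply]
  set f : ℕ → W ⊗[ℂ] V := fun n => (rCoeff r n * qpow r ((a + 2 * n) * (b - 2 * n) / 2)) •
    (W.Kinv ((W.F ^ n) w) ⊗ₜ[ℂ] V.F ((V.E ^ n) v)) with hf
  set g : ℕ → W ⊗[ℂ] V := fun n => (rCoeff r n * qpow r ((a - 2 + 2 * n) * (b - 2 * n) / 2)) •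
    ((W.F ^ n) w ⊗ₜ[ℂ] (V.E ^ n) (V.F v)) with hg
  have e1 : ∑ n ∈ Finset.range r, f n = f 0 + ∑ n ∈ Finset.range r, f (n + 1) :=
    sum_range_eq_shift f r (by simp [hf, W.F_pow])
  have e2 : ∑ n ∈ Finset.range r, g n = g 0 + ∑ n ∈ Finset.range r, g (n + 1) :=
    sum_range_eq_shift g r (by simp [hg, W.F_pow])
  change _ + ∑ n ∈ Finset.range r, g n = ∑ n ∈ Finset.range r, f n + _
  have hK : ∀ n : ℕ, W.Kinv ((W.F ^ n) w) = qpow r (-(b - 2 * n)) • (W.F ^ n) w := fun n =>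
    WtMod.Kinv_apply (WtMod.H_F_pow_apply hw n)
  have e0 : f 0 = g 0 := by
    simp only [hf, hg, hK, ← TensorProduct.smul_tmul', smul_smul, pow_zero, Module.End.one_apply,
      mul_assoc, ← qpow_add]
    ring_nf
  rw [e1, e2, e0, add_left_comm _ (g 0) (∑ n ∈ Finset.range r, g (n + 1)), add_assoc, add_right_inj, Finset.smul_sum,
    ← Finset.sum_add_distrib, ← Finset.sum_add_distrib]
  refine Finset.sum_congr rfl fun n hn => ?_
  rcases (show n + 1 < r ∨ n + 1 = r by have := Finset.mem_range.1 hn; omega) with h | h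
  · simp only [hf, hg]
    rw [WtMod.F_E_pow_apply hv, hK (n + 1), TensorProduct.tmul_sub,
      ← Module.End.mul_apply (W.F ^ n), ← pow_succ, ← Module.End.mul_apply W.F, ← pow_succ']
    simp only [TensorProduct.tmul_smul, ← TensorProduct.smul_tmul']
    have hB : rCoeff r (n + 1) * qpow r ((a - 2 + 2 * (n + 1 : ℕ)) * (b - 2 * (n + 1 : ℕ)) / 2)
        = rCoeff r (n + 1) * qpow r ((a + 2 * (n + 1 : ℕ)) * (b - 2 * (n + 1 : ℕ)) / 2)
          * qpow r (-(b - 2 * (n + 1 : ℕ))) := by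
      rw [mul_assoc, ← qpow_add]
      push_cast
      ring_nf
    have hA : qpow r (-a) * (rCoeff r n * qpow r ((a + 2 * n) * (b - 2 - 2 * n) / 2))
        = rCoeff r n * qpow r ((a + 2 * n) * (b - 2 * n) / 2)
          - rCoeff r (n + 1) * qpow r ((a + 2 * (n + 1 : ℕ)) * (b - 2 * (n + 1 : ℕ)) / 2)
            * qpow r (-(b - 2 * (n + 1 : ℕ))) * (qbr r (n + 1) * qbr r (a + n) / qbr r 1 ^ 2) := by
      have hs := rCoeff_succ h
      have e3 : qpow r (-a) * (rCoeff r n * qpow r ((a + 2 * n) * (b - 2 - 2 * n) / 2))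
          = rCoeff r n * (qpow r n * qpow r ((a + 2 * (n + 1 : ℕ)) * (b - 2 * (n + 1 : ℕ)) / 2)
            * qpow r (-(b - 2 * (n + 1 : ℕ))) * qpow r (-(a + n))) := by
        rw [mul_left_comm, ← qpow_add, ← qpow_add, ← qpow_add, ← qpow_add]
        push_cast
        ring_nf
      have e4 : qpow r ((a + 2 * n) * (b - 2 * n) / 2)
          = (qpow r n * qpow r ((a + 2 * (n + 1 : ℕ)) * (b - 2 * (n + 1 : ℕ)) / 2)
            * qpow r (-(b - 2 * (n + 1 : ℕ))) * qpow r (a + n)) := by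
        rw [← qpow_add, ← qpow_add, ← qpow_add]
        push_cast
        ring_nf
      rw [e3, e4, qbr.eq_def r (a + n)]
      field_simp
      linear_combination ((qpow r (a + n) - qpow r (-(a + n)))
        * qpow r ((a + 2 * (n + 1 : ℕ)) * (b - 2 * (n + 1 : ℕ)) / 2)
        * qpow r (-(b - 2 * (n + 1 : ℕ)))) * hs
    linear_combination (norm := module) hA • ((W.F ^ (n + 1)) w ⊗ₜ[ℂ] (V.E ^ n) v)
      + hB • ((W.F ^ (n + 1)) w ⊗ₜ[ℂ] (V.E ^ (n + 1)) (V.F v))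
  · have hF : (W.F ^ (n + 1)) w = 0 := by rw [h, W.F_pow, LinearMap.zero_apply]
    simp [hf, hg, hF, ← Module.End.mul_apply (W.F ^ n), ← Module.End.mul_apply W.F, ← pow_succ, ← pow_succ']

end Braiding
end UnrolledSl2

end

open CategoryTheory TensorProduct
noncomputable section
namespace UnrolledSl2

/-! ### The braided category of weight modules -/

section Hexagon

variable {r : ℕ} [r.AtLeastTwo]

omit [r.AtLeastTwo] in
theorem tensorF_pow_tmul (V W : WtMod r) {a : ℂ} {v : V} (hv : V.H v = a • v) (w : W) (n : ℕ) :
    (WtMod.tensorF V W ^ n) (v ⊗ₜ w) = ∑ k ∈ Finset.range (n + 1),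
      (gaussBinom (qpow r 2) n k * qpow r (-(a * (n - k : ℕ)))) •
        ((V.F ^ k) v ⊗ₜ[ℂ] (W.F ^ (n - k)) w) := by
  have hq : TensorProduct.map V.Kinv W.F * TensorProduct.map V.F 1
      = qpow r 2 • (TensorProduct.map V.F 1 * TensorProduct.map V.Kinv W.F) := by
    rw [← TensorProduct.map_mul, ← TensorProduct.map_mul, V.FKinv, TensorProduct.map_smul_left,
      mul_one, one_mul, smul_smul, ← qpow_add]
    simp [qpow_zero]
  have hK : ∀ m : ℕ, (V.Kinv ^ m) v = qpow r (-(a * m)) • v := by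
    intro m
    induction m with
    | zero => simp [qpow_zero]
    | succ m ih =>
      rw [pow_succ', Module.End.mul_apply, ih, map_smul, WtMod.Kinv_apply hv, smul_smul, ← qpow_add]
      push_cast
      ring_nf
  rw [WtMod.tensorF, add_comm, add_pow_of_qcomm hq, LinearMap.sum_apply]
  refine Finset.sum_congr rfl fun k _ => ?_
  rw [LinearMap.smul_apply, TensorProduct.map_pow, TensorProduct.map_pow, Module.End.mul_apply,
    TensorProduct.map_tmul, TensorProduct.map_tmul, hK, one_pow, Module.End.one_apply, map_smul,
    ← TensorProduct.smul_tmul', smul_smul]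

omit [r.AtLeastTwo] in
theorem tensorE_pow_tmul (V W : WtMod r) {b : ℂ} (v : V) {w : W} (hw : W.H w = b • w) (n : ℕ) :
    (WtMod.tensorE V W ^ n) (v ⊗ₜ w) = ∑ k ∈ Finset.range (n + 1),
      (gaussBinom (qpow r 2) n k * qpow r (b * (n - k : ℕ))) •
        ((V.E ^ (n - k)) v ⊗ₜ[ℂ] (W.E ^ k) w) := by
  have hq : TensorProduct.map V.E W.K * TensorProduct.map 1 W.E
      = qpow r 2 • (TensorProduct.map 1 W.E * TensorProduct.map V.E W.K) := by
    rw [← TensorProduct.map_mul, ← TensorProduct.map_mul, W.KE, TensorProduct.map_smul_right,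
      mul_one, one_mul]
  have hK : ∀ m : ℕ, (W.K ^ m) w = qpow r (b * m) • w := by
    intro m
    induction m with
    | zero => simp [qpow_zero]
    | succ m ih =>
      rw [pow_succ', Module.End.mul_apply, ih, map_smul, W.K_eq b w hw, smul_smul, ← qpow_add]
      push_cast
      ring_nf
  rw [WtMod.tensorE, add_pow_of_qcomm hq, LinearMap.sum_apply]
  refine Finset.sum_congr rfl fun k _ => ?_
  rw [LinearMap.smul_apply, TensorProduct.map_pow, TensorProduct.map_pow, Module.End.mul_apply,
    TensorProduct.map_tmul, TensorProduct.map_tmul, hK, one_pow, Module.End.one_apply, map_smul,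
    TensorProduct.tmul_smul, smul_smul]

theorem tensor_H_tmul (V W : WtMod r) {a b : ℂ} {v : V} {w : W} (hv : V.H v = a • v)
    (hw : W.H w = b • w) : (V.tensor W).H (v ⊗ₜ[ℂ] w) = (a + b) • (v ⊗ₜ[ℂ] w : V ⊗[ℂ] W) := by
  change WtMod.tensorH V W (v ⊗ₜ w) = _
  simp [WtMod.tensorH, hv, hw, add_smul, TensorProduct.smul_tmul']

omit [r.AtLeastTwo] in
theorem tensor_ext_weight_threefold {X Y Z : WtMod r} {M : Type*} [AddCommGroup M] [Module ℂ M]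
    {f g : (X ⊗[ℂ] Y) ⊗[ℂ] Z →ₗ[ℂ] M} (h : ∀ (a b c : ℂ) (x : X) (y : Y) (z : Z),
      X.H x = a • x → Y.H y = b • y → Z.H z = c • z → f (x ⊗ₜ y ⊗ₜ z) = g (x ⊗ₜ y ⊗ₜ z)) :
    f = g :=
  TensorProduct.ext (WtMod.tensor_ext_weight fun a b x y hx hy =>
    WtMod.ext_weight fun c z hz => h a b c x y z hx hy hz)

/-- This is (id ⊗ Δ) R = R₁₃ R₁₂. The q-binomial theorem expands F^n on Y ⊗ Z, and
`rCoeff_mul_rCoeff` splits the coefficient; the remaining powers of q agree on weight vectors. -/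
theorem braiding_tensor_right_tmul (X Y Z : WtMod r) {a b c : ℂ} {x : X} {y : Y} {z : Z}
    (hx : X.H x = a • x) (hy : Y.H y = b • y) (hz : Z.H z = c • z) :
    TensorProduct.assoc ℂ Y Z X (braiding X (Y.tensor Z) (x ⊗ₜ[ℂ] (y ⊗ₜ[ℂ] z)))
      = TensorProduct.map 1 (braiding X Z)
        (TensorProduct.assoc ℂ Y X Z (braiding X Y (x ⊗ₜ y) ⊗ₜ z)) := by
  have hL : (braiding X (Y.tensor Z) (x ⊗ₜ[ℂ] (y ⊗ₜ[ℂ] z)) : (Y ⊗[ℂ] Z) ⊗[ℂ] X)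
      = ∑ n ∈ Finset.range r, (rCoeff r n * qpow r ((a + 2 * n) * (b + c - 2 * n) / 2)) •
        ((WtMod.tensorF Y Z ^ n) (y ⊗ₜ[ℂ] z) ⊗ₜ[ℂ] (X.E ^ n) x) :=
    braiding_tmul X (Y.tensor Z) hx (tensor_H_tmul Y Z hy hz)
  refine (congrArg (TensorProduct.assoc ℂ Y Z X) hL).trans ?_
  rw [braiding_tmul X Y hx hy]
  rw [TensorProduct.sum_tmul, map_sum, map_sum, map_sum]
  have hR : ∀ k ∈ Finset.range r, TensorProduct.map 1 (braiding X Z) (TensorProduct.assoc ℂ Y X Z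
      (((rCoeff r k * qpow r ((a + 2 * k) * (b - 2 * k) / 2)) •
        ((Y.F ^ k) y ⊗ₜ[ℂ] (X.E ^ k) x)) ⊗ₜ[ℂ] z)) = ∑ l ∈ Finset.range r,
      (rCoeff r k * rCoeff r l * qpow r ((a + 2 * k) * (b - 2 * k) / 2
        + (a + 2 * (k + l)) * (c - 2 * l) / 2)) •
          ((Y.F ^ k) y ⊗ₜ[ℂ] ((Z.F ^ l) z ⊗ₜ[ℂ] (X.E ^ (l + k)) x)) := by
    intro k _
    rw [← TensorProduct.smul_tmul', map_smul, map_smul, TensorProduct.assoc_tmul,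
      TensorProduct.map_tmul, braiding_tmul X Z (WtMod.H_E_pow_apply hx k) hz,
      TensorProduct.tmul_sum, Finset.smul_sum]
    refine Finset.sum_congr rfl fun l _ => ?_
    rw [TensorProduct.tmul_smul, smul_smul, Module.End.one_apply, pow_add, Module.End.mul_apply,
      qpow_add]
    congr 1
    ring_nf
  rw [Finset.sum_congr rfl hR, ← sum_range_sum_range]
  · refine Finset.sum_congr rfl fun n hn => ?_
    rw [map_smul, tensorF_pow_tmul Y Z hy z, TensorProduct.sum_tmul, map_sum, Finset.smul_sum]
    refine Finset.sum_congr rfl fun k hk => ?_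
    have hkn : k ≤ n := Finset.mem_range_succ_iff.1 hk
    rw [← TensorProduct.smul_tmul', map_smul, TensorProduct.assoc_tmul, smul_smul,
      Nat.sub_add_cancel hkn, rCoeff_mul_rCoeff (k := k) (l := n - k)
        (by have := Finset.mem_range.1 hn; omega), Nat.add_sub_cancel' hkn]
    congr 1
    have hn' : (n : ℂ) = k + (n - k : ℕ) := by exact_mod_cast (Nat.add_sub_cancel' hkn).symm
    generalize ((n - k : ℕ) : ℂ) = l at hn'
    rw [hn']
    have e : qpow r ((a + 2 * (k + l)) * (b + c - 2 * (k + l)) / 2) * qpow r (-(b * l))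
        = qpow r (-(2 * k * l)) * qpow r ((a + 2 * k) * (b - 2 * k) / 2
          + (a + 2 * (k + l)) * (c - 2 * l) / 2) := by
      rw [← qpow_add, ← qpow_add]
      ring_nf
    linear_combination (rCoeff r n * gaussBinom (qpow r 2) n k) * e
  · intro k l hkl
    have : (X.E ^ (l + k)) = 0 := pow_eq_zero_of_le (by omega) X.E_pow
    simp [this]

/-- The mirror identity (Δ ⊗ id) R = R₁₃ R₂₃, with E^n on X ⊗ Y expanded instead. -/
theorem braiding_tensor_left_tmul (X Y Z : WtMod r) {a b c : ℂ} {x : X} {y : Y} {z : Z}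
    (hx : X.H x = a • x) (hy : Y.H y = b • y) (hz : Z.H z = c • z) :
    (TensorProduct.assoc ℂ Z X Y).symm (braiding (X.tensor Y) Z ((x ⊗ₜ[ℂ] y) ⊗ₜ[ℂ] z))
      = TensorProduct.map (braiding X Z) 1
        ((TensorProduct.assoc ℂ X Z Y).symm (x ⊗ₜ braiding Y Z (y ⊗ₜ z))) := by
  have hL : (braiding (X.tensor Y) Z ((x ⊗ₜ[ℂ] y) ⊗ₜ[ℂ] z) : Z ⊗[ℂ] (X ⊗[ℂ] Y))
      = ∑ n ∈ Finset.range r, (rCoeff r n * qpow r ((a + b + 2 * n) * (c - 2 * n) / 2)) •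
        ((Z.F ^ n) z ⊗ₜ[ℂ] (WtMod.tensorE X Y ^ n) (x ⊗ₜ[ℂ] y)) :=
    braiding_tmul (X.tensor Y) Z (tensor_H_tmul X Y hx hy) hz
  refine (congrArg (TensorProduct.assoc ℂ Z X Y).symm hL).trans ?_
  rw [braiding_tmul Y Z hy hz]
  rw [TensorProduct.tmul_sum, map_sum, map_sum, map_sum]
  have hR : ∀ k ∈ Finset.range r, TensorProduct.map (braiding X Z) 1
      ((TensorProduct.assoc ℂ X Z Y).symm (x ⊗ₜ[ℂ]
        ((rCoeff r k * qpow r ((b + 2 * k) * (c - 2 * k) / 2)) •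
        ((Z.F ^ k) z ⊗ₜ[ℂ] (Y.E ^ k) y)))) = ∑ l ∈ Finset.range r,
      (rCoeff r k * rCoeff r l * qpow r ((b + 2 * k) * (c - 2 * k) / 2
        + (a + 2 * l) * (c - 2 * (k + l)) / 2)) •
          (((Z.F ^ (l + k)) z ⊗ₜ[ℂ] (X.E ^ l) x) ⊗ₜ[ℂ] (Y.E ^ k) y) := by
    intro k _
    rw [TensorProduct.tmul_smul, map_smul, map_smul, TensorProduct.assoc_symm_tmul,
      TensorProduct.map_tmul, braiding_tmul X Z hx (WtMod.H_F_pow_apply hz k),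
      TensorProduct.sum_tmul, Finset.smul_sum]
    refine Finset.sum_congr rfl fun l _ => ?_
    rw [← TensorProduct.smul_tmul', smul_smul, Module.End.one_apply, pow_add, Module.End.mul_apply,
      qpow_add]
    congr 1
    ring_nf
  rw [Finset.sum_congr rfl hR, ← sum_range_sum_range]
  · refine Finset.sum_congr rfl fun n hn => ?_
    rw [map_smul, tensorE_pow_tmul X Y x hy, TensorProduct.tmul_sum, map_sum, Finset.smul_sum]
    refine Finset.sum_congr rfl fun k hk => ?_
    have hkn : k ≤ n := Finset.mem_range_succ_iff.1 hk
    rw [TensorProduct.tmul_smul, map_smul, TensorProduct.assoc_symm_tmul, smul_smul,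
      Nat.sub_add_cancel hkn, rCoeff_mul_rCoeff (k := k) (l := n - k)
        (by have := Finset.mem_range.1 hn; omega), Nat.add_sub_cancel' hkn]
    congr 1
    have hn' : (n : ℂ) = k + (n - k : ℕ) := by exact_mod_cast (Nat.add_sub_cancel' hkn).symm
    generalize ((n - k : ℕ) : ℂ) = l at hn'
    rw [hn']
    have e : qpow r ((a + b + 2 * (k + l)) * (c - 2 * (k + l)) / 2) * qpow r (b * l)
        = qpow r (-(2 * k * l)) * qpow r ((b + 2 * k) * (c - 2 * k) / 2
          + (a + 2 * l) * (c - 2 * (k + l)) / 2) := by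
      rw [← qpow_add, ← qpow_add]
      ring_nf
    linear_combination (rCoeff r n * gaussBinom (qpow r 2) n k) * e
  · intro k l hkl
    have : (Z.F ^ (l + k)) = 0 := pow_eq_zero_of_le (by omega) Z.F_pow
    simp [this]

theorem braiding_mem_homs (V W : WtMod r) :
    braiding V W ∈ WtMod.homs (V.tensor W) (W.tensor V) := by
  refine ⟨braiding_E V W, braiding_F V W, ?_, ?_⟩
  · change braiding V W ∘ₗ TensorProduct.map V.K W.K = TensorProduct.map W.K V.K ∘ₗ braiding V W
    refine WtMod.tensor_ext_weight fun a b v w hv hw => ?_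
    rw [LinearMap.comp_apply, LinearMap.comp_apply, TensorProduct.map_tmul, V.K_eq a v hv,
      W.K_eq b w hw, TensorProduct.smul_tmul_smul, map_smul, braiding_tmul V W hv hw, map_sum,
      Finset.smul_sum]
    refine Finset.sum_congr rfl fun n _ => ?_
    rw [map_smul, TensorProduct.map_tmul, V.K_eq _ _ (WtMod.H_E_pow_apply hv n),
      W.K_eq _ _ (WtMod.H_F_pow_apply hw n), TensorProduct.smul_tmul_smul, smul_comm, ← qpow_add,
      ← qpow_add]
    ring_nf
  · change braiding V W ∘ₗ WtMod.tensorH V W = WtMod.tensorH W V ∘ₗ braiding V W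
    refine WtMod.tensor_ext_weight fun a b v w hv hw => ?_
    have h : WtMod.tensorH V W (v ⊗ₜ w) = (a + b) • (v ⊗ₜ w) := tensor_H_tmul V W hv hw
    rw [LinearMap.comp_apply, LinearMap.comp_apply, h, map_smul, braiding_tmul V W hv hw, map_sum,
      Finset.smul_sum]
    refine Finset.sum_congr rfl fun n _ => ?_
    have h2 : WtMod.tensorH W V ((W.F ^ n) w ⊗ₜ (V.E ^ n) v) = _ :=
      tensor_H_tmul W V (WtMod.H_F_pow_apply hw n) (WtMod.H_E_pow_apply hv n)
    rw [map_smul, h2, smul_comm]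
    ring_nf

instance : BraidedCategory (WtMod r) where
  braiding V W := WtMod.isoOfLin (braidingEquiv V W) (braiding_mem_homs V W)
  braiding_naturality_right X _ _ f := WtMod.hom_ext (braiding_natural (𝟙 X) f)
  braiding_naturality_left f Z := WtMod.hom_ext (braiding_natural f (𝟙 Z))
  hexagon_forward X Y Z := WtMod.hom_ext (tensor_ext_weight_threefold
    fun _ _ _ _ _ _ hx hy hz => braiding_tensor_right_tmul X Y Z hx hy hz)
  hexagon_reverse X Y Z := by
    -- Precomposing with the associator puts the source in left-bracketed form, where weight vectors
    -- can be tested.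
    rw [← cancel_epi (MonoidalCategoryStruct.associator X Y Z).hom]
    refine WtMod.hom_ext (tensor_ext_weight_threefold
      fun _ _ _ _ _ _ hx hy hz => braiding_tensor_left_tmul X Y Z hx hy hz)

end Hexagon
end UnrolledSl2

end

open CategoryTheory TensorProduct
noncomputable section
namespace UnrolledSl2

/-! ### Pairings in braided categories -/

section Pairing

open MonoidalCategory BraidedCategory

universe v u

variable {C : Type u} [Category.{v} C] [MonoidalCategory C] [BraidedCategory C]

/-- A strand passes freely over a cap: naturality of the braiding in p, and triviality of the
braiding with the unit. -/
theorem braiding_slide_pairing {A B : C} (p : A ⊗ B ⟶ 𝟙_ C) (W : C) :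
    (β_ W A).hom ▷ B ⊗≫ A ◁ (β_ W B).hom ⊗≫ p ▷ W ⊗≫ 𝟙 W = 𝟙 _ ⊗≫ W ◁ p ⊗≫ 𝟙 W := by
  have h := braiding_naturality_right W p
  rw [braiding_tensor_right_hom, braiding_tensorUnit_right] at h
  calc _ = 𝟙 _ ⊗≫ (((α_ W A B).inv ≫ (β_ W A).hom ▷ B ≫ (α_ A W B).hom ≫ A ◁ (β_ W B).hom ≫
        (α_ A B W).inv) ≫ p ▷ W) ⊗≫ 𝟙 W := by monoidal
    _ = 𝟙 _ ⊗≫ W ◁ p ⊗≫ 𝟙 W := by rw [← h]; monoidal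

/-- The evaluation `(W' ⊗ V') ⊗ (V ⊗ W) ⟶ 𝟙` obtained from `V' ⊗ V ⟶ 𝟙` and `W' ⊗ W ⟶ 𝟙`. -/
def nestedPairing {V V' W W' : C} (p : V' ⊗ V ⟶ 𝟙_ C) (q : W' ⊗ W ⟶ 𝟙_ C) :
    (W' ⊗ V') ⊗ (V ⊗ W) ⟶ 𝟙_ C :=
  𝟙 _ ⊗≫ W' ◁ (p ▷ W) ⊗≫ q

/-- The braiding of V ⊗ W with W' ⊗ V' is resolved into four crossings. The double crossing of V and
W lets each strand slide off the cap of the other, leaving one crossing inside each cap. With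
evaluations as caps this becomes the multiplicativity of the Drinfeld operator. -/
theorem double_braiding_nestedPairing {V V' W W' : C} (p : V' ⊗ V ⟶ 𝟙_ C) (q : W' ⊗ W ⟶ 𝟙_ C) :
    ((β_ V W).hom ≫ (β_ W V).hom) ▷ (W' ⊗ V') ≫ (β_ (V ⊗ W) (W' ⊗ V')).hom ≫ nestedPairing p q
      = nestedPairing ((β_ W W').hom ≫ q) ((β_ V V').hom ≫ p) := by
  rw [nestedPairing, nestedPairing]
  calc _ = 𝟙 _ ⊗≫ (β_ V W).hom ▷ W' ▷ V' ⊗≫ ((β_ W V).hom ▷ W' ≫ (β_ (V ⊗ W) W').hom) ▷ V' ⊗≫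
        W' ◁ (V ◁ (β_ W V').hom ⊗≫ ((β_ V V').hom ≫ p) ▷ W ⊗≫ 𝟙 W) ⊗≫ q := by
        rw [braiding_tensor_right_hom (V ⊗ W) W' V', braiding_tensor_left_hom V W V']
        monoidal
    _ = 𝟙 _ ⊗≫ (β_ V W).hom ▷ W' ▷ V' ⊗≫ (β_ (W ⊗ V) W').hom ▷ V' ⊗≫
        W' ◁ ((β_ W V).hom ▷ V' ⊗≫ V ◁ (β_ W V').hom ⊗≫ ((β_ V V').hom ≫ p) ▷ W ⊗≫ 𝟙 W) ⊗≫ q := by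
        rw [braiding_naturality_left]
        monoidal
    _ = 𝟙 _ ⊗≫ (β_ V W).hom ▷ W' ▷ V' ⊗≫ W ◁ (β_ V W').hom ▷ V' ⊗≫
        ((β_ W W').hom ▷ (V ⊗ V') ≫ (W' ⊗ W) ◁ ((β_ V V').hom ≫ p)) ⊗≫ q := by
        rw [braiding_slide_pairing, braiding_tensor_left_hom W V W']
        monoidal
    _ = 𝟙 _ ⊗≫ (β_ V W).hom ▷ W' ▷ V' ⊗≫ W ◁ (β_ V W').hom ▷ V' ⊗≫
        ((W ⊗ W') ◁ ((β_ V V').hom ≫ p) ≫ ((β_ W W').hom ≫ q) ▷ 𝟙_ C) ⊗≫ 𝟙 _ := by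
        rw [← whisker_exchange]
        monoidal
    _ = 𝟙 _ ⊗≫ ((β_ V W).hom ▷ W' ⊗≫ W ◁ (β_ V W').hom ⊗≫ ((β_ W W').hom ≫ q) ▷ V ⊗≫ 𝟙 V) ▷ V'
        ⊗≫ ((β_ V V').hom ≫ p) := by
        rw [whisker_exchange]
        monoidal
    _ = _ := by
        rw [braiding_slide_pairing]
        monoidal

end Pairing

/-! ### Braidings twisted by a natural automorphism of the identity functor -/

section TwistedBraiding

open MonoidalCategory BraidedCategory

universe v u

variable {C : Type u} [Category.{v} C] [MonoidalCategory C] [BraidedCategory C]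
  (σ τ : ∀ V : C, V ⟶ V)

/-- The morphism `τ_{W ⊗ V} c_{V,W} (σ_V ⊗ σ_W)`. -/
def twistedBraiding (V W : C) : V ⊗ W ⟶ W ⊗ V :=
  (σ V ⊗ₘ σ W) ≫ (β_ V W).hom ≫ τ (W ⊗ V)

variable {σ τ} (hσ : ∀ {V W : C} (f : V ⟶ W), σ V ≫ f = f ≫ σ W)
  (hστ : ∀ V, σ V ≫ τ V = 𝟙 V) (hτσ : ∀ V, τ V ≫ σ V = 𝟙 V)

include hσ hστ hτσ

omit [MonoidalCategory C] [BraidedCategory C] in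
theorem inv_natural {V W : C} (f : V ⟶ W) : τ V ≫ f = f ≫ τ W := by
  calc τ V ≫ f = τ V ≫ (f ≫ σ W) ≫ τ W := by
        rw [Category.assoc, hστ, Category.comp_id]
    _ = (τ V ≫ σ V) ≫ f ≫ τ W := by rw [← hσ]; simp only [Category.assoc]
    _ = f ≫ τ W := by rw [hτσ, Category.id_comp]

/-- The coboundary relation. In each composite the factor τ of the inner twisted braiding meets the
σ of the tensor product and cancels. What remains on both sides is σ ⊗ σ ⊗ σ, three crossings and
one τ, and the crossings agree by the Yang–Baxter equation. -/
theorem twistedBraiding_tensor (U V W : C) :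
    twistedBraiding σ τ (U ⊗ V) W ≫ W ◁ twistedBraiding σ τ U V
      = (α_ U V W).hom ≫ twistedBraiding σ τ U (V ⊗ W) ≫ twistedBraiding σ τ V W ▷ U
        ≫ (α_ W V U).hom := by
  have hτ : ∀ {V W : C} (f : V ⟶ W), τ V ≫ f = f ≫ τ W := inv_natural hσ hστ hτσ
  have key : ∀ V W : C, σ (V ⊗ W) ≫ twistedBraiding σ τ V W = (σ V ⊗ₘ σ W) ≫ (β_ V W).hom := by
    intro V W
    rw [hσ, twistedBraiding, Category.assoc, Category.assoc, hτσ, Category.comp_id]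
  have hyb : (β_ U V).hom ▷ W ≫ (β_ (V ⊗ U) W).hom
      = (α_ U V W).hom ≫ U ◁ (β_ V W).hom ≫ (β_ U (W ⊗ V)).hom ≫ (α_ W V U).hom := by
    have h := yang_baxter U V W
    rw [braiding_tensor_left_hom, braiding_tensor_right_hom]
    calc _ = 𝟙 _ ⊗≫ ((α_ U V W).inv ≫ (β_ U V).hom ▷ W ≫ (α_ V U W).hom ≫ V ◁ (β_ U W).hom ≫
          (α_ V W U).inv ≫ (β_ V W).hom ▷ U ≫ (α_ W V U).hom) ⊗≫ 𝟙 _ := by monoidal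
      _ = _ := by rw [h]; monoidal
  calc _ = (σ (U ⊗ V) ⊗ₘ σ W) ≫ (β_ (U ⊗ V) W).hom ≫ W ◁ twistedBraiding σ τ U V
        ≫ τ (W ⊗ V ⊗ U) := by
        rw [twistedBraiding.eq_def σ τ (U ⊗ V), Category.assoc, Category.assoc, hτ]
    _ = ((σ U ⊗ₘ σ V) ⊗ₘ σ W) ≫ (β_ U V).hom ▷ W ≫ (β_ (V ⊗ U) W).hom ≫ τ (W ⊗ V ⊗ U) := by
        rw [← braiding_naturality_left_assoc, ← tensorHom_id, tensorHom_comp_tensorHom_assoc, key,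
          ← tensorHom_id, tensorHom_comp_tensorHom_assoc]
    _ = ((σ U ⊗ₘ σ V) ⊗ₘ σ W) ≫ (α_ U V W).hom ≫ U ◁ (β_ V W).hom ≫ (β_ U (W ⊗ V)).hom
        ≫ τ ((W ⊗ V) ⊗ U) ≫ (α_ W V U).hom := by
        rw [hτ]
        slice_lhs 2 3 => rw [hyb]
        simp only [Category.assoc]
    _ = (α_ U V W).hom ≫ (σ U ⊗ₘ σ (V ⊗ W)) ≫ U ◁ twistedBraiding σ τ V W ≫ (β_ U (W ⊗ V)).hom
        ≫ τ ((W ⊗ V) ⊗ U) ≫ (α_ W V U).hom := by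
        rw [associator_naturality_assoc, ← id_tensorHom, ← id_tensorHom,
          tensorHom_comp_tensorHom_assoc, tensorHom_comp_tensorHom_assoc, key]
    _ = _ := by
        rw [braiding_naturality_right_assoc, twistedBraiding.eq_def σ τ U (V ⊗ W)]
        simp only [Category.assoc]
        rw [← reassoc_of% @hτ]

/-- By naturality all σ move to the front and all τ to the end, so the composite is the balancing
expression followed by τ². The hypothesis identifies the former with σ². -/
theorem twistedBraiding_comp_twistedBraiding {V W : C}
    (h : σ (V ⊗ W) ≫ σ (V ⊗ W)
      = (σ V ≫ σ V ⊗ₘ σ W ≫ σ W) ≫ (β_ V W).hom ≫ (β_ W V).hom) :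
    twistedBraiding σ τ V W ≫ twistedBraiding σ τ W V = 𝟙 _ := by
  have hτ : ∀ {V W : C} (f : V ⟶ W), τ V ≫ f = f ≫ τ W := inv_natural hσ hστ hτσ
  calc _ = (σ V ≫ σ V ⊗ₘ σ W ≫ σ W) ≫ (β_ V W).hom ≫ (β_ W V).hom ≫ τ (V ⊗ W) ≫ τ (V ⊗ W) := by
        rw [twistedBraiding, twistedBraiding, ← tensorHom_comp_tensorHom]
        simp only [Category.assoc]
        rw [reassoc_of% (hτ (σ W ⊗ₘ σ V)), ← braiding_naturality_assoc (σ V) (σ W),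
          reassoc_of% (hτ (β_ W V).hom)]
    _ = 𝟙 _ := by
        rw [← reassoc_of% h, reassoc_of% (hστ (V ⊗ W)), hστ]


theorem twistedBraiding_unit_left (h : σ (𝟙_ C) = 𝟙 _) (V : C) :
    twistedBraiding σ τ (𝟙_ C) V = (λ_ V).hom ≫ (ρ_ V).inv := by
  rw [twistedBraiding, h, id_tensorHom, braiding_tensorUnit_left, Category.assoc,
    leftUnitor_naturality_assoc, ← inv_natural hσ hστ hτσ (ρ_ V).inv, reassoc_of% (hστ V)]

theorem twistedBraiding_unit_right (h : σ (𝟙_ C) = 𝟙 _) (V : C) :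
    twistedBraiding σ τ V (𝟙_ C) = (ρ_ V).hom ≫ (λ_ V).inv := by
  rw [twistedBraiding, h, tensorHom_id, braiding_tensorUnit_right, Category.assoc,
    rightUnitor_naturality_assoc, ← inv_natural hσ hστ hτσ (λ_ V).inv, reassoc_of% (hστ V)]

end TwistedBraiding
end UnrolledSl2

end

open CategoryTheory TensorProduct
noncomputable section
namespace UnrolledSl2

/-! ### The twist -/

section Twist

variable {r : ℕ}

theorem neg_K_F_pow_apply {V : WtMod r} {μ : ℂ} {v : V} (hv : V.H v = μ • v) (n : ℕ) :
    ((-(V.K * V.F)) ^ n) v = ((-1) ^ n * qpow r (n * μ - n * (n + 1))) • (V.F ^ n) v := by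
  induction n with
  | zero => simp [qpow_zero]
  | succ n ih =>
    have hF := WtMod.H_F_pow_apply hv (n + 1)
    rw [pow_succ' (-(V.K * V.F)), Module.End.mul_apply, ih, map_smul, LinearMap.neg_apply,
      Module.End.mul_apply, ← Module.End.mul_apply V.F, ← pow_succ', V.K_eq _ _ hF, ← neg_smul,
      smul_smul, pow_succ, mul_assoc, mul_neg, ← qpow_add]
    congr 1
    push_cast
    ring_nf

/-- The Drinfeld operator `∑ S(b) a` for `R = ∑ a ⊗ b`. -/
def drinfeldOp (V : WtMod r) : Module.End ℂ V := ∑ n ∈ Finset.range r,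
  rCoeff r n • ((-(V.K * V.F)) ^ n * opFun V.H (fun a => qpow r (-(a ^ 2) / 2)) * V.E ^ n)

theorem thetaOp_eq (V : WtMod r) : thetaOp V = V.K ^ (r - 1) * drinfeldOp V := rfl

theorem drinfeldOp_apply {V : WtMod r} {a : ℂ} {v : V} (hv : V.H v = a • v) :
    drinfeldOp V v = ∑ n ∈ Finset.range r, (rCoeff r n * qpow r (-(a + 2 * n) ^ 2 / 2)) •
      ((-(V.K * V.F)) ^ n) ((V.E ^ n) v) := by
  rw [drinfeldOp, LinearMap.sum_apply]
  refine Finset.sum_congr rfl fun n _ => ?_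
  rw [LinearMap.smul_apply, Module.End.mul_apply, Module.End.mul_apply,
    opFun_apply _ _ (WtMod.H_E_pow_apply hv n), map_smul, smul_smul]

theorem dual_weight_apply {V : WtMod r} {a b : ℂ} {v : V} {f : Module.Dual ℂ V}
    (hv : V.H v = a • v) (hf : V.dual.H f = b • (show V.dual from f)) (hab : a + b ≠ 0) :
    f v = 0 := by
  have h : f (-(V.H v)) = b * f v := LinearMap.congr_fun hf v
  rw [hv, map_neg, map_smul, smul_eq_mul] at h
  have h2 : (a + b) * f v = 0 := by linear_combination -h
  exact (mul_eq_zero.1 h2).resolve_left hab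

theorem dual_F_pow_apply (V : WtMod r) (f : Module.Dual ℂ V) (n : ℕ) (v : V) :
    (show Module.Dual ℂ V from (V.dual.F ^ n) f) v = f (((-(V.K * V.F)) ^ n) v) := by
  have h : V.dual.F ^ n = WtMod.tr ((-(V.K * V.F)) ^ n) := WtMod.tr_pow _ n
  rw [h]
  rfl

/-- The composite evaluation ∘ braiding on V ⊗ V* encodes ∑ S(b) a, because b acts on functionals
through the antipode. This replaces Hopf-algebra computations with u by diagrams. -/
theorem contractLeft_braiding (V : WtMod r) (v : V) (f : Module.Dual ℂ V) :
    contractLeft ℂ V (braiding V V.dual (v ⊗ₜ f)) = f (drinfeldOp V v) := by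
  let P : V ⊗[ℂ] Module.Dual ℂ V →ₗ[ℂ] ℂ := contractLeft ℂ V ∘ₗ braiding V V.dual
  let Q : V ⊗[ℂ] Module.Dual ℂ V →ₗ[ℂ] ℂ :=
    TensorProduct.lift ((Module.Dual.eval ℂ V) ∘ₗ drinfeldOp V)
  have h : P = Q := by
    refine WtMod.tensor_ext_weight (W := V.dual) fun a b v f hv hf => ?_
    have h1 : Q (v ⊗ₜ f) = (show Module.Dual ℂ V from f) (drinfeldOp V v) := rfl
    have h2 : P (v ⊗ₜ f) = contractLeft ℂ V (braiding V V.dual (v ⊗ₜ f)) := rfl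
    refine h2.trans (Eq.trans ?_ h1.symm)
    rw [braiding_tmul V V.dual hv hf, drinfeldOp_apply hv, map_sum]
    refine (map_sum (contractLeft ℂ V) _ _).trans ?_
    refine Finset.sum_congr rfl fun n _ => ?_
    refine ((contractLeft ℂ V).map_smul _ _).trans ?_
    refine Eq.trans ?_ ((show Module.Dual ℂ V from f).map_smul _ _).symm
    have h3 : contractLeft ℂ V ((V.dual.F ^ n) f ⊗ₜ[ℂ] (V.E ^ n) v)
      = (show Module.Dual ℂ V from f) (((-(V.K * V.F)) ^ n) ((V.E ^ n) v)) :=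
      dual_F_pow_apply V f n _
    refine (congrArg (fun t : ℂ => (rCoeff r n * qpow r ((a + 2 * n) * (b - 2 * n) / 2)) • t)
      h3).trans ?_
    -- A functional of weight b sees only vectors of weight -b. For b = -a the exponent (a + 2n)(b -
    -- 2n)/2 becomes -(a + 2n)²/2, as in the Drinfeld operator.
    by_cases hab : a + b = 0
    · rw [eq_neg_of_add_eq_zero_right hab]
      congr 3
      ring
    · have hw := WtMod.H_F_pow_apply (WtMod.H_E_pow_apply hv n) n
      rw [add_sub_cancel_right] at hw
      have h4 : (show Module.Dual ℂ V from f) (((-(V.K * V.F)) ^ n) ((V.E ^ n) v)) = 0 := by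
        rw [neg_K_F_pow_apply (WtMod.H_E_pow_apply hv n), map_smul, dual_weight_apply hw hf hab,
          smul_zero]
      rw [h4, smul_zero, smul_zero]
  exact LinearMap.congr_fun h (v ⊗ₜ f)

variable [r.AtLeastTwo]

/-- Evaluation of functionals is a morphism of modules. -/
theorem contractLeft_mem_homs (V : WtMod r) :
    (contractLeft ℂ V : Module.Dual ℂ V ⊗[ℂ] V →ₗ[ℂ] ℂ)
      ∈ WtMod.homs (V.dual.tensor V) (WtMod.unit r) := by
  refine ⟨?_, ?_, ?_, ?_⟩ <;> refine TensorProduct.ext' fun (f : Module.Dual ℂ V) v => ?_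
  · change contractLeft ℂ V (f ⊗ₜ V.E v + (WtMod.tr (-(V.E * V.Kinv)) f) ⊗ₜ V.K v) = 0
    have h : V.Kinv (V.K v) = v := LinearMap.congr_fun V.Kinv_K v
    simp [h]
  · change contractLeft ℂ V ((WtMod.tr V.K f) ⊗ₜ V.F v + (WtMod.tr (-(V.K * V.F)) f) ⊗ₜ v) = 0
    simp
  · change contractLeft ℂ V ((WtMod.tr V.Kinv f) ⊗ₜ V.K v) = contractLeft ℂ V (f ⊗ₜ v)
    have h : V.Kinv (V.K v) = v := LinearMap.congr_fun V.Kinv_K v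
    simp [h]
  · change contractLeft ℂ V ((WtMod.tr (-V.H) f) ⊗ₜ v + f ⊗ₜ V.H v) = 0
    simp

open MonoidalCategory in
/-- The evaluation `V* ⊗ V ⟶ 𝟙`. -/
def evalHom (V : WtMod r) : V.dual ⊗ V ⟶ 𝟙_ (WtMod r) :=
  WtMod.ofLin (contractLeft ℂ V) (contractLeft_mem_homs V)

/-- This is u x = S²(x) u with S² equal to conjugation by K. It holds because evaluation ∘ braiding
is a module map to the trivial module. -/
theorem drinfeldOp_comm (V : WtMod r) (v : V) :
    drinfeldOp V (V.E v) = V.K (V.E (V.Kinv (drinfeldOp V v))) ∧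
    drinfeldOp V (V.F v) = V.K (V.F (drinfeldOp V (V.Kinv v))) ∧
    drinfeldOp V (V.K v) = V.K (drinfeldOp V v) ∧ drinfeldOp V (V.H v) = V.H (drinfeldOp V v) := by
  have hm := WtMod.comp_mem_homs (braiding_mem_homs V V.dual) (contractLeft_mem_homs V)
  have hKK : ∀ x, V.K (V.Kinv x) = x := LinearMap.congr_fun V.K_Kinv
  let P : V ⊗[ℂ] Module.Dual ℂ V →ₗ[ℂ] ℂ := contractLeft ℂ V ∘ₗ braiding V V.dual
  have hP : ∀ v f, P (v ⊗ₜ f) = f (drinfeldOp V v) := contractLeft_braiding V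
  refine ⟨?_, ?_, ?_, ?_⟩ <;> refine sub_eq_zero.1
    ((Module.forall_dual_apply_eq_zero_iff ℂ _).1 fun f => ?_)
  -- The functional is precomposed with K so that the K⁻¹ acting on it in the coproduct is absorbed.
  · have h : P (v ⊗ₜ[ℂ] (WtMod.tr (-(V.E * V.Kinv)) (WtMod.tr V.K f))
        + V.E v ⊗ₜ[ℂ] (WtMod.tr V.Kinv (WtMod.tr V.K f))) = 0 :=
      LinearMap.congr_fun hm.1 (v ⊗ₜ[ℂ] WtMod.tr V.K f)
    rw [map_add, hP, hP] at h
    have h3 : -f (V.K (V.E (V.Kinv (drinfeldOp V v))))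
        + f (V.K (V.Kinv (drinfeldOp V (V.E v)))) = 0 := by
      simpa using h
    rw [hKK] at h3
    rw [map_sub]
    linear_combination h3
  · have h : P (V.Kinv v ⊗ₜ[ℂ] (WtMod.tr (-(V.K * V.F)) f) + V.F v ⊗ₜ[ℂ] f) = 0 :=
      LinearMap.congr_fun hm.2.1 (v ⊗ₜ[ℂ] f)
    rw [map_add, hP, hP] at h
    have h3 : -f (V.K (V.F (drinfeldOp V (V.Kinv v)))) + f (drinfeldOp V (V.F v)) = 0 := by
      simpa using h
    rw [map_sub]
    linear_combination h3
  · have h : P (V.K v ⊗ₜ[ℂ] (WtMod.tr V.Kinv (WtMod.tr V.K f))) = P (v ⊗ₜ[ℂ] WtMod.tr V.K f) :=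
      LinearMap.congr_fun hm.2.2.1 (v ⊗ₜ[ℂ] WtMod.tr V.K f)
    rw [hP, hP] at h
    have h3 : f (V.K (V.Kinv (drinfeldOp V (V.K v)))) = f (V.K (drinfeldOp V v)) := h
    rw [hKK] at h3
    rw [map_sub, h3, sub_self]
  · have h : P (V.H v ⊗ₜ[ℂ] f + v ⊗ₜ[ℂ] (WtMod.tr (-V.H) f)) = 0 :=
      LinearMap.congr_fun hm.2.2.2 (v ⊗ₜ[ℂ] f)
    rw [map_add, hP, hP] at h
    have h3 : f (drinfeldOp V (V.H v)) + -f (V.H (drinfeldOp V v)) = 0 := by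
      simpa using h
    rw [map_sub]
    linear_combination h3

theorem qpow_mul_self_two (r : ℕ) (hr : r ≠ 0) : qpow r 2 ^ r = 1 :=
  (qpow_two_primitive r hr).pow_eq_one

theorem K_pow_mul_E (V : WtMod r) : V.K ^ r * V.E = V.E * V.K ^ r := by
  have h : ∀ n : ℕ, V.K ^ n * V.E = qpow r 2 ^ n • (V.E * V.K ^ n) := by
    intro n
    induction n with
    | zero => simp
    | succ n ih =>
      rw [pow_succ, mul_assoc, V.KE, mul_smul_comm, ← mul_assoc, ih, smul_mul_assoc, smul_smul,
        mul_assoc, pow_succ']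
  rw [h, qpow_mul_self_two r (NeZero.ne r), one_smul]

theorem K_pow_mul_F (V : WtMod r) : V.K ^ r * V.F = V.F * V.K ^ r := by
  have h : ∀ n : ℕ, V.K ^ n * V.F = qpow r (-2) ^ n • (V.F * V.K ^ n) := by
    intro n
    induction n with
    | zero => simp
    | succ n ih =>
      rw [pow_succ, mul_assoc, V.KF, mul_smul_comm, ← mul_assoc, ih, smul_mul_assoc, smul_smul,
        mul_assoc, pow_succ']
  rw [h, qpow_neg, inv_pow, qpow_mul_self_two r (NeZero.ne r), inv_one, one_smul]

/-- Since q^(2r) = 1, K^r commutes with the action, so K^(r-1) has the same effect as K⁻¹: it undoes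
the conjugation by K in u x = K x K⁻¹ u. -/
theorem thetaOp_mem_homs (V : WtMod r) : thetaOp V ∈ WtMod.homs V V := by
  have hE : drinfeldOp V * V.E = V.K * V.E * V.Kinv * drinfeldOp V :=
    LinearMap.ext fun v => (drinfeldOp_comm V v).1
  have hF : drinfeldOp V * V.F = V.K * V.F * drinfeldOp V * V.Kinv :=
    LinearMap.ext fun v => (drinfeldOp_comm V v).2.1
  have hK : drinfeldOp V * V.K = V.K * drinfeldOp V :=
    LinearMap.ext fun v => (drinfeldOp_comm V v).2.2.1
  have hH : drinfeldOp V * V.H = V.H * drinfeldOp V :=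
    LinearMap.ext fun v => (drinfeldOp_comm V v).2.2.2
  have hKi : drinfeldOp V * V.Kinv = V.Kinv * drinfeldOp V := by
    have h := congrArg (fun x => V.Kinv * x * V.Kinv) hK
    simp only [mul_assoc, V.K_Kinv, mul_one] at h
    rw [← mul_assoc V.Kinv V.K, V.Kinv_K, one_mul] at h
    exact h.symm
  have hr : r - 1 + 1 = r := Nat.sub_add_cancel (Nat.one_le_of_lt (Nat.AtLeastTwo.prop))
  have hKr' : V.K ^ (r - 1) * V.K = V.K ^ r := by rw [← pow_succ, hr]
  have hKr : V.K ^ r * V.Kinv = V.K ^ (r - 1) := by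
    rw [← hKr', mul_assoc, V.K_Kinv, mul_one]
  refine ⟨?_, ?_, ?_, ?_⟩
  · change thetaOp V * V.E = V.E * thetaOp V
    rw [thetaOp_eq, mul_assoc, hE, ← mul_assoc, ← mul_assoc, ← mul_assoc, hKr', K_pow_mul_E,
      mul_assoc V.E, hKr, mul_assoc]
  · change thetaOp V * V.F = V.F * thetaOp V
    rw [thetaOp_eq, mul_assoc, hF, mul_assoc _ _ V.Kinv, hKi, ← mul_assoc, ← mul_assoc,
      ← mul_assoc, hKr', K_pow_mul_F, mul_assoc V.F, hKr, mul_assoc]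
  · change thetaOp V * V.K = V.K * thetaOp V
    rw [thetaOp_eq, mul_assoc, hK, ← mul_assoc, ← mul_assoc, ← pow_succ, ← pow_succ']
  · change thetaOp V * V.H = V.H * thetaOp V
    have h : Commute V.H (V.K ^ (r - 1)) := Commute.pow_right V.H_K _
    rw [thetaOp_eq, mul_assoc, hH, ← mul_assoc, ← mul_assoc, h.eq]

/-- The antipode reverses the coproduct, so W* ⊗ V*, and not V* ⊗ W*, maps to (V ⊗ W)* as a module.
-/
theorem dualDistrib_comm_mem_homs (V W : WtMod r) :
    TensorProduct.dualDistrib ℂ V W ∘ₗ (TensorProduct.comm ℂ (Module.Dual ℂ W)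
      (Module.Dual ℂ V)).toLinearMap ∈ WtMod.homs (W.dual.tensor V.dual) (V.tensor W).dual := by
  have hV : ∀ v, V.Kinv (V.K v) = v := LinearMap.congr_fun V.Kinv_K
  have hW : ∀ v, W.K (W.Kinv v) = v := LinearMap.congr_fun W.K_Kinv
  refine ⟨?_, ?_, ?_, ?_⟩ <;>
    refine TensorProduct.ext' fun (g : Module.Dual ℂ W) (f : Module.Dual ℂ V) =>
      TensorProduct.ext' fun v w => ?_
  · change f (-(V.E (V.Kinv v))) * g w + f (V.Kinv v) * g (-(W.E (W.Kinv w)))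
      = TensorProduct.dualDistrib ℂ V W (f ⊗ₜ g)
        (-(V.Kinv v ⊗ₜ W.E (W.Kinv w) + V.E (V.Kinv v) ⊗ₜ W.K (W.Kinv w)))
    simp only [hW, map_neg, map_add, dualDistrib_apply]
    ring
  · change f (-(V.K (V.F v))) * g (W.K w) + f v * g (-(W.K (W.F w)))
      = TensorProduct.dualDistrib ℂ V W (f ⊗ₜ g)
        (-(TensorProduct.map V.K W.K (V.Kinv v ⊗ₜ W.F w + V.F v ⊗ₜ w)))
    have hV' : ∀ v, V.K (V.Kinv v) = v := LinearMap.congr_fun V.K_Kinv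
    simp only [hV', map_neg, map_add, map_tmul, dualDistrib_apply]
    ring
  · rfl
  · change f v * g (-(W.H w)) + f (-(V.H v)) * g w
      = TensorProduct.dualDistrib ℂ V W (f ⊗ₜ g) (-(V.H v ⊗ₜ w + v ⊗ₜ W.H w))
    simp only [map_neg, map_add, dualDistrib_apply]
    ring

open MonoidalCategory in
/-- The functional underlying a morphism to the unit object. -/
def unitLin {X : WtMod r} (p : X ⟶ 𝟙_ (WtMod r)) : X →ₗ[ℂ] ℂ := WtMod.lin p

open MonoidalCategory in
theorem unitLin_nestedPairing {V V' W W' : WtMod r} (p : V' ⊗ V ⟶ 𝟙_ (WtMod r))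
    (q : W' ⊗ W ⟶ 𝟙_ (WtMod r)) (v : V) (v' : V') (w : W) (w' : W') :
    unitLin (nestedPairing p q) ((w' ⊗ₜ[ℂ] v') ⊗ₜ[ℂ] (v ⊗ₜ[ℂ] w))
      = unitLin p (v' ⊗ₜ[ℂ] v) * unitLin q (w' ⊗ₜ[ℂ] w) := by
  have h : nestedPairing p q = (α_ W' V' (V ⊗ W)).hom ≫ W' ◁ ((α_ V' V W).inv ≫ p ▷ W ≫
      (λ_ W).hom) ≫ q := by
    rw [nestedPairing]; monoidal
  rw [h]
  have h2 : unitLin q (w' ⊗ₜ[ℂ] (unitLin p (v' ⊗ₜ[ℂ] v) • w))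
      = unitLin p (v' ⊗ₜ[ℂ] v) * unitLin q (w' ⊗ₜ[ℂ] w) := by
    rw [TensorProduct.tmul_smul]
    exact (unitLin q).map_smul _ _
  exact h2

open MonoidalCategory in
-- The evaluation of V ⊗ W is the nested pairing of the two evaluations, so
-- `double_braiding_nestedPairing` applies and each cap with one crossing is a Drinfeld operator.
theorem drinfeldOp_tensor_tmul (V W : WtMod r) (v : V) (w : W) (f : Module.Dual ℂ V)
    (g : Module.Dual ℂ W) : TensorProduct.dualDistrib ℂ V W (f ⊗ₜ g)
      (drinfeldOp (V.tensor W) (braiding W V (braiding V W (v ⊗ₜ w))))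
        = f (drinfeldOp V v) * g (drinfeldOp W w) := by
  let j : W.dual ⊗ V.dual ⟶ (V ⊗ W).dual := WtMod.ofLin _ (dualDistrib_comm_mem_homs V W)
  have h1 : nestedPairing (evalHom V) (evalHom W) = j ▷ (V ⊗ W) ≫ evalHom (V ⊗ W) := by
    refine WtMod.hom_ext (TensorProduct.ext_fourfold'
      fun (g : Module.Dual ℂ W) (f : Module.Dual ℂ V) v w => ?_)
    refine (unitLin_nestedPairing (evalHom V) (evalHom W) v f w g).trans ?_
    rfl
  have h2 := double_braiding_nestedPairing (evalHom V) (evalHom W)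
  rw [h1, ← BraidedCategory.braiding_naturality_right_assoc] at h2
  have h3 := congrArg (fun m => unitLin m ((v ⊗ₜ[ℂ] w) ⊗ₜ[ℂ]
    ((show W.dual from g) ⊗ₜ[ℂ] (show V.dual from f)))) h2
  have h4 := unitLin_nestedPairing ((β_ W W.dual).hom ≫ evalHom W) ((β_ V V.dual).hom ≫ evalHom V)
    (show W.dual from g) w (show V.dual from f) v
  have h5 : unitLin ((β_ W W.dual).hom ≫ evalHom W) (w ⊗ₜ[ℂ] (show W.dual from g))
    = g (drinfeldOp W w) := contractLeft_braiding W w g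
  have h6 : unitLin ((β_ V V.dual).hom ≫ evalHom V) (v ⊗ₜ[ℂ] (show V.dual from f))
    = f (drinfeldOp V v) := contractLeft_braiding V v f
  rw [h5, h6, mul_comm] at h4
  refine Eq.trans ?_ (h3.trans h4)
  exact (contractLeft_braiding (V.tensor W) (braiding W V (braiding V W (v ⊗ₜ w)))
    (TensorProduct.dualDistrib ℂ V W (f ⊗ₜ g))).symm

theorem drinfeldOp_tensor (V W : WtMod r) (y : V ⊗[ℂ] W) :
    drinfeldOp (V.tensor W) (braiding W V (braiding V W y))
      = TensorProduct.map (drinfeldOp V) (drinfeldOp W) y := by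
  let D : V ⊗[ℂ] W →ₗ[ℂ] V ⊗[ℂ] W :=
    drinfeldOp (V.tensor W) ∘ₗ braiding W V ∘ₗ braiding V W
  have hD : ∀ (v : V) (w : W) (t : Module.Dual ℂ V ⊗[ℂ] Module.Dual ℂ W),
      TensorProduct.dualDistrib ℂ V W t (D (v ⊗ₜ w))
        = TensorProduct.dualDistrib ℂ V W t (drinfeldOp V v ⊗ₜ drinfeldOp W w) := by
    intro v w t
    induction t using TensorProduct.induction_on with
    | zero => simp
    | tmul f g => exact drinfeldOp_tensor_tmul V W v w f g
    | add s t hs ht => rw [map_add, LinearMap.add_apply, LinearMap.add_apply, hs, ht]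
  suffices h : D = TensorProduct.map (drinfeldOp V) (drinfeldOp W) from LinearMap.congr_fun h y
  refine TensorProduct.ext' fun v w => sub_eq_zero.1
    ((Module.forall_dual_apply_eq_zero_iff ℂ _).1 fun φ => ?_)
  -- In finite dimension every functional on V ⊗ W comes from V* ⊗ W*, so testing on products of
  -- functionals suffices.
  obtain ⟨t, rfl⟩ := (TensorProduct.dualDistribEquiv ℂ V W).surjective φ
  rw [map_sub]
  exact sub_eq_zero.2 (hD v w t)

theorem thetaOp_tensor (V W : WtMod r) (y : V ⊗[ℂ] W) :
    thetaOp (V.tensor W) (braiding W V (braiding V W y))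
      = TensorProduct.map (thetaOp V) (thetaOp W) y := by
  have h : (V.tensor W).K ^ (r - 1) = TensorProduct.map (V.K ^ (r - 1)) (W.K ^ (r - 1)) :=
    TensorProduct.map_pow V.K W.K (r - 1)
  refine (LinearMap.congr_fun h (drinfeldOp (V.tensor W) (braiding W V (braiding V W y)))).trans ?_
  refine (congrArg (TensorProduct.map (V.K ^ (r - 1)) (W.K ^ (r - 1)))
    (drinfeldOp_tensor V W y)).trans ?_
  exact (LinearMap.congr_fun (TensorProduct.map_mul (V.K ^ (r - 1)) (drinfeldOp V)
    (W.K ^ (r - 1)) (drinfeldOp W)) y).symm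

end Twist
end UnrolledSl2

end

open CategoryTheory TensorProduct Polynomial
noncomputable section
namespace UnrolledSl2

/-! ### Polynomials in an operator and the vectors they kill -/

theorem aeval_eq_zero_of_dvd {M : Type*} [AddCommGroup M] [Module ℂ M] {T : Module.End ℂ M}
    {p q : ℂ[X]} (h : p ∣ q) {v : M} (hv : aeval T p v = 0) : aeval T q v = 0 := by
  obtain ⟨s, rfl⟩ := h
  rw [mul_comm, map_mul, Module.End.mul_apply, hv, map_zero]

theorem eq_zero_of_aeval_coprime {M : Type*} [AddCommGroup M] [Module ℂ M] {T : Module.End ℂ M}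
    {p q : ℂ[X]} (h : IsCoprime p q) {v : M} (hp : aeval T p v = 0) (hq : aeval T q v = 0) :
    v = 0 := by
  obtain ⟨a, b, hab⟩ := h
  have := congrArg (fun s => aeval T s v) hab
  simpa [hp, hq] using this.symm

theorem aeval_eq_smul_of_dvd {M : Type*} [AddCommGroup M] [Module ℂ M] {T : Module.End ℂ M}
    {p q : ℂ[X]} {a : ℂ} (h : p ∣ q - C a) {v : M} (hv : aeval T p v = 0) :
    aeval T q v = a • v := by
  have := aeval_eq_zero_of_dvd h hv
  rwa [map_sub, aeval_C, LinearMap.sub_apply, sub_eq_zero] at this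

/-! ### Interpolation to second order -/

/-- The polynomial with value `1` at `c`, vanishing at the other points of `s`, and with
derivative zero on `s`. -/
def hermiteBasis (s : Finset ℂ) (c : ℂ) : ℂ[X] :=
  Lagrange.basis s id c ^ 2 * (3 - 2 * Lagrange.basis s id c)

/-- The cubic t²(3 - 2t) takes the values 0 at 0 and 1 at 1, each to second order; composed with the
Lagrange basis it gives second-order interpolation. -/
theorem sq_dvd_hermiteBasis {s : Finset ℂ} {c d : ℂ} (hd : d ∈ s) (h : c ≠ d) :
    (X - C d) ^ 2 ∣ hermiteBasis s c := by
  have h1 : eval (id d) (Lagrange.basis s id c) = 0 := Lagrange.eval_basis_of_ne h hd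
  have h2 : X - C d ∣ Lagrange.basis s id c := dvd_iff_isRoot.2 h1
  exact dvd_mul_of_dvd_left (pow_dvd_pow_of_dvd h2 2) _

theorem sq_dvd_hermiteBasis_sub_one {s : Finset ℂ} {c : ℂ} (hc : c ∈ s) :
    (X - C c) ^ 2 ∣ hermiteBasis s c - 1 := by
  have h1 : X - C c ∣ Lagrange.basis s id c - 1 := by
    have := Lagrange.eval_basis_self (v := id) Function.injective_id.injOn hc
    refine dvd_iff_isRoot.2 ?_
    simp only [id] at this
    simp [this]
  have h2 : hermiteBasis s c - 1
      = (Lagrange.basis s id c - 1) ^ 2 * -(2 * Lagrange.basis s id c + 1) := by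
    rw [hermiteBasis]; ring
  rw [h2]
  exact (pow_dvd_pow_of_dvd h1 2).mul_right _

/-- The polynomial with values `g` and derivative zero on `s`. -/
def hermite (s : Finset ℂ) (g : ℂ → ℂ) : ℂ[X] := ∑ c ∈ s, C (g c) * hermiteBasis s c

theorem sq_dvd_hermite_sub {s : Finset ℂ} (g : ℂ → ℂ) {d : ℂ} (hd : d ∈ s) :
    (X - C d) ^ 2 ∣ hermite s g - C (g d) := by
  rw [hermite, ← Finset.add_sum_erase s _ hd]
  have : C (g d) * hermiteBasis s d + ∑ c ∈ s.erase d, C (g c) * hermiteBasis s c - C (g d)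
    = C (g d) * (hermiteBasis s d - 1) + ∑ c ∈ s.erase d, C (g c) * hermiteBasis s c := by ring
  rw [this]
  refine dvd_add ((sq_dvd_hermiteBasis_sub_one hd).mul_left _) (Finset.dvd_sum fun c hc => ?_)
  exact (sq_dvd_hermiteBasis hd (Finset.ne_of_mem_erase hc)).mul_left _

theorem prod_sq_dvd {s : Finset ℂ} {q : ℂ[X]} (h : ∀ c ∈ s, (X - C c) ^ 2 ∣ q) :
    ∏ c ∈ s, (X - C c) ^ 2 ∣ q := by
  refine Finset.prod_dvd_of_coprime (fun a _ b _ hab => ?_) h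
  exact ((pairwise_coprime_X_sub_C Function.injective_id) hab).pow

/-! ### The roots of the polynomials annihilating the Casimir operator -/

theorem qpow_eq_one_iff {r : ℕ} (hr : r ≠ 0) (x : ℂ) :
    qpow r x = 1 ↔ ∃ n : ℤ, x = 2 * r * n := by
  have hr' : (r : ℂ) ≠ 0 := by exact_mod_cast hr
  have hp : (Real.pi : ℂ) ≠ 0 := by exact_mod_cast Real.pi_ne_zero
  rw [qpow, Complex.exp_eq_one_iff]
  refine exists_congr fun n => ?_
  rw [div_eq_iff hr']
  constructor
  · intro h
    refine mul_left_cancel₀ (mul_ne_zero hp Complex.I_ne_zero) ?_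
    linear_combination h
  · rintro rfl
    ring

/-- With x = q^(a+1) and y = q^(b+1), the equation x + x⁻¹ = y + y⁻¹ means x = y or x y = 1. -/
theorem casEig_eq_iff {r : ℕ} [r.AtLeastTwo] (a b : ℂ) :
    casEig r a = casEig r b ↔ (∃ n : ℤ, a - b = 2 * r * n) ∨ ∃ n : ℤ, a + b + 2 = 2 * r * n := by
  have h1 := qbr_one_ne_zero r
  have ha := qpow_ne_zero r (a + 1)
  have hb := qpow_ne_zero r (b + 1)
  rw [← qpow_eq_one_iff (NeZero.ne r), ← qpow_eq_one_iff (NeZero.ne r),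
    show a - b = (a + 1) + -(b + 1) by ring, show a + b + 2 = (a + 1) + (b + 1) by ring,
    qpow_add r (a + 1), qpow_add r (a + 1), casEig, casEig, div_left_inj' (pow_ne_zero 2 h1),
    qpow_neg, qpow_neg]
  generalize qpow r (a + 1) = x at *
  generalize qpow r (b + 1) = y at *
  rw [mul_inv_eq_one₀ hb, ← sub_eq_zero (a := x), ← sub_eq_zero (a := x * y), ← mul_eq_zero,
    ← sub_eq_zero]
  have : x + x⁻¹ - (y + y⁻¹) = (x - y) * (x * y - 1) * (x * y)⁻¹ := by field_simp; ring
  rw [this, mul_eq_zero, or_iff_left (inv_ne_zero (mul_ne_zero ha hb))]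

theorem eval_casPoly_eq_zero_iff (r n : ℕ) (μ c : ℂ) :
    (casPoly r n μ).eval c = 0 ↔ ∃ j < n, c = casEig r (μ + 2 * j) := by
  rw [casPoly, eval_prod, Finset.prod_eq_zero_iff]
  simp [sub_eq_zero]

theorem eq_of_sub_eq_mul {r j k : ℕ} (hj : j < r) (hk : k < r) {n : ℤ}
    (h : (j : ℂ) - k = r * n) : j = k := by
  have h1 : (j : ℤ) - k = r * n := by exact_mod_cast h
  have h2 : (j : ℤ) - k = 0 := by
    refine Int.eq_zero_of_abs_lt_dvd (m := r) ⟨n, h1⟩ ?_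
    rw [abs_lt]
    constructor <;> omega
  omega

theorem casEig_shift_eq_iff {r : ℕ} [r.AtLeastTwo] {μ : ℂ} {j k : ℕ} (hj : j < r) (hk : k < r) :
    casEig r (μ + 2 * j) = casEig r (μ + 2 * k) ↔
      j = k ∨ ∃ n : ℤ, (μ + 2 * j) + (μ + 2 * k) + 2 = 2 * r * n := by
  rw [casEig_eq_iff]
  refine or_congr_left ⟨fun ⟨n, h⟩ => eq_of_sub_eq_mul hj hk (n := n) ?_, ?_⟩
  · linear_combination h / 2
  · rintro rfl
    exact ⟨0, by simp⟩

/-- Distinct labels j, k < r with the same eigenvalue are related by the reflection a ↦ -2 - a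
modulo 2r, which determines k from j. Hence the roots of the annihilating polynomial of C are at
most double. -/
theorem card_casEig_le {r : ℕ} [r.AtLeastTwo] (μ c : ℂ) :
    ((Finset.range r).filter fun j => casEig r (μ + 2 * (j : ℕ)) = c).card ≤ 2 := by
  by_contra! h
  obtain ⟨a, b, d, ha, hb, hd, hab, had, hbd⟩ := Finset.two_lt_card_iff.1 h
  simp only [Finset.mem_filter, Finset.mem_range] at ha hb hd
  obtain ⟨m, hm⟩ := ((casEig_shift_eq_iff ha.1 hb.1).1 (ha.2.trans hb.2.symm)).resolve_left hab
  obtain ⟨n, hn⟩ := ((casEig_shift_eq_iff ha.1 hd.1).1 (ha.2.trans hd.2.symm)).resolve_left had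
  refine hbd (eq_of_sub_eq_mul hb.1 hd.1 (n := m - n) ?_)
  push_cast
  linear_combination (hm - hn) / 2

theorem casPoly_dvd {r : ℕ} [r.AtLeastTwo] (μ : ℂ) : casPoly r r μ ∣
    ∏ c ∈ (Finset.range r).image (fun j : ℕ => casEig r (μ + 2 * j)), (X - C c) ^ 2 := by
  rw [casPoly, Finset.prod_comp (fun c => X - C c) (fun j : ℕ => casEig r (μ + 2 * j))]
  exact Finset.prod_dvd_prod_of_dvd _ _ fun c _ => pow_dvd_pow _ (card_casEig_le μ c)

namespace WtMod

variable {r : ℕ}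

/-- The vectors of weight `μ` killed by `(C - c) ^ 2`, with `C` the Casimir operator. -/
def IsBlockVec (V : WtMod r) (μ c : ℂ) (v : V) : Prop :=
  V.H v = μ • v ∧ aeval V.cas ((X - C c) ^ 2) v = 0

theorem span_isBlockVec [r.AtLeastTwo] (V : WtMod r) :
    Submodule.span ℂ {v : V | ∃ μ c, V.IsBlockVec μ c v} = ⊤ := by
  rw [eq_top_iff, ← span_eigenvectors V.weight, Submodule.span_le]
  rintro v ⟨μ, hv⟩
  set s := (Finset.range r).image (fun j : ℕ => casEig r (μ + 2 * j)) with hs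
  have h0 : aeval V.cas (∏ c ∈ s, (X - C c) ^ 2) v = 0 :=
    aeval_eq_zero_of_dvd (casPoly_dvd μ) (aeval_casPoly hv)
  -- Interpolating the constant 1 decomposes v as a sum of its components hermiteBasis(C) v, one for
  -- each root.
  have h1 : aeval V.cas (hermite s fun _ => 1) v = (1 : ℂ) • v :=
    aeval_eq_smul_of_dvd (prod_sq_dvd fun c hc => sq_dvd_hermite_sub _ hc) h0
  rw [one_smul, hermite, map_sum, LinearMap.sum_apply] at h1
  rw [← h1]
  refine Submodule.sum_mem _ fun c hc => Submodule.subset_span ⟨μ, c, ?_, ?_⟩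
  · exact H_aeval_cas hv _
  · rw [← Module.End.mul_apply, ← map_mul]
    refine aeval_eq_zero_of_dvd (prod_sq_dvd fun d hd => ?_) h0
    rcases eq_or_ne c d with rfl | hcd
    · exact dvd_mul_right _ _
    · exact ((sq_dvd_hermiteBasis hd hcd).mul_left _).mul_left _

theorem ext_blockVec [r.AtLeastTwo] {V : WtMod r} {M : Type*} [AddCommGroup M] [Module ℂ M]
    {f g : V →ₗ[ℂ] M} (h : ∀ μ c v, V.IsBlockVec μ c v → f v = g v) : f = g :=
  LinearMap.ext_on V.span_isBlockVec fun v ⟨μ, c, hv⟩ => h μ c v hv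

theorem ext_blockVec_conj [r.AtLeastTwo] {V : WtMod r} {M : Type*} [AddCommGroup M] [Module ℂ M]
    {f g : V →ₗ⋆[ℂ] M} (h : ∀ μ c v, V.IsBlockVec μ c v → f v = g v) : f = g :=
  LinearMap.ext_on V.span_isBlockVec fun v ⟨μ, c, hv⟩ => h μ c v hv

theorem eval_eq_zero_of_isBlockVec {V : WtMod r} {μ c : ℂ} {v : V} (hv : V.IsBlockVec μ c v)
    (h0 : v ≠ 0) {p : ℂ[X]} (hp : aeval V.cas p v = 0) : p.eval c = 0 := by
  by_contra hc
  refine h0 (eq_zero_of_aeval_coprime (IsCoprime.pow_left ?_) hv.2 hp)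
  exact (irreducible_X_sub_C c).coprime_iff_not_dvd.2 fun h => hc (dvd_iff_isRoot.1 h)

theorem exists_casEig_of_isBlockVec [r.AtLeastTwo] {V : WtMod r} {μ c : ℂ} {v : V} (hv : V.IsBlockVec μ c v)
    (h0 : v ≠ 0) : ∃ j < r, c = casEig r (μ + 2 * j) :=
  (eval_casPoly_eq_zero_iff _ _ _ _).1 (eval_eq_zero_of_isBlockVec hv h0 (aeval_casPoly hv.1))

theorem IsBlockVec.E [r.AtLeastTwo] {V : WtMod r} {μ c : ℂ} {v : V} (hv : V.IsBlockVec μ c v) :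
    V.IsBlockVec (μ + 2) c (V.E v) :=
  ⟨H_E_apply hv.1, by rw [← aeval_cas_E, hv.2, map_zero]⟩

theorem IsBlockVec.F [r.AtLeastTwo] {V : WtMod r} {μ c : ℂ} {v : V} (hv : V.IsBlockVec μ c v) :
    V.IsBlockVec (μ - 2) c (V.F v) :=
  ⟨H_F_apply hv.1, by rw [← aeval_cas_F, hv.2, map_zero]⟩

theorem isBlockVec_of_cas {V : WtMod r} {μ c : ℂ} {v : V} (hv : V.H v = μ • v)
    (hc : V.cas v = c • v) : V.IsBlockVec μ c v := by
  refine ⟨hv, ?_⟩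
  simp [pow_two, hc]

/-- The operator acting by `g μ c` on the vectors of weight `μ` killed by `(C - c) ^ 2`, with
`C` the Casimir operator. -/
def blockFun (V : WtMod r) (g : ℂ → ℂ → ℂ) : Module.End ℂ V :=
  ∑ μ ∈ weights V.H, aeval V.cas (hermite (weights V.cas) (g μ))
    * opFun V.H (Set.indicator {μ} 1)

theorem blockFun_apply {V : WtMod r} (g : ℂ → ℂ → ℂ) {μ c : ℂ} {v : V}
    (hv : V.IsBlockVec μ c v) : V.blockFun g v = g μ c • v := by
  rcases eq_or_ne v 0 with rfl | h0
  · simp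
  have hμ : μ ∈ weights V.H := by
    simp only [weights, Set.Finite.mem_toFinset, Set.mem_ofPred_eq]
    exact Module.End.hasEigenvalue_of_hasEigenvector ⟨Module.End.mem_eigenspace_iff.2 hv.1, h0⟩
  have hc : c ∈ weights V.cas := by
    simp only [weights, Set.Finite.mem_toFinset, Set.mem_ofPred_eq]
    by_contra h
    -- If c were not an eigenvalue, C - c would be injective, hence also its square, and v would be
    -- zero.
    have hbot : V.cas.eigenspace c = ⊥ := by
      by_contra h'
      exact h h'
    have hinj : ∀ w, aeval V.cas (X - C c) w = 0 → w = 0 := by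
      intro w hw
      have : w ∈ V.cas.eigenspace c := by
        rw [Module.End.mem_eigenspace_iff]
        simpa [sub_eq_zero] using hw
      rwa [hbot, Submodule.mem_bot] at this
    have h2 := hv.2
    rw [pow_two, map_mul, Module.End.mul_apply] at h2
    exact h0 (hinj _ (hinj _ h2))
  rw [blockFun, LinearMap.sum_apply, Finset.sum_eq_single_of_mem μ hμ]
  · rw [Module.End.mul_apply, opFun_apply _ _ hv.1]
    simpa using aeval_eq_smul_of_dvd (sq_dvd_hermite_sub (g μ) hc) hv.2
  · intro a _ ha
    rw [Module.End.mul_apply, opFun_apply _ _ hv.1]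
    simp [Set.indicator_of_notMem, ha.symm]

/-- The values at μ and μ + 2 need only match for those c at which E or F can be nonzero, and
`aeval_casPoly_E` and `aeval_casPoly_F` restrict these to c(μ + 2 + 2j) with j + 1 < r. -/
theorem blockFun_mem_homs [r.AtLeastTwo] (V : WtMod r) {g : ℂ → ℂ → ℂ}
    (hg : ∀ μ (j : ℕ), j + 1 < r →
      g μ (casEig r (μ + 2 + 2 * j)) = g (μ + 2) (casEig r (μ + 2 + 2 * j))) :
    V.blockFun g ∈ homs V V := by
  refine ⟨?_, ?_, ?_, ?_⟩ <;> refine ext_blockVec fun μ c v hv => ?_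
  all_goals rw [LinearMap.comp_apply, LinearMap.comp_apply, blockFun_apply g hv, map_smul]
  · rw [blockFun_apply g hv.E]
    rcases eq_or_ne (V.E v) 0 with h0 | h0
    · simp [h0]
    obtain ⟨j, hj, rfl⟩ := (eval_casPoly_eq_zero_iff _ _ _ _).1
      (eval_eq_zero_of_isBlockVec hv.E h0 (aeval_casPoly_E hv.1))
    rw [hg μ j (by omega)]
  · rw [blockFun_apply g hv.F]
    rcases eq_or_ne (V.F v) 0 with h0 | h0
    · simp [h0]
    obtain ⟨j, hj, rfl⟩ := (eval_casPoly_eq_zero_iff _ _ _ _).1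
      (eval_eq_zero_of_isBlockVec hv.F h0 (aeval_casPoly_F hv.1))
    have := hg (μ - 2) j (by omega)
    rw [sub_add_cancel] at this
    rw [this]
  · rw [V.K_eq μ v hv.1, map_smul, blockFun_apply g hv, smul_comm]
  · rw [hv.1, map_smul, blockFun_apply g hv, smul_comm]

end WtMod
end UnrolledSl2

end

open CategoryTheory TensorProduct Polynomial
noncomputable section
namespace UnrolledSl2

variable {r : ℕ}

/-! ### The inverse twist as a polynomial in the Casimir operator -/

/-- The polynomial in the Casimir operator by which `drinfeldOp` acts on vectors of weight `μ`. -/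
def drinfeldPoly (r : ℕ) (μ : ℂ) : ℂ[X] := ∑ n ∈ Finset.range r,
  C (rCoeff r n * qpow r (-(μ + 2 * n) ^ 2 / 2)
    * ((-1) ^ n * qpow r (n * (μ + 2 * n) - n * (n + 1)))) * casPoly r n μ

/-- The polynomial in the Casimir operator by which `thetaOp` acts on vectors of weight `μ`. -/
def thetaPoly (r : ℕ) (μ : ℂ) : ℂ[X] := C (qpow r ((r - 1 : ℕ) * μ)) * drinfeldPoly r μ

theorem K_pow_apply {V : WtMod r} {μ : ℂ} {v : V} (hv : V.H v = μ • v) (n : ℕ) :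
    (V.K ^ n) v = qpow r (n * μ) • v := by
  induction n with
  | zero => simp [qpow_zero]
  | succ n ih =>
    rw [pow_succ', Module.End.mul_apply, ih, map_smul, V.K_eq μ v hv, smul_smul, ← qpow_add]
    congr 2
    push_cast
    ring

theorem drinfeldOp_eq_aeval [r.AtLeastTwo] {V : WtMod r} {μ : ℂ} {v : V} (hv : V.H v = μ • v) :
    drinfeldOp V v = aeval V.cas (drinfeldPoly r μ) v := by
  rw [drinfeldOp_apply hv, drinfeldPoly, map_sum, LinearMap.sum_apply]
  refine Finset.sum_congr rfl fun n _ => ?_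
  rw [map_mul, aeval_C, Module.End.mul_apply, Module.algebraMap_end_apply,
    ← WtMod.F_pow_E_pow_apply hv, neg_K_F_pow_apply (WtMod.H_E_pow_apply hv n), smul_smul]

theorem thetaOp_apply [r.AtLeastTwo] {V : WtMod r} {μ : ℂ} {v : V} (hv : V.H v = μ • v) :
    thetaOp V v = aeval V.cas (thetaPoly r μ) v := by
  rw [thetaOp_eq, Module.End.mul_apply, drinfeldOp_eq_aeval hv,
    K_pow_apply (WtMod.H_aeval_cas hv _), thetaPoly, map_mul, aeval_C, Module.End.mul_apply,
    Module.algebraMap_end_apply]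

theorem thetaOp_apply_of_E_eq_zero [r.AtLeastTwo] {V : WtMod r} {l : ℂ} {v : V}
    (hv : V.H v = l • v) (h0 : V.E v = 0) :
    thetaOp V v = qpow r (((r - 1) ^ 2 - (l - r + 1) ^ 2) / 2) • v := by
  have h : ∀ n, n ≠ 0 → (V.E ^ n) v = 0 := by
    intro n hn
    obtain ⟨m, rfl⟩ := Nat.exists_eq_succ_of_ne_zero hn
    rw [pow_succ, Module.End.mul_apply, h0, map_zero]
  have hd : drinfeldOp V v = qpow r (-(l ^ 2) / 2) • v := by
    rw [drinfeldOp, LinearMap.sum_apply, Finset.sum_eq_single_of_mem 0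
      (Finset.mem_range.2 (NeZero.pos r))]
    · simp [opFun_apply _ _ hv, rCoeff_zero]
    · intro n _ hn
      simp [h n hn]
  rw [thetaOp_eq, Module.End.mul_apply, hd, map_smul, K_pow_apply hv, smul_smul, ← qpow_add]
  congr 2
  rw [Nat.cast_pred (NeZero.pos r)]
  ring

theorem WtMod.cas_apply_of_E_eq_zero {V : WtMod r} {l : ℂ} {v : V}
    (hv : V.H v = l • v) (h0 : V.E v = 0) : V.cas v = casEig r l • v := by
  rw [cas_apply hv, h0, map_zero, zero_add]

theorem mem_homs_F_pow {V W : WtMod r} {f : V →ₗ[ℂ] W} (hf : f ∈ WtMod.homs V W) (n : ℕ) (v : V) :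
    f ((V.F ^ n) v) = (W.F ^ n) (f v) := by
  induction n with
  | zero => rfl
  | succ n ih =>
    rw [pow_succ', pow_succ', Module.End.mul_apply, Module.End.mul_apply, ← ih]
    exact LinearMap.congr_fun hf.2.1 _

/-! ### The values of `thetaPoly` from highest weight modules -/

section HighestWeight

open WtMod

variable [r.AtLeastTwo] {N : ℕ} {l : ℂ} (hN : N ≤ r) (hl : hwCoeff r l N = 0)

/-- The highest weight vector. -/
def hwTop : hw r N l hN hl := hwVec N 0

theorem hw_F_pow_top (j : ℕ) :
    ((hw r N l hN hl).F ^ j) (hwTop hN hl) = (hwVec N j : Fin N → ℂ) :=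
  (hwF_pow j 0).trans (by rw [zero_add])

theorem hw_H_top : (hw r N l hN hl).H (hwTop hN hl) = l • hwTop hN hl :=
  by
  refine (hwH_apply l 0).trans ?_
  rw [Nat.cast_zero, mul_zero, sub_zero]
  rfl

theorem hw_E_top : (hw r N l hN hl).E (hwTop hN hl) = 0 := by
  rcases Nat.eq_zero_or_pos N with rfl | h
  · exact funext fun i => i.elim0
  · refine (hwE_apply r l h).trans ?_
    rw [hwCoeff_zero, zero_smul]
    rfl

theorem hwVec_ne_zero {N k : ℕ} (h : k < N) : hwVec N k ≠ 0 := fun h0 => by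
  have := congrFun h0 ⟨k, h⟩
  simp [hwVec] at this

/-- In the r-dimensional module of highest weight μ + 2j, the vector F^j v is nonzero of weight μ.
Being a module map, `thetaOp` acts on it by the same scalar as on the highest weight vector, which
avoids summing the series. -/
theorem eval_thetaPoly (μ : ℂ) {j : ℕ} (hj : j < r) :
    (thetaPoly r μ).eval (casEig r (μ + 2 * j))
      = qpow r (((r - 1) ^ 2 - (μ + 2 * j - r + 1) ^ 2) / 2) := by
  have key : ∀ (V : WtMod r) (v : V), V.H v = (μ + 2 * j) • v → V.E v = 0 → (V.F ^ j) v ≠ 0 →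
      (thetaPoly r μ).eval (casEig r (μ + 2 * j))
        = qpow r (((r - 1) ^ 2 - (μ + 2 * j - r + 1) ^ 2) / 2) := by
    intro V v hv hE h0
    have hw : V.H ((V.F ^ j) v) = μ • (V.F ^ j) v := by
      rw [H_F_pow_apply hv, add_sub_cancel_right]
    have hc : V.cas ((V.F ^ j) v) = casEig r (μ + 2 * j) • (V.F ^ j) v := by
      rw [← F_pow_comm_cas, cas_apply_of_E_eq_zero hv hE, map_smul]
    have hT := mem_homs_F_pow (thetaOp_mem_homs V) j v
    rw [thetaOp_apply hw, Module.End.aeval_apply_of_mem_apply_eq_smul hc,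
      thetaOp_apply_of_E_eq_zero hv hE, map_smul] at hT
    exact smul_left_injective ℂ h0 hT
  have hl : hwCoeff r (μ + 2 * j) r = 0 := by
    have := qbr_int_mul r (NeZero.ne r) 1
    simp only [Int.cast_one, one_mul] at this
    simp [hwCoeff, this]
  refine key (hw r r (μ + 2 * j) le_rfl hl) _ (hw_H_top _ _) (hw_E_top _ _) ?_
  rw [hw_F_pow_top]
  exact hwVec_ne_zero hj

end HighestWeight

/-! ### Symmetry of `thetaPoly` under change of sign of the weight -/

theorem natDegree_casPoly (n : ℕ) (μ : ℂ) : (casPoly r n μ).natDegree = n := by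
  rw [casPoly, natDegree_prod_of_monic _ _ fun _ _ => monic_X_sub_C _]
  simp

theorem degree_thetaPoly_lt (r : ℕ) (μ : ℂ) : (thetaPoly r μ).degree < r := by
  have hC : ∀ (a : ℂ) (p : ℂ[X]), (C a * p).degree ≤ p.degree := fun a p => by
    rw [← smul_eq_C_mul]
    exact degree_smul_le a p
  refine (hC _ _).trans_lt ((degree_sum_le _ _).trans_lt
    ((Finset.sup_lt_iff (WithBot.bot_lt_coe r)).2 fun n hn => ?_))
  refine (hC _ _).trans_lt (degree_le_natDegree.trans_lt ?_)
  rw [natDegree_casPoly]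
  exact Nat.cast_lt.2 (Finset.mem_range.1 hn)

theorem continuous_qpow {X : Type*} [TopologicalSpace X] {f : X → ℂ} (hf : Continuous f) :
    Continuous fun x => qpow r (f x) := by
  unfold qpow
  fun_prop

theorem continuous_eval_thetaPoly (x : ℂ) : Continuous fun μ => (thetaPoly r μ).eval x := by
  simp only [thetaPoly, drinfeldPoly, casPoly, casEig, eval_finsetSum, eval_mul, eval_C, eval_prod, eval_sub,
    eval_X]
  have h := fun {f : ℂ → ℂ} hf => continuous_qpow (r := r) (f := f) hf
  refine (h (by fun_prop)).mul (continuous_finsetSum _ fun n _ =>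
    ((continuous_const.mul (h (by fun_prop))).mul (continuous_const.mul (h (by fun_prop)))).mul
    (continuous_finsetProd _ fun j _ => continuous_const.sub
      (((h (by fun_prop)).add (h (by fun_prop))).div_const _)))

theorem casEig_reflect [r.AtLeastTwo] (μ : ℂ) {j : ℕ} (hj : j < r) :
    casEig r (-μ + 2 * (r - 1 - j : ℕ)) = casEig r (μ + 2 * j) := by
  refine (casEig_eq_iff _ _).2 (Or.inr ⟨1, ?_⟩)
  have : ((r - 1 - j : ℕ) : ℂ) = r - 1 - j := by
    rw [Nat.cast_sub (by omega), Nat.cast_pred (NeZero.pos r)]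
  rw [this]
  push_cast
  ring

/-- For μ not an integer the r values c(μ + 2j) are distinct and invariant under μ ↦ -μ, j ↦ r - 1 -
j, so two polynomials of degree less than r agree at r points. Integral μ are reached by continuity
of the values in μ. -/
theorem thetaPoly_neg [r.AtLeastTwo] (μ : ℂ) : thetaPoly r (-μ) = thetaPoly r μ := by
  have key : ∀ μ : ℂ, μ ∈ (Set.range fun n : ℤ => (n : ℂ))ᶜ →
      thetaPoly r (-μ) = thetaPoly r μ := by
    intro μ hμ
    have hinj : Set.InjOn (fun j : ℕ => casEig r (μ + 2 * j)) (Finset.range r) := by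
      intro j hj k hk h
      rw [Finset.mem_coe, Finset.mem_range] at hj hk
      refine ((casEig_shift_eq_iff hj hk).1 h).resolve_right ?_
      rintro ⟨n, hn⟩
      -- A coincidence between distinct labels forces 2μ + 2j + 2k + 2 = 2rn, hence μ is an integer.
      refine hμ ⟨r * n - j - k - 1, ?_⟩
      push_cast
      linear_combination -hn / 2
    refine eq_of_degree_sub_lt_of_eval_finset_eq
      ((Finset.range r).image fun j : ℕ => casEig r (μ + 2 * j)) ?_ ?_
    · rw [Finset.card_image_of_injOn hinj, Finset.card_range]
      exact (degree_sub_le _ _).trans_lt (max_lt (degree_thetaPoly_lt _ _) (degree_thetaPoly_lt _ _))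
    · intro c hc
      obtain ⟨j, hj, rfl⟩ := Finset.mem_image.1 hc
      rw [Finset.mem_range] at hj
      rw [eval_thetaPoly μ hj, ← casEig_reflect μ hj, eval_thetaPoly (-μ) (by omega)]
      congr 3
      rw [Nat.cast_sub (by omega), Nat.cast_pred (NeZero.pos r)]
      ring
  refine Polynomial.funext fun x => ?_
  refine congrFun (Continuous.ext_on ((Set.countable_range fun n : ℤ => (n : ℂ)).dense_compl ℂ)
    ((continuous_eval_thetaPoly x).comp continuous_neg) (continuous_eval_thetaPoly x) ?_) μ
  intro μ hμ
  exact congrArg (eval x) (key μ hμ)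

/-! ### Duality -/

theorem aeval_tr {V : WtMod r} (T : Module.End ℂ V) (p : ℂ[X]) :
    aeval (WtMod.tr T) p = WtMod.tr (aeval T p) := by
  induction p using Polynomial.induction_on' with
  | add p q hp hq => rw [map_add, map_add, hp, hq]; ext; simp
  | monomial n c =>
    rw [aeval_monomial, aeval_monomial, WtMod.tr_pow]
    ext
    simp

theorem tr_ext_weight {V : WtMod r} {S : Module.End ℂ V.dual} {T : Module.End ℂ V}
    (h : ∀ (a b : ℂ) (f : Module.Dual ℂ V) (v : V), V.dual.H f = a • (show V.dual from f) →
      V.H v = b • v → (show Module.Dual ℂ V from S f) v = f (T v)) : S = WtMod.tr T :=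
  WtMod.ext_weight fun a f hf => WtMod.ext_weight (V := V) (M := ℂ)
    (f := show Module.Dual ℂ V from S f) (g := (show Module.Dual ℂ V from f) ∘ₗ T)
      fun b v hv => h a b f v hf hv

theorem cas_dual [r.AtLeastTwo] (V : WtMod r) : V.dual.cas = WtMod.tr V.cas := by
  refine tr_ext_weight fun a b f v hf hv => ?_
  refine (LinearMap.congr_fun (WtMod.cas_apply hf) v).trans ?_
  change f (-((V.E * V.Kinv) (-((V.K * V.F) v)))) + casEig r a * f v = f (V.cas v)
  have h1 : (V.E * V.Kinv) ((V.K * V.F) v) = V.E (V.F v) := by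
    rw [← Module.End.mul_apply, mul_assoc, ← mul_assoc V.Kinv, V.Kinv_K, one_mul,
      Module.End.mul_apply]
  -- Only a = -b contributes, and c(-b) = c(b - 2) by the reflection. Transposition exchanges the
  -- roles of F E and E F.
  have h2 : casEig r a * f v = casEig r (b - 2) * f v := by
    rcases eq_or_ne (b + a) 0 with h | h
    · rw [eq_neg_of_add_eq_zero_right h, (casEig_eq_iff (-b) (b - 2)).2 (Or.inr ⟨0, by push_cast; ring⟩)]
    · rw [dual_weight_apply hv hf h, mul_zero, mul_zero]
  rw [map_neg (V.E * V.Kinv), neg_neg, h1, h2, WtMod.E_F_apply hv, map_sub, map_smul, smul_eq_mul,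
    sub_add_cancel]

theorem aeval_cas_dual [r.AtLeastTwo] (V : WtMod r) (p : ℂ[X]) :
    aeval V.dual.cas p = WtMod.tr (aeval V.cas p) :=
  (congrArg (fun T : Module.End ℂ V.dual => aeval T p) (cas_dual V)).trans (aeval_tr V.cas p)

/-- The Casimir operator of the dual is the transpose and weights change sign, so the claim is the
evenness of `thetaPoly` in the weight. -/
theorem thetaOp_dual [r.AtLeastTwo] (V : WtMod r) : thetaOp V.dual = WtMod.tr (thetaOp V) := by
  refine tr_ext_weight fun a b f v hf hv => ?_
  refine (LinearMap.congr_fun (thetaOp_apply hf) v).trans ?_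
  rw [thetaOp_apply hv, aeval_cas_dual]
  change f (aeval V.cas (thetaPoly r a) v) = f (aeval V.cas (thetaPoly r b) v)
  rcases eq_or_ne (b + a) 0 with h | h
  · rw [eq_neg_of_add_eq_zero_right h, thetaPoly_neg]
  · rw [dual_weight_apply (WtMod.H_aeval_cas hv _) hf h,
      dual_weight_apply (WtMod.H_aeval_cas hv _) hf h]

end UnrolledSl2

end

open CategoryTheory TensorProduct Polynomial
noncomputable section
namespace UnrolledSl2

variable {r : ℕ}

/-! ### The values of the half twist -/

open Classical in
/-- For an integer `α` not divisible by `r`, its representative modulo `2 r` in `[-r, r)`;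
otherwise `α`. -/
def typicalRep (r : ℕ) (α : ℂ) : ℂ :=
  if h : ∃ n : ℤ, α = n ∧ ¬ (r : ℤ) ∣ n then ((h.choose.bmod (2 * r) : ℤ) : ℂ) else α

theorem typicalRep_intCast {n : ℤ} (hn : ¬ (r : ℤ) ∣ n) :
    typicalRep r n = (n.bmod (2 * r) : ℤ) := by
  have h : ∃ m : ℤ, (n : ℂ) = m ∧ ¬ (r : ℤ) ∣ m := ⟨n, rfl, hn⟩
  have h1 : h.choose = n := by exact_mod_cast h.choose_spec.1.symm
  rw [typicalRep, dif_pos h, h1]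

theorem typicalRep_of_not {α : ℂ} (h : ¬ ∃ n : ℤ, α = n ∧ ¬ (r : ℤ) ∣ n) : typicalRep r α = α :=
  dif_neg h

/-- The value of the standard half twist on a module generated by a highest weight vector of
weight `α + r - 1`. -/
def halfTwistVal (r : ℕ) (α : ℂ) : ℂ := qpow r ((typicalRep r α ^ 2 - ((r : ℂ) - 1) ^ 2) / 4)

theorem halfTwistVal_ne_zero (α : ℂ) : halfTwistVal r α ≠ 0 := qpow_ne_zero _ _

/-- Modulo 2r one has n ≡ -m, and only the square of the representative enters. This is the
coincidence of values at the two labels of a double root of C. -/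
theorem halfTwistVal_of_add_dvd {m n : ℤ} (hm : ¬ (r : ℤ) ∣ m) (h : ((2 * r : ℕ) : ℤ) ∣ m + n) :
    halfTwistVal r m = halfTwistVal r n := by
  have hn : ¬ (r : ℤ) ∣ n := fun hn => hm <| by
    have h1 : (r : ℤ) ∣ m + n := (Dvd.intro_left 2 (by push_cast; ring)).trans h
    exact (Int.dvd_add_left hn).1 h1
  have h1 : n.bmod (2 * r) = (-m).bmod (2 * r) := by
    rw [Int.bmod_eq_bmod_iff_bmod_sub_eq_zero]
    refine Int.bmod_eq_zero_of_dvd ?_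
    rwa [sub_neg_eq_add, add_comm]
  rw [halfTwistVal, halfTwistVal, typicalRep_intCast hm, typicalRep_intCast hn, h1, Int.neg_bmod]
  split_ifs with h2
  · rfl
  · push_cast
    rw [neg_sq]

theorem halfTwistVal_neg (α : ℂ) : halfTwistVal r (-α) = halfTwistVal r α := by
  by_cases h : ∃ n : ℤ, α = n ∧ ¬ (r : ℤ) ∣ n
  · obtain ⟨n, rfl, hn⟩ := h
    rw [← Int.cast_neg, halfTwistVal_of_add_dvd hn (n := -n) (by simp)]
  · have h' : ¬ ∃ n : ℤ, -α = n ∧ ¬ (r : ℤ) ∣ n := by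
      rintro ⟨n, hn, h1⟩
      exact h ⟨-n, by rw [Int.cast_neg, ← hn, neg_neg], by rwa [Int.dvd_neg]⟩
    rw [halfTwistVal, halfTwistVal, typicalRep_of_not h, typicalRep_of_not h', neg_sq]

/-- Replacing an integer α by α + 2rk changes α²/2 by the multiple 2r(kα + rk²) of 2r, which q does
not see. At a quarter of the square it may matter, whence the choice of representative. -/
theorem halfTwistVal_sq (hr : r ≠ 0) (α : ℂ) :
    halfTwistVal r α ^ 2 * qpow r ((((r : ℂ) - 1) ^ 2 - α ^ 2) / 2) = 1 := by
  rw [halfTwistVal, pow_two, ← qpow_add, ← qpow_add, qpow_eq_one_iff hr]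
  by_cases h : ∃ n : ℤ, α = n ∧ ¬ (r : ℤ) ∣ n
  · obtain ⟨n, rfl, hn⟩ := h
    obtain ⟨k, hk⟩ := Int.dvd_bmod_sub_self (x := n) (m := 2 * r)
    rw [typicalRep_intCast hn, show n.bmod (2 * r) = n + 2 * r * k by push_cast at hk; linarith]
    refine ⟨k * n + r * k ^ 2, ?_⟩
    push_cast
    ring
  · rw [typicalRep_of_not h]
    exact ⟨0, by push_cast; ring⟩

open Classical in
/-- The value of the standard half twist on the vectors of weight `μ` in the generalized
eigenspace of the Casimir operator for `c`. -/
def blockVal (r : ℕ) (μ c : ℂ) : ℂ :=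
  if h : ∃ j < r, c = casEig r (μ + 2 * (j : ℕ)) then halfTwistVal r (μ + 2 * h.choose - r + 1)
  else 1

/-- Independence of the chosen label: for distinct labels j, k with the same eigenvalue, the numbers
μ + 2j - r + 1 and μ + 2k - r + 1 are integers not divisible by r whose sum is divisible by 2r. -/
theorem blockVal_casEig [r.AtLeastTwo] (μ : ℂ) {j : ℕ} (hj : j < r) :
    blockVal r μ (casEig r (μ + 2 * j)) = halfTwistVal r (μ + 2 * j - r + 1) := by
  have h : ∃ k < r, casEig r (μ + 2 * j) = casEig r (μ + 2 * (k : ℕ)) := ⟨j, hj, rfl⟩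
  rw [blockVal, dif_pos h]
  obtain ⟨hk, hc⟩ := h.choose_spec
  generalize h.choose = k at hk hc
  rcases eq_or_ne j k with rfl | hjk
  · rfl
  obtain ⟨n, hn⟩ := ((casEig_shift_eq_iff hj hk).1 hc).resolve_left hjk
  have e1 : μ + 2 * j - r + 1 = ((r * (n - 1) + (j - k) : ℤ) : ℂ) := by
    push_cast
    linear_combination hn / 2
  have e2 : μ + 2 * k - r + 1 = ((r * (n - 1) + (k - j) : ℤ) : ℂ) := by
    push_cast
    linear_combination hn / 2
  rw [e1, e2]
  refine halfTwistVal_of_add_dvd ?_ ⟨n - 1, by push_cast; ring⟩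
  rw [Int.dvd_add_right (dvd_mul_right _ _)]
  rintro ⟨m, hm⟩
  exact hjk.symm (eq_of_sub_eq_mul hk hj (n := m) (by exact_mod_cast hm))

theorem blockVal_ne_zero (μ c : ℂ) : blockVal r μ c ≠ 0 := by
  unfold blockVal
  split_ifs
  · exact halfTwistVal_ne_zero _
  · exact one_ne_zero

/-! ### Naturality -/

section Natural

variable {V W : WtMod r} (f : V ⟶ W)

theorem lin_aeval_cas (p : ℂ[X]) (v : V) :
    WtMod.lin f (aeval V.cas p v) = aeval W.cas p (WtMod.lin f v) :=
  aeval_apply_comm (WtMod.lin_cas f) p v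

theorem lin_isBlockVec {μ c : ℂ} {v : V} (hv : V.IsBlockVec μ c v) :
    W.IsBlockVec μ c (WtMod.lin f v) :=
  ⟨WtMod.lin_weight f hv.1, by rw [← lin_aeval_cas, hv.2, map_zero]⟩

theorem lin_blockFun [r.AtLeastTwo] (g : ℂ → ℂ → ℂ) (v : V) :
    WtMod.lin f (V.blockFun g v) = W.blockFun g (WtMod.lin f v) := by
  refine LinearMap.congr_fun (WtMod.ext_blockVec (f := WtMod.lin f ∘ₗ V.blockFun g)
    (g := W.blockFun g ∘ₗ WtMod.lin f) fun μ c v hv => ?_) v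
  rw [LinearMap.comp_apply, LinearMap.comp_apply, WtMod.blockFun_apply g hv, map_smul,
    WtMod.blockFun_apply g (lin_isBlockVec f hv)]

theorem lin_thetaOp [r.AtLeastTwo] (v : V) :
    WtMod.lin f (thetaOp V v) = thetaOp W (WtMod.lin f v) := by
  refine LinearMap.congr_fun (WtMod.ext_weight (f := WtMod.lin f ∘ₗ thetaOp V)
    (g := thetaOp W ∘ₗ WtMod.lin f) fun μ v hv => ?_) v
  rw [LinearMap.comp_apply, LinearMap.comp_apply, thetaOp_apply hv, lin_aeval_cas,
    thetaOp_apply (WtMod.lin_weight f hv)]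

end Natural

/-! ### The square root of the twist -/

section Sqrt

variable [r.AtLeastTwo]

/-- The label j at weight μ + 2 corresponds to j + 1 at weight μ, and both give the same highest
weight μ + 2 + 2j. -/
theorem blockFun_blockVal_mem_homs (V : WtMod r) :
    V.blockFun (blockVal r) ∈ WtMod.homs V V := by
  refine WtMod.blockFun_mem_homs V fun μ j hj => ?_
  have h1 := blockVal_casEig (r := r) μ hj
  have h2 := blockVal_casEig (r := r) (μ + 2) (j := j) (by omega)
  rw [show μ + 2 * ((j + 1 : ℕ) : ℂ) = μ + 2 + 2 * j by push_cast; ring] at h1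
  rw [h1, h2]

/-- The operator `θ ^ (1/2)`. -/
def sqrtTwist (V : WtMod r) : Module.End ℂ V :=
  (3 / 2 : ℂ) • V.blockFun (blockVal r)
    - (1 / 2 : ℂ) • V.blockFun (fun μ c => blockVal r μ c ^ 3) ∘ₗ thetaOp V

theorem thetaOp_isBlockVec {V : WtMod r} {μ c : ℂ} {v : V} (hv : V.IsBlockVec μ c v) :
    V.IsBlockVec μ c (thetaOp V v) :=
  lin_isBlockVec (WtMod.ofLin _ (thetaOp_mem_homs V)) hv

/-- With T = `thetaOp` and β the block value, T is β⁻² plus an operator of square zero, so T^(-1/2)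
= β(1 - β²(T - β⁻²)/2) = (3/2)β - (1/2)β³ T exactly. -/
theorem sqrtTwist_apply {V : WtMod r} {μ c : ℂ} {v : V} (hv : V.IsBlockVec μ c v) :
    sqrtTwist V v = (3 / 2 * blockVal r μ c) • v
      - (1 / 2 * blockVal r μ c ^ 3) • thetaOp V v := by
  rw [sqrtTwist, LinearMap.sub_apply, LinearMap.smul_apply, LinearMap.smul_apply,
    LinearMap.comp_apply, WtMod.blockFun_apply _ hv, WtMod.blockFun_apply _ (thetaOp_isBlockVec hv),
    smul_smul, smul_smul]

theorem lin_sqrtTwist {V W : WtMod r} (f : V ⟶ W) (v : V) :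
    WtMod.lin f (sqrtTwist V v) = sqrtTwist W (WtMod.lin f v) := by
  rw [sqrtTwist, sqrtTwist, LinearMap.sub_apply, LinearMap.smul_apply, LinearMap.smul_apply,
    LinearMap.comp_apply, map_sub, map_smul, map_smul, lin_blockFun, lin_blockFun, lin_thetaOp]
  rfl

theorem sqrtTwist_mem_homs (V : WtMod r) : sqrtTwist V ∈ WtMod.homs V V := by
  refine (WtMod.homs V V).sub_mem ((WtMod.homs V V).smul_mem _ (blockFun_blockVal_mem_homs V))
    ((WtMod.homs V V).smul_mem _ (WtMod.comp_mem_homs (thetaOp_mem_homs V) ?_))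
  -- The cube is a composite of module maps, so its naturality needs no separate verification.
  have h : V.blockFun (fun μ c => blockVal r μ c ^ 3) = V.blockFun (blockVal r) ∘ₗ
      V.blockFun (blockVal r) ∘ₗ V.blockFun (blockVal r) := by
    refine WtMod.ext_blockVec fun μ c v hv => ?_
    simp only [LinearMap.comp_apply, WtMod.blockFun_apply _ hv, map_smul, smul_smul]
    congr 1
    ring
  rw [h]
  have h1 := blockFun_blockVal_mem_homs V
  exact WtMod.comp_mem_homs (WtMod.comp_mem_homs h1 h1) h1

/-- The polynomial `thetaPoly` minus its value β⁻² at c is divisible by X - c, so its square kills a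
vector killed by (C - c)². Expanding (T - β⁻²)² = 0 gives the relation. -/
theorem sq_thetaOp_apply {V : WtMod r} {μ c : ℂ} {v : V} (hv : V.IsBlockVec μ c v) :
    thetaOp V (thetaOp V v) = (2 * (blockVal r μ c ^ 2)⁻¹) • thetaOp V v
      - (blockVal r μ c ^ 4)⁻¹ • v := by
  rcases eq_or_ne v 0 with rfl | h0
  · simp
  obtain ⟨j, hj, rfl⟩ := WtMod.exists_casEig_of_isBlockVec hv h0
  set x := (blockVal r μ (casEig r (μ + 2 * j)) ^ 2)⁻¹ with hx
  have h1 : (thetaPoly r μ).eval (casEig r (μ + 2 * j)) = x := by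
    rw [eval_thetaPoly μ hj, hx, blockVal_casEig μ hj]
    refine eq_inv_of_mul_eq_one_left ?_
    have := halfTwistVal_sq (NeZero.ne r) (μ + 2 * j - r + 1)
    exact (mul_comm _ _).trans this
  have h2 : X - C (casEig r (μ + 2 * j)) ∣ thetaPoly r μ - C x :=
    dvd_iff_isRoot.2 (by simp [h1])
  have h3 := aeval_eq_zero_of_dvd (pow_dvd_pow_of_dvd h2 2) hv.2
  have h4 : (blockVal r μ (casEig r (μ + 2 * j)) ^ 4)⁻¹ = x * x := by
    rw [hx, ← mul_inv]
    ring
  have h5 : (thetaPoly r μ - C x) ^ 2 = thetaPoly r μ * thetaPoly r μ - C (2 * x) * thetaPoly r μ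
      + C (x * x) := by
    rw [map_mul, map_mul, map_ofNat]
    ring
  rw [h5, map_add, map_sub, map_mul, map_mul, aeval_C, aeval_C, LinearMap.add_apply,
    LinearMap.sub_apply, Module.End.mul_apply, Module.End.mul_apply, Module.algebraMap_end_apply,
    Module.algebraMap_end_apply, ← thetaOp_apply hv.1,
    ← thetaOp_apply (thetaOp_isBlockVec hv).1] at h3
  rw [h4]
  linear_combination (norm := module) h3

theorem sqrtTwist_mul_sqrtTwist_mul_thetaOp (V : WtMod r) :
    sqrtTwist V * (sqrtTwist V * thetaOp V) = 1 := by
  refine WtMod.ext_blockVec fun μ c v hv => ?_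
  have h0 := blockVal_ne_zero (r := r) μ c
  rw [Module.End.mul_apply, Module.End.mul_apply, Module.End.one_apply,
    sqrtTwist_apply (thetaOp_isBlockVec hv), sq_thetaOp_apply hv, map_sub, map_smul, map_smul, map_sub, map_smul, map_smul, sqrtTwist_apply hv, sqrtTwist_apply (thetaOp_isBlockVec hv), sq_thetaOp_apply hv]
  match_scalars <;> field_simp <;> ring

theorem thetaOp_mul_sqrtTwist_mul_sqrtTwist (V : WtMod r) :
    thetaOp V * (sqrtTwist V * sqrtTwist V) = 1 :=
  mul_eq_one_comm.1 ((mul_assoc _ _ _).trans (sqrtTwist_mul_sqrtTwist_mul_thetaOp V))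

theorem twist_eq (V : WtMod r) : twist V = sqrtTwist V * sqrtTwist V := by
  have h := thetaOp_mul_sqrtTwist_mul_sqrtTwist V
  exact Ring.inverse_unit ⟨thetaOp V, sqrtTwist V * sqrtTwist V, h, mul_eq_one_comm.1 h⟩

theorem sqrtTwist_apply_of_E_eq_zero {V : WtMod r} {l : ℂ} {v : V}
    (hv : V.H v = l • v) (h0 : V.E v = 0) :
    sqrtTwist V v = halfTwistVal r (l - r + 1) • v := by
  have hb : V.IsBlockVec l (casEig r l) v :=
    WtMod.isBlockVec_of_cas hv (WtMod.cas_apply_of_E_eq_zero hv h0)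
  have h1 := blockVal_casEig (r := r) l (NeZero.pos r)
  rw [Nat.cast_zero, mul_zero, add_zero] at h1
  have h2 := halfTwistVal_sq (NeZero.ne r) (l - r + 1)
  rw [sqrtTwist_apply hb, h1, thetaOp_apply_of_E_eq_zero hv h0, smul_smul, ← sub_smul]
  congr 1
  linear_combination (-1 / 2 * halfTwistVal r (l - r + 1)) * h2

/-- Orthogonality of distinct generalized eigenspaces: φ vanishes on the image of q(T), and by a
Bézout identity this image contains the kernel of p(T). -/
theorem eq_zero_of_coprime_functional {M : Type*} [AddCommGroup M] [Module ℂ M]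
    {T : Module.End ℂ M} {p q : ℂ[X]} (h : IsCoprime p q) {φ : M →ₗ[ℂ] ℂ} {v : M}
    (hp : aeval T p v = 0) (hq : ∀ w, φ (aeval T q w) = 0) : φ v = 0 := by
  obtain ⟨a, b, hab⟩ := h
  have := congrArg (fun s => φ (aeval T s v)) hab
  simp only [map_add, map_mul, LinearMap.add_apply, Module.End.mul_apply, hp, map_zero, zero_add,
    map_one, Module.End.one_apply] at this
  rw [← this, ← Module.End.mul_apply, ← map_mul, mul_comm, map_mul, Module.End.mul_apply, hq]

theorem isCoprime_sq {c d : ℂ} (h : c ≠ d) : IsCoprime ((X - C c) ^ 2) ((X - C d) ^ 2 : ℂ[X]) :=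
  IsCoprime.pow (pairwise_coprime_X_sub_C Function.injective_id h)

theorem tr_ext_blockVec {V : WtMod r} {S : Module.End ℂ V.dual} {T : Module.End ℂ V}
    (h : ∀ (a b c d : ℂ) (f : Module.Dual ℂ V) (v : V), V.dual.IsBlockVec a c (show V.dual from f) →
      V.IsBlockVec b d v → (show Module.Dual ℂ V from S f) v = f (T v)) : S = WtMod.tr T :=
  WtMod.ext_blockVec fun a c f hf => WtMod.ext_blockVec (V := V) (M := ℂ)
    (f := show Module.Dual ℂ V from S f) (g := (show Module.Dual ℂ V from f) ∘ₗ T)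
      fun b d v hv => h a b c d f v hf hv

theorem blockFun_blockVal_dual (V : WtMod r) (n : ℕ) :
    V.dual.blockFun (fun μ c => blockVal r μ c ^ n)
      = WtMod.tr (V.blockFun fun μ c => blockVal r μ c ^ n) := by
  refine tr_ext_blockVec fun a b c d f v hf hv => ?_
  refine (LinearMap.congr_fun (WtMod.blockFun_apply _ hf) v).trans ?_
  rw [WtMod.blockFun_apply _ hv, map_smul]
  change blockVal r a c ^ n * f v = blockVal r b d ^ n * f v
  rcases eq_or_ne (f v) 0 with h0 | h0
  · rw [h0, mul_zero, mul_zero]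
  -- A nonzero pairing forces opposite weights and equal Casimir eigenvalues. Then label j at weight
  -- b matches r - 1 - j at weight -b, and the numbers entering `halfTwistVal` are negatives of each
  -- other.
  have hab : b + a = 0 := by
    by_contra hab
    exact h0 (dual_weight_apply hv.1 hf.1 hab)
  have hcd : d = c := by
    by_contra hcd
    refine h0 (eq_zero_of_coprime_functional (isCoprime_sq hcd) hv.2 fun w => ?_)
    have h2 := hf.2
    rw [aeval_cas_dual] at h2
    exact LinearMap.congr_fun h2 w
  subst hcd
  rw [eq_neg_of_add_eq_zero_right hab]
  obtain ⟨j, hj, rfl⟩ := WtMod.exists_casEig_of_isBlockVec hv fun h => h0 (by rw [h, map_zero])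
  rw [blockVal_casEig b hj, ← casEig_reflect b hj, blockVal_casEig (-b) (by omega),
    ← halfTwistVal_neg (b + 2 * j - r + 1)]
  congr 3
  rw [Nat.cast_sub (by omega), Nat.cast_pred (NeZero.pos r)]
  ring

theorem sqrtTwist_dual (V : WtMod r) : sqrtTwist V.dual = WtMod.tr (sqrtTwist V) := by
  have h1 := blockFun_blockVal_dual V 1
  simp only [pow_one] at h1
  have h3 : thetaOp V ∘ₗ V.blockFun (fun μ c => blockVal r μ c ^ 3)
      = V.blockFun (fun μ c => blockVal r μ c ^ 3) ∘ₗ thetaOp V :=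
    LinearMap.ext fun v => lin_blockFun (WtMod.ofLin _ (thetaOp_mem_homs V)) _ v
  rw [sqrtTwist, h1, blockFun_blockVal_dual V 3, thetaOp_dual, sqrtTwist, ← h3]
  refine LinearMap.ext fun (f : Module.Dual ℂ V) => LinearMap.ext fun (v : V) => ?_
  change (3 / 2 : ℂ) * f _ - (1 / 2 : ℂ) * f _ = f ((3 / 2 : ℂ) • _ - (1 / 2 : ℂ) • _)
  rw [map_sub, map_smul, map_smul]
  rfl

theorem sqrtTwist_unit : sqrtTwist (WtMod.unit r) = 1 := by
  refine LinearMap.ext fun v => ?_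
  refine (sqrtTwist_apply_of_E_eq_zero (l := 0) (by rw [zero_smul]; rfl) rfl).trans ?_
  have hr := Nat.AtLeastTwo.prop (n := r)
  -- The unit corresponds to α = 1 - r. As r ≥ 2 it is not divisible by r and is its own
  -- representative in [-r, r), so the exponent is zero.
  have hn : ¬ (r : ℤ) ∣ 1 - r := by
    intro h
    have := Int.le_of_dvd one_pos ((dvd_sub_left (dvd_refl _)).1 h)
    omega
  have h1 : halfTwistVal r (0 - r + 1) = 1 := by
    rw [show (0 : ℂ) - r + 1 = ((1 - r : ℤ) : ℂ) by push_cast; ring, halfTwistVal,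
      typicalRep_intCast hn, Int.bmod_eq_of_le (by push_cast; omega) (by push_cast; omega)]
    rw [show (((((1 : ℤ) - r : ℤ) : ℂ)) ^ 2 - ((r : ℂ) - 1) ^ 2) / 4 = 0 by push_cast; ring,
      qpow_zero]
  rw [h1, one_smul]
  rfl

variable (r) in
/-- The standard half twist. -/
def standardHalfTwist : HalfTwist r where
  iso := NatIso.ofComponents (fun V =>
    { hom := WtMod.ofLin _ (sqrtTwist_mem_homs V)
      inv := WtMod.ofLin _ (WtMod.comp_mem_homs (thetaOp_mem_homs V) (sqrtTwist_mem_homs V))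
      hom_inv_id := WtMod.hom_ext (mul_eq_one_comm.1 (sqrtTwist_mul_sqrtTwist_mul_thetaOp V))
      inv_hom_id := WtMod.hom_ext (sqrtTwist_mul_sqrtTwist_mul_thetaOp V) })
    fun f => WtMod.hom_ext (LinearMap.ext fun v => (lin_sqrtTwist f v).symm)
  sq V := (twist_eq V).symm
  dual := sqrtTwist_dual
  unit := WtMod.hom_ext sqrtTwist_unit

end Sqrt
end UnrolledSl2

end

open CategoryTheory TensorProduct Polynomial
noncomputable section
namespace UnrolledSl2

variable {r : ℕ} [r.AtLeastTwo]

/-! ### Values on modules generated by a highest weight vector -/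

theorem sqrtTwist_eq_smul {V : WtMod r} {l : ℂ} {v : V} (hv : V.H v = l • v) (h0 : V.E v = 0)
    (hs : Submodule.span ℂ (Set.range fun j => (V.F ^ j) v) = ⊤) :
    sqrtTwist V = halfTwistVal r (l - r + 1) • 1 := by
  refine LinearMap.ext_on hs ?_
  rintro _ ⟨j, rfl⟩
  rw [mem_homs_F_pow (sqrtTwist_mem_homs V), sqrtTwist_apply_of_E_eq_zero hv h0, map_smul]
  rfl

theorem hasValue_standardHalfTwist {V : WtMod r} {l c : ℂ} {v : V} (hv : V.H v = l • v)
    (h0 : V.E v = 0) (hs : Submodule.span ℂ (Set.range fun j => (V.F ^ j) v) = ⊤)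
    (hc : halfTwistVal r (l - r + 1) = c) : (standardHalfTwist r).HasValue V c := by
  refine ⟨1, ?_⟩
  rw [pow_one, sub_eq_zero, ← hc]
  exact sqrtTwist_eq_smul hv h0 hs

section

open WtMod

variable {N : ℕ} {l : ℂ} (hN : N ≤ r) (hl : hwCoeff r l N = 0)

theorem span_F_pow_hwTop :
    Submodule.span ℂ (Set.range fun j => ((hw r N l hN hl).F ^ j) (hwTop hN hl)) = ⊤ := by
  rw [eq_top_iff]
  refine (Pi.basisFun ℂ (Fin N)).span_eq.ge.trans (Submodule.span_mono ?_)
  rintro _ ⟨i, rfl⟩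
  exact ⟨i, (hw_F_pow_top hN hl i).trans (basisFun_eq N i).symm⟩

variable {a : ℂ} (h1 : 1 ≤ r) (ha : hwCoeff r a 1 = 0) (V : WtMod r)

theorem hw_one_F (y : hw r 1 a h1 ha) : (hw r 1 a h1 ha).F y = 0 := by
  have h : hwF 1 = 0 := hw_ext fun k hk => by
    rw [hwF_apply, hwVec_of_le (by omega), LinearMap.zero_apply]
  exact LinearMap.congr_fun h y

theorem tensor_hw_one_F_pow (v : V) (j : ℕ) :
    ((V.tensor (hw r 1 a h1 ha)).F ^ j) (v ⊗ₜ[ℂ] hwTop h1 ha) = (V.F ^ j) v ⊗ₜ[ℂ] hwTop h1 ha := by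
  induction j with
  | zero => rfl
  | succ j ih =>
    rw [pow_succ']
    refine (congrArg (V.tensor (hw r 1 a h1 ha)).F ih).trans ?_
    change V.Kinv _ ⊗ₜ[ℂ] (hw r 1 a h1 ha).F (hwTop h1 ha) + _ = _
    rw [hw_one_F, tmul_zero, zero_add, pow_succ']
    rfl

theorem tensor_hw_one_E {v : V} (hv : V.E v = 0) :
    (V.tensor (hw r 1 a h1 ha)).E (v ⊗ₜ[ℂ] hwTop h1 ha) = 0 := by
  change v ⊗ₜ[ℂ] (hw r 1 a h1 ha).E (hwTop h1 ha) + V.E v ⊗ₜ[ℂ] _ = 0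
  rw [hw_E_top, tmul_zero, hv, zero_tmul, add_zero]

theorem tensor_hw_one_H {b : ℂ} {v : V} (hv : V.H v = b • v) :
    (V.tensor (hw r 1 a h1 ha)).H (v ⊗ₜ[ℂ] hwTop h1 ha)
      = (b + a) • (v ⊗ₜ[ℂ] hwTop h1 ha : V ⊗[ℂ] hw r 1 a h1 ha) :=
  tensor_H_tmul _ _ hv (hw_H_top h1 ha)

theorem tensor_hw_one_span {v : V}
    (hv : Submodule.span ℂ (Set.range fun j => (V.F ^ j) v) = ⊤) :
    Submodule.span ℂ (Set.range fun j =>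
      ((V.tensor (hw r 1 a h1 ha)).F ^ j) (v ⊗ₜ[ℂ] hwTop h1 ha)) = ⊤ := by
  have h2 : ∀ x : V, x ⊗ₜ[ℂ] hwTop h1 ha ∈ Submodule.span ℂ (Set.range fun j =>
      (V.F ^ j) v ⊗ₜ[ℂ] hwTop h1 ha) := by
    intro x
    have hx : x ∈ Submodule.span ℂ (Set.range fun j => (V.F ^ j) v) := hv ▸ Submodule.mem_top
    induction hx using Submodule.span_induction with
    | mem _ h =>
      obtain ⟨j, rfl⟩ := h
      exact Submodule.subset_span ⟨j, rfl⟩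
    | zero => rw [zero_tmul]; exact zero_mem _
    | add y z _ _ hy hz => rw [add_tmul]; exact add_mem hy hz
    | smul c y _ hy => rw [← smul_tmul']; exact Submodule.smul_mem _ _ hy
  simp only [tensor_hw_one_F_pow]
  rw [eq_top_iff]
  refine (TensorProduct.span_tmul_eq_top ℂ V (hw r 1 a h1 ha)).ge.trans (Submodule.span_le.2 ?_)
  rintro _ ⟨x, y, rfl⟩
  have hy : y = (y : Fin 1 → ℂ) 0 • hwTop h1 ha := by
    refine funext fun i : Fin 1 => ?_
    obtain rfl : i = 0 := Subsingleton.elim _ _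
    exact (mul_one _).symm
  rw [hy, tmul_smul]
  exact Submodule.smul_mem _ _ (h2 x)

omit [r.AtLeastTwo] in
theorem typicalRep_of_typical {α : ℂ} (h : (¬ ∃ n : ℤ, α = n) ∨ ∃ k : ℤ, α = k * r) :
    typicalRep r α = α := by
  refine typicalRep_of_not ?_
  rintro ⟨n, rfl, hn⟩
  rcases h with h | ⟨k, hk⟩
  · exact h ⟨n, rfl⟩
  · exact hn ⟨k, by rw [mul_comm]; exact_mod_cast hk⟩

-- For even k the representative modulo 2r is i + 1 - r, and (i + 1 - r)² - (r - 1)² = i(i + 2 -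
-- 2r).
omit [r.AtLeastTwo] in
theorem halfTwistVal_even {i : ℕ} (hi : i + 2 ≤ r) {k : ℤ} (hk : Even k) :
    halfTwistVal r ((i : ℂ) + k * r - r + 1) = qpow r ((i : ℂ) * ((i : ℂ) + 2 - 2 * r) / 4) := by
  obtain ⟨m, rfl⟩ := hk
  have h1 : ¬ (r : ℤ) ∣ i + (m + m) * r - r + 1 := by
    intro h
    have h2 : (r : ℤ) ∣ i + 1 := by
      have : (i : ℤ) + 1 = (i + (m + m) * r - r + 1) + r * (1 - (m + m)) := by ring
      rw [this]
      exact dvd_add h (dvd_mul_right _ _)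
    have := Int.le_of_dvd (by omega) h2
    omega
  have h2 : (i + (m + m) * r - r + 1 : ℤ).bmod (2 * r) = i + 1 - r := by
    refine (Int.bmod_eq_iff (by omega)).2 ⟨by push_cast; omega, by push_cast; omega, -m, ?_⟩
    push_cast
    ring
  rw [halfTwistVal, show (i : ℂ) + (m + m : ℤ) * r - r + 1 = ((i + (m + m) * r - r + 1 : ℤ) : ℂ) by
    push_cast; ring, typicalRep_intCast h1, h2]
  congr 1
  push_cast
  ring

-- For odd k the representative is i + 1 = r - 1 - j, which explains the exchange of i with j in the
-- standard values.
omit [r.AtLeastTwo] in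
theorem halfTwistVal_odd {i j : ℕ} (hij : i + j + 2 = r) {k : ℤ} (hk : Odd k) :
    halfTwistVal r ((i : ℂ) + k * r - r + 1) = qpow r ((j : ℂ) * ((j : ℂ) + 2 - 2 * r) / 4) := by
  obtain ⟨m, rfl⟩ := hk
  have h1 : ¬ (r : ℤ) ∣ i + (2 * m + 1) * r - r + 1 := by
    intro h
    have h2 : (r : ℤ) ∣ i + 1 := by
      have : (i : ℤ) + 1 = (i + (2 * m + 1) * r - r + 1) + r * (-(2 * m)) := by ring
      rw [this]
      exact dvd_add h (dvd_mul_right _ _)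
    have := Int.le_of_dvd (by omega) h2
    omega
  have h2 : (i + (2 * m + 1) * r - r + 1 : ℤ).bmod (2 * r) = i + 1 := by
    refine (Int.bmod_eq_iff (by omega)).2 ⟨by push_cast; omega, by push_cast; omega, -m, ?_⟩
    push_cast
    ring
  have h3 : (i : ℂ) = r - j - 2 := by
    rw [← hij]
    push_cast
    ring
  rw [halfTwistVal, show (i : ℂ) + (2 * m + 1 : ℤ) * r - r + 1
    = ((i + (2 * m + 1) * r - r + 1 : ℤ) : ℂ) by push_cast; ring, typicalRep_intCast h1, h2]
  congr 1
  push_cast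
  rw [h3]
  ring

theorem isStandard_standardHalfTwist : (standardHalfTwist r).IsStandard where
  V α hα := by
    refine hasValue_standardHalfTwist (hw_H_top _ _) (hw_E_top _ _) (span_F_pow_hwTop _ _) ?_
    rw [show α + r - 1 - r + 1 = α by ring, halfTwistVal, typicalRep_of_typical hα]
  S i hi := by
    refine hasValue_standardHalfTwist (hw_H_top _ _) (hw_E_top _ _) (span_F_pow_hwTop _ _) ?_
    rw [← halfTwistVal_even hi (k := 0) (by simp)]
    simp
  S_even i hi k hk := hasValue_standardHalfTwist (tensor_hw_one_H _ _ _ (hw_H_top _ _))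
    (tensor_hw_one_E _ _ _ (hw_E_top _ _)) (tensor_hw_one_span _ _ _ (span_F_pow_hwTop _ _))
    (halfTwistVal_even hi hk)
  S_odd i hi j hij k hk := hasValue_standardHalfTwist (tensor_hw_one_H _ _ _ (hw_H_top _ _))
    (tensor_hw_one_E _ _ _ (hw_E_top _ _)) (tensor_hw_one_span _ _ _ (span_F_pow_hwTop _ _))
    (halfTwistVal_odd hij hk)

/-! ### Uniqueness of the standard half twist -/

/-- The map from `V_α` sending the highest weight vector to `v`. -/
def hwLift {V : WtMod r} (N : ℕ) (v : V) : (Fin N → ℂ) →ₗ[ℂ] V :=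
  (Pi.basisFun ℂ (Fin N)).constr ℂ fun i => (V.F ^ (i : ℕ)) v

omit [r.AtLeastTwo] in
theorem hwLift_apply {V : WtMod r} (v : V) (k : ℕ) : hwLift r v (hwVec r k) = (V.F ^ k) v := by
  rcases lt_or_ge k r with h | h
  · have := (Pi.basisFun ℂ (Fin r)).constr_basis ℂ (fun i : Fin r => (V.F ^ (i : ℕ)) v) ⟨k, h⟩
    rw [basisFun_eq] at this
    exact this
  · rw [hwVec_of_le h, map_zero, pow_eq_zero_of_le h V.F_pow, LinearMap.zero_apply]

/-- Since F^r = 0, the r-dimensional highest weight module is universal: it maps to every module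
with a highest weight vector of weight l, whether or not it is simple. -/
theorem hwLift_mem_homs {V : WtMod r} {l : ℂ} (hl : hwCoeff r l r = 0) {v : V}
    (hv : V.H v = l • v) (h0 : V.E v = 0) : hwLift r v ∈ homs (hw r r l le_rfl hl) V := by
  refine ⟨?_, ?_, ?_, ?_⟩ <;> refine (Pi.basisFun ℂ (Fin r)).ext fun i => ?_ <;>
    rw [basisFun_eq]
  · change hwLift r v (hwE r r l (hwVec r i)) = V.E (hwLift r v (hwVec r i))
    rw [hwE_apply r l i.2, map_smul, hwLift_apply, hwLift_apply]
    rcases Nat.eq_zero_or_pos (i : ℕ) with h | h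
    · rw [h, hwCoeff_zero, zero_smul, pow_zero, Module.End.one_apply, h0]
    · obtain ⟨m, hm⟩ := Nat.exists_eq_succ_of_ne_zero h.ne'
      rw [hm, Nat.succ_eq_add_one, E_F_pow_apply hv, h0, map_zero, zero_add, Nat.add_sub_cancel,
        hwCoeff]
      push_cast
      rw [add_sub_add_right_eq_sub]
  · change hwLift r v (hwF r (hwVec r i)) = V.F (hwLift r v (hwVec r i))
    rw [hwF_apply, hwLift_apply, hwLift_apply, pow_succ', Module.End.mul_apply]
  · change hwLift r v (hwK r r l (hwVec r i)) = V.K (hwLift r v (hwVec r i))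
    rw [hwK_apply, map_smul, hwLift_apply, V.K_eq _ _ (H_F_pow_apply hv i)]
  · change hwLift r v (hwH r l (hwVec r i)) = V.H (hwLift r v (hwVec r i))
    rw [hwH_apply, map_smul, hwLift_apply, H_F_pow_apply hv]

theorem hwH_coord (N : ℕ) (l : ℂ) (f : Fin N → ℂ) (i : Fin N) :
    hwH N l f i = (l - 2 * (i : ℕ)) * f i := by
  have h : LinearMap.proj i ∘ₗ hwH N l = (l - 2 * (i : ℕ)) • LinearMap.proj (R := ℂ) i := by
    refine (Pi.basisFun ℂ (Fin N)).ext fun j => ?_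
    rw [basisFun_eq, LinearMap.comp_apply, hwH_apply]
    by_cases hij : (i : ℕ) = j <;> simp [hwVec, hij]
  exact LinearMap.congr_fun h f

/-- The top weight space is a line, so any operator preserving weights acts on it by a scalar.
Transported along `hwLift`, this scalar depends only on l. -/
theorem hw_weight_top {f : hw r N l hN hl} (hf : (hw r N l hN hl).H f = l • f) :
    ∃ x : ℂ, f = x • hwTop hN hl := by
  have h : ∀ i : Fin N, (i : ℕ) ≠ 0 → (f : Fin N → ℂ) i = 0 := by
    intro i hi
    have h1 := (hwH_coord N l f i).symm.trans (congrFun hf i)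
    have h2 : (l - 2 * (i : ℕ)) * (f : Fin N → ℂ) i = l * (f : Fin N → ℂ) i := h1
    have h3 : (2 * ((i : ℕ) : ℂ)) * (f : Fin N → ℂ) i = 0 := by linear_combination -h2
    exact (mul_eq_zero.1 h3).resolve_left (by simpa using hi)
  rcases Nat.eq_zero_or_pos N with rfl | h0
  · exact ⟨0, funext fun i : Fin 0 => i.elim0⟩
  · refine ⟨(f : Fin N → ℂ) ⟨0, h0⟩, funext fun i : Fin N => ?_⟩
    change (f : Fin N → ℂ) i = (f : Fin N → ℂ) ⟨0, h0⟩ * hwVec N 0 i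
    by_cases hi : (i : ℕ) = 0
    · rw [show i = ⟨0, h0⟩ from Fin.ext hi]
      simp [hwVec]
    · simp [hwVec, hi, h i hi]

end

namespace HalfTwist

variable (s t : HalfTwist r)

theorem app_lin {V W : WtMod r} (f : V ⟶ W) (v : V) :
    WtMod.lin f (s.app V v) = s.app W (WtMod.lin f v) :=
  (LinearMap.congr_fun (congrArg WtMod.lin (s.iso.hom.naturality f)) v).symm

theorem inv_app (V : WtMod r) (v : V) : s.inv V (s.app V v) = v :=
  LinearMap.congr_fun (congrArg WtMod.lin (s.iso.hom_inv_id_app V)) v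

theorem app_inv (V : WtMod r) (v : V) : s.app V (s.inv V v) = v :=
  LinearMap.congr_fun (congrArg WtMod.lin (s.iso.inv_hom_id_app V)) v

theorem app_comm (V : WtMod r) (v : V) : s.app V (t.app V v) = t.app V (s.app V v) :=
  t.app_lin (s.iso.hom.app V) v

theorem app_app (V : WtMod r) (v : V) : s.app V (s.app V v) = twist V v :=
  LinearMap.congr_fun (s.sq V) v

theorem H_app {V : WtMod r} {μ : ℂ} {v : V} (hv : V.H v = μ • v) :
    V.H (s.app V v) = μ • s.app V v :=
  WtMod.lin_weight (s.iso.hom.app V) hv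

theorem app_E_pow {V : WtMod r} (v : V) (n : ℕ) :
    s.app V ((V.E ^ n) v) = (V.E ^ n) (s.app V v) :=
  WtMod.lin_E_pow (s.iso.hom.app V) v n

/-- On highest weight vectors of a given weight a half twist is a scalar. -/
theorem exists_scalar (l : ℂ) : ∃ x : ℂ, ∀ (V : WtMod r) (v : V),
    V.H v = l • v → V.E v = 0 → s.app V v = x • v := by
  have hl : WtMod.hwCoeff r l r = 0 := by
    have := qbr_int_mul r (NeZero.ne r) 1
    simp only [Int.cast_one, one_mul] at this
    simp [WtMod.hwCoeff, this]
  obtain ⟨x, hx⟩ := hw_weight_top _ _ (s.H_app (hw_H_top le_rfl hl))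
  refine ⟨x, fun V v hv h0 => ?_⟩
  have h1 := s.app_lin (WtMod.ofLin _ (hwLift_mem_homs hl hv h0)) (hwTop _ _)
  rw [hx, map_smul] at h1
  have h2 : WtMod.lin (WtMod.ofLin _ (hwLift_mem_homs hl hv h0)) (hwTop le_rfl hl) = v :=
    hwLift_apply v 0
  rw [h2] at h1
  exact h1.symm

theorem eq_of_hasValue {V : WtMod r} {v : V} {x c : ℂ} (hv : v ≠ 0) (hx : s.app V v = x • v)
    (hc : s.HasValue V c) : x = c := by
  obtain ⟨n, hn⟩ := hc
  have h : ∀ n, ((s.app V - c • (1 : Module.End ℂ V)) ^ n) v = (x - c) ^ n • v := by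
    intro n
    induction n with
    | zero => simp
    | succ n ih =>
      rw [pow_succ', Module.End.mul_apply, ih, map_smul, LinearMap.sub_apply, hx,
        LinearMap.smul_apply, Module.End.one_apply, ← sub_smul, smul_smul, pow_succ]
  have h1 := h n
  rw [hn, LinearMap.zero_apply] at h1
  exact sub_eq_zero.1 (eq_zero_of_pow_eq_zero ((smul_eq_zero.1 h1.symm).resolve_right hv))

variable {s t} (hs : s.IsStandard) (ht : t.IsStandard)
include hs ht

/-- For each l some module with a prescribed value has a highest weight vector of weight l: V_α with
α = l - r + 1 when α is a non-integer or a multiple of r, otherwise S_i ⊗ ℂ^H_{kr} with l = i + kr.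
-/
theorem IsStandard.app_eq_of_highest {V : WtMod r} {l : ℂ} {v : V} (hv : V.H v = l • v)
    (h0 : V.E v = 0) : s.app V v = t.app V v := by
  obtain ⟨x, hx⟩ := s.exists_scalar l
  obtain ⟨y, hy⟩ := t.exists_scalar l
  suffices h : x = y by rw [hx V v hv h0, hy V v hv h0, h]
  have key : ∀ (W : WtMod r) (c : ℂ) (w : W), s.HasValue W c → t.HasValue W c →
      W.H w = l • w → W.E w = 0 → w ≠ 0 → x = y := fun W c w h1 h2 hH hE hw =>
    (s.eq_of_hasValue hw (hx W w hH hE) h1).trans (t.eq_of_hasValue hw (hy W w hH hE) h2).symm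
  by_cases h : (¬ ∃ n : ℤ, l - r + 1 = n) ∨ ∃ k : ℤ, l - r + 1 = k * r
  · refine key (WtMod.Vmod r (l - r + 1)) _ (hwTop _ _) (hs.V _ h) (ht.V _ h) ?_ (hw_E_top _ _)
      (hwVec_ne_zero (NeZero.pos r))
    refine (hw_H_top _ _).trans ?_
    congr 1
    ring
  · rw [not_or, not_not] at h
    obtain ⟨⟨n, hn⟩, hk⟩ := h
    have hr := NeZero.pos r
    -- The index i is the remainder of n - 1 modulo r. The value r - 1 would make n a multiple of r,
    -- which is excluded, so i ≤ r - 2.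
    have hne : (n - 1) % r + 1 ≠ r := by
      intro h1
      refine hk ⟨(n - 1) / r + 1, ?_⟩
      have h2 := Int.emod_add_mul_ediv (n - 1) r
      rw [hn]
      have : n = ((n - 1) / r + 1) * r := by linarith
      exact_mod_cast this
    have h1 := Int.emod_nonneg (n - 1) (b := r) (by omega)
    have h2 := Int.emod_lt_of_pos (n - 1) (b := r) (by omega)
    obtain ⟨i, hi⟩ := Int.eq_ofNat_of_zero_le h1
    have hir : i + 2 ≤ r := by omega
    have hl : l = i + (((n - 1) / r + 1 : ℤ) : ℂ) * r := by
      have h3 := Int.emod_add_mul_ediv (n - 1) r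
      have h4 : n + r - 1 = i + ((n - 1) / r + 1) * r := by linarith
      have h5 : (n : ℂ) + r - 1 = i + (((n - 1) / r + 1 : ℤ) : ℂ) * r := by exact_mod_cast h4
      linear_combination hn + h5
    have hw0 : WtMod.hwVec (i + 1) 0 ⊗ₜ[ℂ] WtMod.hwVec 1 0 ≠ 0 := by
      intro h3
      have h4 := congrArg (LinearMap.mul' ℂ ℂ ∘ₗ TensorProduct.map
        (LinearMap.proj (R := ℂ) (φ := fun _ => ℂ) (0 : Fin (i + 1)))
        (LinearMap.proj (R := ℂ) (φ := fun _ => ℂ) (0 : Fin 1))) h3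
      simp [WtMod.hwVec] at h4
    rcases Int.even_or_odd ((n - 1) / r + 1) with hp | hp
    · exact key _ _ (hwTop _ _ ⊗ₜ[ℂ] hwTop _ _) (hs.S_even i hir _ hp) (ht.S_even i hir _ hp)
        (hl ▸ tensor_hw_one_H _ _ _ (hw_H_top _ _)) (tensor_hw_one_E _ _ _ (hw_E_top _ _)) hw0
    · exact key _ _ (hwTop _ _ ⊗ₜ[ℂ] hwTop _ _) (hs.S_odd i hir (r - 2 - i) (by omega) _ hp)
        (ht.S_odd i hir (r - 2 - i) (by omega) _ hp)
        (hl ▸ tensor_hw_one_H _ _ _ (hw_H_top _ _)) (tensor_hw_one_E _ _ _ (hw_E_top _ _)) hw0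

/-- The two half twists commute and have the same square, so s = -t on the image of s - t. If that
image were nonzero, a maximal nonvanishing power of E applied to one of its weight vectors would
give a highest weight vector y, where also s y = t y; then t y = 0, contradicting invertibility. -/
theorem IsStandard.app_eq (V : WtMod r) : s.app V = t.app V := by
  refine WtMod.ext_weight fun μ w hw => ?_
  by_contra hne
  set u := s.app V w - t.app V w with hu
  have hu0 : u ≠ 0 := sub_ne_zero.2 hne
  have hu1 : s.app V u = -t.app V u := by
    rw [hu, map_sub, map_sub, app_app, app_app, s.app_comm t, neg_sub]
  have hu2 : V.H u = μ • u := by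
    rw [hu, map_sub, s.H_app hw, t.H_app hw, smul_sub]
  classical
  have hex : ∃ n, (V.E ^ n) u = 0 := ⟨r, by rw [V.E_pow, LinearMap.zero_apply]⟩
  obtain ⟨n, hn⟩ : ∃ n, Nat.find hex = n + 1 := Nat.exists_eq_succ_of_ne_zero fun h => hu0 <| by
    have := Nat.find_spec hex
    rwa [h, pow_zero] at this
  have hy0 : (V.E ^ n) u ≠ 0 := Nat.find_min hex (by omega)
  have hy1 : V.E ((V.E ^ n) u) = 0 := by
    have := Nat.find_spec hex
    rwa [hn, pow_succ', Module.End.mul_apply] at this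
  have h2 := IsStandard.app_eq_of_highest hs ht (WtMod.H_E_pow_apply hu2 n) hy1
  have h3 : s.app V ((V.E ^ n) u) = -t.app V ((V.E ^ n) u) := by
    rw [app_E_pow, app_E_pow, hu1, map_neg]
  refine hy0 ?_
  rw [h2, eq_neg_iff_add_eq_zero, ← map_add, ← two_smul ℂ, map_smul] at h3
  rw [← t.inv_app V ((V.E ^ n) u), (smul_eq_zero.1 h3).resolve_left two_ne_zero, map_zero]

end HalfTwist
end UnrolledSl2

end

open CategoryTheory TensorProduct
noncomputable section
namespace UnrolledSl2

variable {r : ℕ} [r.AtLeastTwo]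

/-! ### Closure under tensor products -/

open MonoidalCategory

theorem nonempty_listTensor_append (L M : List (WtMod r)) :
    Nonempty (listTensor L ⊗ listTensor M ≅ listTensor (L ++ M)) := by
  induction L with
  | nil => exact ⟨λ_ _⟩
  | cons X L ih =>
    obtain ⟨e⟩ := ih
    exact ⟨α_ X (listTensor L) (listTensor M) ≪≫ whiskerLeftIso X e⟩

theorem IsGeneratedRetract.tensor {X Y : WtMod r} (hX : IsGeneratedRetract X)
    (hY : IsGeneratedRetract Y) : IsGeneratedRetract (X ⊗ Y) := by
  obtain ⟨L, hL, ⟨ρ⟩⟩ := hX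
  obtain ⟨M, hM, ⟨σ⟩⟩ := hY
  obtain ⟨e⟩ := nonempty_listTensor_append L M
  refine ⟨L ++ M, fun Z hZ => (List.mem_append.1 hZ).elim (hL Z) (hM Z), ⟨?_⟩⟩
  exact
    { i := (ρ.i ⊗ₘ σ.i) ≫ e.hom
      r := e.inv ≫ (ρ.r ⊗ₘ σ.r)
      retract := by simp }

/-- The tensor product is biadditive, so tensor products of the inclusions and projections exhibit X
⊗ Y as the direct sum of the products of the summands. -/
theorem InD.tensor {X Y : WtMod r} (hX : InD X) (hY : InD Y) : InD (X.tensor Y) := by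
  obtain ⟨m, A, a, hA, ⟨ha⟩, ⟨e⟩⟩ := hX
  obtain ⟨n, B, b, hB, ⟨hb⟩, ⟨f⟩⟩ := hY
  let φ : Fin m × Fin n ≃ Fin (m * n) := finProdFinEquiv
  let c : Limits.Bicone fun k : Fin (m * n) => A (φ.symm k).1 ⊗ B (φ.symm k).2 :=
    { pt := a.pt ⊗ b.pt
      π := fun k => a.π _ ⊗ₘ b.π _
      ι := fun k => a.ι _ ⊗ₘ b.ι _
      ι_π := fun k l => by
        rw [tensorHom_comp_tensorHom]
        split_ifs with h
        · subst h
          simp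
        · have h1 : (φ.symm k).1 ≠ (φ.symm l).1 ∨ (φ.symm k).2 ≠ (φ.symm l).2 := by
            by_contra! h2
            exact h (φ.symm.injective (Prod.ext h2.1 h2.2))
          rcases h1 with h1 | h1
          · rw [Limits.bicone_ι_π_ne a h1, MonoidalCategory.tensorHom_def, MonoidalPreadditive.zero_whiskerRight,
              Limits.zero_comp]
          · rw [Limits.bicone_ι_π_ne b h1, MonoidalCategory.tensorHom_def, MonoidalPreadditive.whiskerLeft_zero,
              Limits.comp_zero] }
  refine ⟨m * n, _, c, fun k => (hA _).tensor (hB _), ⟨Limits.isBilimitOfTotal c ?_⟩,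
    ⟨e ⊗ᵢ f⟩⟩
  have h1 : ∑ k, c.π k ≫ c.ι k = ∑ p : Fin m × Fin n, (a.π p.1 ≫ a.ι p.1) ⊗ₘ (b.π p.2 ≫ b.ι p.2) := by
    rw [← φ.symm.sum_comp]
    exact Finset.sum_congr rfl fun k _ => tensorHom_comp_tensorHom _ _ _ _
  rw [h1, Fintype.sum_prod_type]
  simp_rw [← tensor_sum, ← sum_tensor]
  rw [Limits.IsBilimit.total ha, Limits.IsBilimit.total hb, id_tensorHom_id]

end UnrolledSl2

end

open CategoryTheory TensorProduct Polynomial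
noncomputable section
namespace UnrolledSl2

variable {r : ℕ}

/-! ### The twist as a polynomial in the Casimir operator -/

/-- The polynomial whose coefficients are conjugate to those of `drinfeldPoly`. -/
def drinfeldPolyInv (r : ℕ) (μ : ℂ) : ℂ[X] := ∑ n ∈ Finset.range r,
  C (rCoeffInv r n * qpow r ((μ + 2 * n) ^ 2 / 2)
    * ((-1) ^ n * qpow r (-(n * (μ + 2 * n) - n * (n + 1))))) * casPoly r n μ

/-- The polynomial in the Casimir operator by which the twist acts on vectors of weight `μ`. -/
def thetaPolyInv (r : ℕ) (μ : ℂ) : ℂ[X] := C (qpow r (-((r - 1 : ℕ) * μ))) * drinfeldPolyInv r μ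

theorem neg_E_Kinv_pow_apply {V : WtMod r} {μ : ℂ} {v : V} (hv : V.H v = μ • v) (n : ℕ) :
    ((-(V.E * V.Kinv)) ^ n) v = ((-1) ^ n * qpow r (-(n * μ) - n * (n - 1))) • (V.E ^ n) v := by
  induction n with
  | zero => simp [qpow_zero]
  | succ n ih =>
    have hE := WtMod.H_E_pow_apply hv n
    rw [pow_succ' (-(V.E * V.Kinv)), Module.End.mul_apply, ih, map_smul, LinearMap.neg_apply,
      Module.End.mul_apply, WtMod.Kinv_apply hE, map_smul, ← Module.End.mul_apply V.E, ← pow_succ',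
      ← neg_smul, smul_smul, pow_succ, mul_assoc, mul_neg, ← qpow_add]
    congr 1
    push_cast
    ring_nf

variable [r.AtLeastTwo]

theorem E_pow_F_pow_apply {V : WtMod r} {μ : ℂ} {v : V} (hv : V.H v = μ • v) (n : ℕ) :
    (V.E ^ n) ((V.F ^ n) v) = aeval V.cas (casPoly r n (-μ)) v := by
  induction n with
  | zero => simp [casPoly]
  | succ n ih =>
    -- The reflection a ↦ -2 - a turns the roots met when lowering from μ into those met when
    -- raising from -μ.
    have hc : casEig r (-μ + 2 * n) = casEig r (μ - 2 * n - 2) :=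
      (casEig_eq_iff _ _).2 (Or.inr ⟨0, by push_cast; ring⟩)
    rw [pow_succ V.E, Module.End.mul_apply, pow_succ' V.F, Module.End.mul_apply,
      WtMod.E_F_apply (WtMod.H_F_pow_apply hv n), map_sub, map_smul, WtMod.E_pow_comm_cas, ih,
      casPoly_succ, mul_comm _ (_ - _), map_mul, Module.End.mul_apply, map_sub, aeval_X, aeval_C,
      LinearMap.sub_apply, Module.algebraMap_end_apply, hc]

omit [r.AtLeastTwo] in
theorem dual_E_pow_apply (V : WtMod r) (f : Module.Dual ℂ V) (n : ℕ) (v : V) :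
    (show Module.Dual ℂ V from (V.dual.E ^ n) f) v = f (((-(V.E * V.Kinv)) ^ n) v) := by
  have h : V.dual.E ^ n = WtMod.tr ((-(V.E * V.Kinv)) ^ n) := WtMod.tr_pow _ n
  rw [h]
  rfl

/-- Evaluation after R⁻¹ on V* ⊗ V produces a polynomial in C whose coefficients are, up to
conjugation, those of `drinfeldPoly`. It plays for the inverse braiding the part of the Drinfeld
operator. -/
theorem contractLeft_rMatrixInv (V : WtMod r) {a : ℂ} {v : V} (hv : V.H v = a • v)
    (f : Module.Dual ℂ V) : contractLeft ℂ V (rMatrixInv V.dual V (f ⊗ₜ v))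
      = f (aeval V.cas (drinfeldPolyInv r (-a)) v) := by
  let P : V.dual →ₗ[ℂ] ℂ :=
    contractLeft ℂ V ∘ₗ rMatrixInv V.dual V ∘ₗ (TensorProduct.mk ℂ V.dual V).flip v
  let Q : V.dual →ₗ[ℂ] ℂ := Module.Dual.eval ℂ V (aeval V.cas (drinfeldPolyInv r (-a)) v)
  have h : P = Q := by
    refine WtMod.ext_weight fun b f hf => ?_
    change contractLeft ℂ V (rMatrixInv V.dual V (f ⊗ₜ v))
      = (show Module.Dual ℂ V from f) (aeval V.cas (drinfeldPolyInv r (-a)) v)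
    have h1 : rMatrixInv V.dual V (f ⊗ₜ v) = ∑ n ∈ Finset.range r,
        (rCoeffInv r n * qpow r (-(b * a / 2))) • ((V.dual.E ^ n) f ⊗ₜ[ℂ] (V.F ^ n) v) := by
      rw [rMatrixInv, Module.End.mul_apply, qHHInv_tmul V.dual V hf hv, map_smul,
        LinearMap.sum_apply, Finset.smul_sum]
      refine Finset.sum_congr rfl fun n _ => ?_
      rw [LinearMap.smul_apply, map_tmul, smul_smul, mul_comm]
    rw [h1, drinfeldPolyInv, map_sum, LinearMap.sum_apply, map_sum]
    refine (map_sum (contractLeft ℂ V) _ _).trans (Finset.sum_congr rfl fun n _ => ?_)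
    refine ((contractLeft ℂ V).map_smul _ _).trans ?_
    have h2 : contractLeft ℂ V ((V.dual.E ^ n) f ⊗ₜ[ℂ] (V.F ^ n) v)
      = (show Module.Dual ℂ V from f) (((-(V.E * V.Kinv)) ^ n) ((V.F ^ n) v)) :=
      dual_E_pow_apply V f n _
    refine (congrArg (fun t : ℂ => (rCoeffInv r n * qpow r (-(b * a / 2))) • t) h2).trans ?_
    rw [neg_E_Kinv_pow_apply (WtMod.H_F_pow_apply hv n), E_pow_F_pow_apply hv, map_mul, aeval_C,
      Module.End.mul_apply, Module.algebraMap_end_apply, map_smul, map_smul, smul_smul]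
    by_cases hab : a + b = 0
    · rw [eq_neg_of_add_eq_zero_right hab, mul_assoc, mul_assoc]
      congr 2
      rw [mul_left_comm, mul_left_comm (qpow r _), ← qpow_add, ← qpow_add]
      congr 2
      ring
    · rw [dual_weight_apply (WtMod.H_aeval_cas hv _) hf hab, smul_zero, smul_zero]
  exact LinearMap.congr_fun h f

theorem thetaOp_unit : thetaOp (WtMod.unit r) = 1 := by
  refine LinearMap.ext fun v => ?_
  refine (thetaOp_apply_of_E_eq_zero (l := 0) (by rw [zero_smul]; rfl) rfl).trans ?_
  rw [show (((r : ℂ) - 1) ^ 2 - (0 - r + 1) ^ 2) / 2 = 0 by ring, qpow_zero, one_smul]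
  rfl

open MonoidalCategory in
-- Naturality of `thetaOp` is applied to evaluation ∘ (inverse braiding) : V ⊗ V* → 𝟙. As `thetaOp`
-- is trivial on the unit, balancing on V ⊗ V* converts the inverse braiding after θ⁻¹ ⊗ θ⁻¹ into
-- the braiding.
theorem contractLeft_rMatrixInv_thetaOp (V : WtMod r) (v : V) (f : Module.Dual ℂ V) :
    contractLeft ℂ V (rMatrixInv V.dual V ((thetaOp V.dual f) ⊗ₜ (thetaOp V v)))
      = f (drinfeldOp V v) := by
  let e : V ⊗ V.dual ⟶ 𝟙_ (WtMod r) := (β_ V.dual V).inv ≫ evalHom V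
  let y : V ⊗[ℂ] V.dual := v ⊗ₜ[ℂ] (show V.dual from f)
  have h1 : unitLin e (thetaOp (V.tensor V.dual) (braiding V.dual V (braiding V V.dual y)))
      = contractLeft ℂ V (rMatrixInv V.dual V ((thetaOp V.dual f) ⊗ₜ (thetaOp V v))) :=
    congrArg (unitLin e) (thetaOp_tensor V V.dual y)
  have h2 : unitLin e (thetaOp (V.tensor V.dual) (braiding V.dual V (braiding V V.dual y)))
      = unitLin e (braiding V.dual V (braiding V V.dual y)) := by
    refine (lin_thetaOp e _).trans ?_
    exact LinearMap.congr_fun thetaOp_unit _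
  have h3 : unitLin e (braiding V.dual V (braiding V V.dual y))
      = contractLeft ℂ V (braiding V V.dual y) :=
    congrArg (contractLeft ℂ V) ((braidingEquiv V.dual V).symm_apply_apply (braiding V V.dual y))
  rw [← h1, h2, h3]
  exact contractLeft_braiding V v f

theorem thetaOp_injective (V : WtMod r) : Function.Injective (thetaOp V) := by
  refine Function.LeftInverse.injective (g := sqrtTwist V * sqrtTwist V) fun v => ?_
  exact LinearMap.congr_fun (mul_eq_one_comm.1 (thetaOp_mul_sqrtTwist_mul_sqrtTwist V)) v

theorem thetaOp_aeval_cas (V : WtMod r) (p : ℂ[X]) (v : V) :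
    thetaOp V (aeval V.cas p v) = aeval V.cas p (thetaOp V v) :=
  lin_aeval_cas (WtMod.ofLin _ (thetaOp_mem_homs V)) p v

/-- Both sides agree after applying `thetaOp`: the functional on V* ⊗ V moves one `thetaOp` across
by duality, and the powers of K account for the scalar in front. -/
theorem aeval_thetaPolyInv_neg {V : WtMod r} {a : ℂ} {v : V} (hv : V.H v = a • v) :
    aeval V.cas (thetaPolyInv r (-a)) (thetaOp V v) = v := by
  have hT := WtMod.lin_weight (WtMod.ofLin _ (thetaOp_mem_homs V)) hv
  have h1 : thetaOp V (aeval V.cas (drinfeldPolyInv r (-a)) (thetaOp V v)) = drinfeldOp V v := by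
    refine sub_eq_zero.1 ((Module.forall_dual_apply_eq_zero_iff ℂ _).1 fun f => ?_)
    rw [map_sub, ← contractLeft_rMatrixInv_thetaOp V v f]
    refine sub_eq_zero.2 (Eq.symm ((contractLeft_rMatrixInv V hT (thetaOp V.dual f)).trans ?_))
    exact LinearMap.congr_fun (LinearMap.congr_fun (thetaOp_dual V) f) _
  refine thetaOp_injective V ?_
  have hu : V.H (drinfeldOp V v) = a • drinfeldOp V v := by
    rw [drinfeldOp_eq_aeval hv]
    exact WtMod.H_aeval_cas hv _
  have h2 : thetaOp V v = qpow r ((r - 1 : ℕ) * a) • drinfeldOp V v := by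
    rw [thetaOp_eq, Module.End.mul_apply, K_pow_apply hu]
  rw [thetaPolyInv, map_mul, aeval_C, Module.End.mul_apply, Module.algebraMap_end_apply, map_smul,
    h1, h2, mul_neg, neg_neg]

/-- The previous statement on the dual module, where weights have the opposite sign, transposed back
to V. -/
theorem aeval_thetaPolyInv {V : WtMod r} {a : ℂ} {v : V} (hv : V.H v = a • v) :
    aeval V.cas (thetaPolyInv r a) (thetaOp V v) = v := by
  have hT : V.H (thetaOp V v) = a • thetaOp V v :=
    WtMod.lin_weight (WtMod.ofLin _ (thetaOp_mem_homs V)) hv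
  refine sub_eq_zero.1 ((Module.forall_dual_apply_eq_zero_iff ℂ _).1 fun f => ?_)
  refine LinearMap.congr_fun (WtMod.ext_weight (V := V.dual) (M := ℂ)
    (f := Module.Dual.eval ℂ V (aeval V.cas (thetaPolyInv r a) (thetaOp V v) - v)) (g := 0)
    fun b (f : Module.Dual ℂ V) hf => ?_) f
  change f (aeval V.cas (thetaPolyInv r a) (thetaOp V v) - v) = 0
  rw [map_sub, sub_eq_zero]
  by_cases hab : a + b = 0
  · have h := LinearMap.congr_fun (aeval_thetaPolyInv_neg (V := V.dual) hf) v
    rw [aeval_cas_dual, thetaOp_dual, eq_neg_of_add_eq_zero_right hab, neg_neg] at h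
    rw [← thetaOp_aeval_cas]
    exact h
  · rw [dual_weight_apply hv hf hab, dual_weight_apply (WtMod.H_aeval_cas hT _) hf hab]

end UnrolledSl2

end

open CategoryTheory TensorProduct Polynomial
noncomputable section
namespace UnrolledSl2

variable {r : ℕ}

/-! ### Complex conjugation -/

local notation "conj" => starRingEnd ℂ

theorem conj_qpow (r : ℕ) (x : ℂ) : conj (qpow r x) = qpow r (-conj x) := by
  rw [qpow, qpow, ← Complex.exp_conj]
  congr 1
  simp

theorem conj_qbr (r : ℕ) (x : ℂ) : conj (qbr r x) = -qbr r (conj x) := by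
  rw [qbr, qbr, map_sub, conj_qpow, conj_qpow, map_neg, neg_neg, neg_sub]

theorem conj_casEig (r : ℕ) (l : ℂ) : conj (casEig r l) = casEig r (conj l) := by
  simp only [casEig, map_div₀, map_add, map_pow, conj_qpow, conj_qbr, map_neg, map_one, neg_neg,
    neg_sq]
  rw [add_comm]

/-- Each factor {k} is purely imaginary. The even power of {1} is therefore fixed, {n}! gains
(-1)^n, and the power of q is inverted. -/
theorem conj_rCoeff (r n : ℕ) : conj (rCoeff r n) = rCoeffInv r n := by
  have h : conj (qfact r n) = (-1) ^ n * qfact r n := by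
    simp only [qfact, map_prod, conj_qbr, map_add, map_natCast, map_one]
    rw [Finset.prod_neg]
    simp
  have h2 : ((-1 : ℂ) ^ n)⁻¹ = (-1) ^ n := by rw [← inv_pow, inv_neg, inv_one]
  have h3 : conj ((n : ℂ) * ((n : ℂ) - 1) / 2) = (n : ℂ) * ((n : ℂ) - 1) / 2 := by
    simp [Complex.conj_ofNat]
  rw [rCoeff, rCoeffInv, map_mul, map_div₀, map_pow, conj_qbr, map_one, conj_qpow, h, h3,
    Even.neg_pow (even_two_mul n), div_mul_eq_div_div, div_eq_mul_inv _ ((-1 : ℂ) ^ n), h2]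
  ring

theorem map_conj_casPoly (r n : ℕ) (μ : ℂ) : (casPoly r n μ).map conj = casPoly r n (conj μ) := by
  simp only [casPoly, Polynomial.map_prod, Polynomial.map_sub, map_X, map_C, conj_casEig, map_add,
    map_mul, map_natCast, Complex.conj_ofNat]

theorem map_conj_thetaPoly (r : ℕ) (μ : ℂ) :
    (thetaPoly r μ).map conj = thetaPolyInv r (conj μ) := by
  have h0 (n : ℕ) : conj (μ + 2 * n) = conj μ + 2 * n := by simp [Complex.conj_ofNat]
  have h1 : (drinfeldPoly r μ).map conj = drinfeldPolyInv r (conj μ) := by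
    rw [drinfeldPoly, drinfeldPolyInv, Polynomial.map_sum]
    refine Finset.sum_congr rfl fun n _ => ?_
    have e1 : -conj (-(μ + 2 * n) ^ 2 / 2) = (conj μ + 2 * n) ^ 2 / 2 := by
      rw [map_div₀, map_neg, map_pow, h0, Complex.conj_ofNat, neg_div, neg_neg]
    have e2 : -conj (n * (μ + 2 * n) - n * (n + 1))
        = -(n * (conj μ + 2 * n) - n * (n + 1)) := by
      rw [map_sub, map_mul, h0, map_mul, map_add, map_natCast, map_one]
    rw [Polynomial.map_mul, map_C, map_conj_casPoly]
    refine congrArg (fun x => C x * casPoly r n (conj μ)) ?_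
    rw [map_mul, map_mul, map_mul, conj_rCoeff, conj_qpow, conj_qpow, e1, e2, map_pow, map_neg,
      map_one]
  rw [thetaPoly, thetaPolyInv, Polynomial.map_mul, map_C, conj_qpow, h1, map_mul, map_natCast]

theorem conj_typicalRep (α : ℂ) : conj (typicalRep r α) = typicalRep r (conj α) := by
  by_cases h : ∃ n : ℤ, α = n ∧ ¬ (r : ℤ) ∣ n
  · obtain ⟨n, rfl, hn⟩ := h
    rw [map_intCast, typicalRep_intCast hn, map_intCast]
  · have h' : ¬ ∃ n : ℤ, conj α = n ∧ ¬ (r : ℤ) ∣ n := by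
      rintro ⟨n, hn, h1⟩
      refine h ⟨n, ?_, h1⟩
      rw [← Complex.conj_conj α, hn, map_intCast]
    rw [typicalRep_of_not h, typicalRep_of_not h']

theorem conj_halfTwistVal_mul (α : ℂ) :
    conj (halfTwistVal r α) * halfTwistVal r (conj α) = 1 := by
  rw [halfTwistVal, halfTwistVal, conj_qpow, ← conj_typicalRep, ← qpow_add]
  simp [qpow_zero, Complex.conj_ofNat]

theorem conj_blockVal_mul [r.AtLeastTwo] (μ : ℂ) {j : ℕ} (hj : j < r) :
    conj (blockVal r μ (casEig r (μ + 2 * j)))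
      * blockVal r (conj μ) (conj (casEig r (μ + 2 * j))) = 1 := by
  have h : conj (μ + 2 * j) = conj μ + 2 * j := by simp [Complex.conj_ofNat]
  have h2 : conj (μ + 2 * j - r + 1) = conj μ + 2 * j - r + 1 := by simp [Complex.conj_ofNat]
  rw [conj_casEig, h, blockVal_casEig _ hj, blockVal_casEig _ hj, ← h2, conj_halfTwistVal_mul]

/-! ### Contravariant pairings -/

/-- Sesquilinear pairings compatible with the anti-involution `E ↦ F`, `F ↦ E`, `H ↦ H`. -/
structure IsContravariant {A B : WtMod r} (φ : A →ₗ⋆[ℂ] B →ₗ[ℂ] ℂ) : Prop where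
  E : ∀ a b, φ (A.F a) b = φ a (B.E b)
  F : ∀ a b, φ (A.E a) b = φ a (B.F b)
  H : ∀ a b, φ (A.H a) b = φ a (B.H b)

namespace IsContravariant

variable {A B : WtMod r}

theorem ext_weight₂ {φ ψ : A →ₗ⋆[ℂ] B →ₗ[ℂ] ℂ}
    (h : ∀ (μ ν : ℂ) (a : A) (b : B), A.H a = μ • a → B.H b = ν • b → φ a b = ψ a b) : φ = ψ :=
  WtMod.ext_weight_conj fun μ a ha => WtMod.ext_weight fun ν b hb => h μ ν a b ha hb

variable {φ : A →ₗ⋆[ℂ] B →ₗ[ℂ] ℂ} (hφ : IsContravariant φ)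
include hφ

theorem eq_zero_of_weight {μ ν : ℂ} {a : A} {b : B} (ha : A.H a = μ • a) (hb : B.H b = ν • b)
    (h : conj μ ≠ ν) : φ a b = 0 := by
  have h1 := hφ.H a b
  rw [ha, hb, LinearMap.map_smulₛₗ₂, map_smul, smul_eq_mul, smul_eq_mul, ← sub_eq_zero, ← sub_mul] at h1
  exact (mul_eq_zero.1 h1).resolve_left (sub_ne_zero.2 h)

theorem cas (a : A) (b : B) : φ (A.cas a) b = φ a (B.cas b) := by
  refine LinearMap.congr_fun₂ (ext_weight₂ (φ := φ.comp A.cas) (ψ := φ.compl₂ B.cas)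
    fun μ ν a b ha hb => ?_) a b
  rw [LinearMap.comp_apply, LinearMap.compl₂_apply, WtMod.cas_apply ha, WtMod.cas_apply hb, map_add,
    LinearMap.add_apply, map_add, hφ.E, hφ.F, LinearMap.map_smulₛₗ₂, map_smul, conj_casEig]
  congr 1
  -- Vectors pair to zero unless their weights are conjugate, in which case the Casimir scalars
  -- match and F E is self-adjoint.
  by_cases h : conj μ = ν
  · rw [h]
  · rw [hφ.eq_zero_of_weight ha hb h, smul_zero, smul_zero]

theorem aeval_cas (p : ℂ[X]) (a : A) (b : B) :
    φ (aeval A.cas p a) b = φ a (aeval B.cas (p.map conj) b) := by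
  induction p using Polynomial.induction_on' with
  | add p q hp hq => simp only [map_add, LinearMap.add_apply, Polynomial.map_add, hp, hq]
  | monomial n c =>
    have hn : ∀ (n : ℕ) (a : A), φ ((A.cas ^ n) a) b = φ a ((B.cas ^ n) b) := by
      intro n
      induction n with
      | zero => intro a; rfl
      | succ n ih =>
        intro a
        rw [pow_succ, Module.End.mul_apply, ih, hφ.cas, pow_succ', Module.End.mul_apply]
    rw [map_monomial, aeval_monomial, aeval_monomial, Module.End.mul_apply, Module.End.mul_apply,
      Module.algebraMap_end_apply, Module.algebraMap_end_apply, LinearMap.map_smulₛₗ₂, map_smul, hn]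

theorem eq_zero_of_isBlockVec {μ ν c d : ℂ} {a : A} {b : B} (ha : A.IsBlockVec μ c a)
    (hb : B.IsBlockVec ν d b) (h : conj c ≠ d) : φ a b = 0 := by
  refine eq_zero_of_coprime_functional (φ := φ a) (isCoprime_sq h.symm) hb.2 fun w => ?_
  have h2 : ((X - C (conj c)) ^ 2 : ℂ[X]) = ((X - C c) ^ 2).map conj := by simp
  rw [h2, ← hφ.aeval_cas, ha.2, map_zero, LinearMap.zero_apply]

variable [r.AtLeastTwo]

/-- Moving the polynomial in C across the pairing conjugates its coefficients and gives
`thetaPolyInv`, which cancels `thetaOp` on the other side. -/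
theorem thetaOp (a : A) (b : B) : φ (thetaOp A a) (thetaOp B b) = φ a b := by
  refine LinearMap.congr_fun₂ (ext_weight₂ (φ := (φ.comp (UnrolledSl2.thetaOp A)).compl₂
    (UnrolledSl2.thetaOp B)) (ψ := φ) fun μ ν a b ha hb => ?_) a b
  rw [LinearMap.compl₂_apply, LinearMap.comp_apply, thetaOp_apply ha, hφ.aeval_cas,
    map_conj_thetaPoly]
  by_cases h : conj μ = ν
  · rw [h, aeval_thetaPolyInv hb]
  · have hb' : B.H (UnrolledSl2.thetaOp B b) = ν • UnrolledSl2.thetaOp B b :=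
      WtMod.lin_weight (WtMod.ofLin _ (thetaOp_mem_homs B)) hb
    rw [hφ.eq_zero_of_weight ha hb h, hφ.eq_zero_of_weight ha (WtMod.H_aeval_cas hb' _) h]

/-- Only blocks with conjugate weight and Casimir eigenvalue pair nontrivially. There the block
values are inverse up to conjugation, and unitarity of `thetaOp` reduces the claim to algebra in
φ(a, b), φ(a, θ⁻¹b) and φ(θ⁻¹a, b). -/
theorem sqrtTwist (a : A) (b : B) : φ (sqrtTwist A a) (sqrtTwist B b) = φ a b := by
  have key : (φ.comp (UnrolledSl2.sqrtTwist A)).compl₂ (UnrolledSl2.sqrtTwist B) = φ := by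
    refine WtMod.ext_blockVec_conj fun μ c a ha => WtMod.ext_blockVec fun ν d b hb => ?_
    rw [LinearMap.compl₂_apply, LinearMap.comp_apply]
    have ha2 : A.IsBlockVec μ c (UnrolledSl2.sqrtTwist A a) :=
      lin_isBlockVec (WtMod.ofLin _ (sqrtTwist_mem_homs A)) ha
    have hb2 : B.IsBlockVec ν d (UnrolledSl2.sqrtTwist B b) :=
      lin_isBlockVec (WtMod.ofLin _ (sqrtTwist_mem_homs B)) hb
    by_cases h : conj μ = ν
    swap
    · rw [hφ.eq_zero_of_weight ha.1 hb.1 h, hφ.eq_zero_of_weight ha2.1 hb2.1 h]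
    by_cases hc : conj c = d
    swap
    · rw [hφ.eq_zero_of_isBlockVec ha hb hc, hφ.eq_zero_of_isBlockVec ha2 hb2 hc]
    rcases eq_or_ne a 0 with rfl | h0
    · simp
    obtain ⟨j, hj, rfl⟩ := WtMod.exists_casEig_of_isBlockVec ha h0
    have hu := conj_blockVal_mul (r := r) μ hj
    rw [h, hc] at hu
    have e1 := hφ.thetaOp a b
    have e2 := hφ.thetaOp a (UnrolledSl2.thetaOp B b)
    -- The quadratic relation for `thetaOp` on b expresses φ(θ⁻¹a, b) through φ(a, b) and φ(a,
    -- θ⁻¹b), where θ⁻¹ stands for `thetaOp`.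
    rw [sq_thetaOp_apply hb, map_sub, map_smul, map_smul, e1, smul_eq_mul, smul_eq_mul] at e2
    rw [sqrtTwist_apply ha, sqrtTwist_apply hb]
    simp only [map_sub, LinearMap.sub_apply, LinearMap.map_smulₛₗ₂, map_smul, smul_eq_mul, e1,
      map_mul, map_div₀, map_pow, map_one, Complex.conj_ofNat]
    have hy : blockVal r ν d ≠ 0 := blockVal_ne_zero _ _
    rw [eq_inv_of_mul_eq_one_left hu]
    generalize blockVal r ν d = y at *
    field_simp at e2 ⊢
    linear_combination 3 * e2
  exact LinearMap.congr_fun₂ key a b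

end IsContravariant

end UnrolledSl2

end

open CategoryTheory TensorProduct Polynomial
noncomputable section
namespace UnrolledSl2

variable {r : ℕ}

local notation "conj" => starRingEnd ℂ

/-! ### The product pairing -/

section FlipPairing

variable {A A' B B' : WtMod r}

/-- The pairing `(a ⊗ a', b' ⊗ b) ↦ φ(a, b) ψ(a', b')`. -/
def flipPairing (φ : A →ₗ⋆[ℂ] B →ₗ[ℂ] ℂ) (ψ : A' →ₗ⋆[ℂ] B' →ₗ[ℂ] ℂ) :
    A ⊗[ℂ] A' →ₗ⋆[ℂ] B' ⊗[ℂ] B →ₗ[ℂ] ℂ :=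
  ((TensorProduct.dualDistrib ℂ B B').comp (TensorProduct.map φ ψ)).compl₂
    (TensorProduct.comm ℂ B' B).toLinearMap

variable (φ : A →ₗ⋆[ℂ] B →ₗ[ℂ] ℂ) (ψ : A' →ₗ⋆[ℂ] B' →ₗ[ℂ] ℂ)

theorem flipPairing_tmul (a : A) (a' : A') (b : B) (b' : B') :
    flipPairing φ ψ (a ⊗ₜ a') (b' ⊗ₜ b) = φ a b * ψ a' b' := rfl

theorem flipPairing_ext {M M' N N' : WtMod r} {f g : M ⊗[ℂ] M' →ₗ⋆[ℂ] N' ⊗[ℂ] N →ₗ[ℂ] ℂ}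
    (h : ∀ (μ μ' ν ν' : ℂ) (m : M) (m' : M') (n : N) (n' : N'), M.H m = μ • m → M'.H m' = μ' • m' →
      N.H n = ν • n → N'.H n' = ν' • n' → f (m ⊗ₜ m') (n' ⊗ₜ n) = g (m ⊗ₜ m') (n' ⊗ₜ n)) :
    f = g :=
  WtMod.tensor_ext_weight_conj fun μ μ' m m' hm hm' =>
    WtMod.tensor_ext_weight fun ν' ν n' n hn' hn => h μ μ' ν ν' m m' n n' hm hm' hn hn'

theorem flipPairing_comm (x : A ⊗[ℂ] A') (y : B' ⊗[ℂ] B) :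
    flipPairing ψ φ (TensorProduct.comm ℂ A A' x) (TensorProduct.comm ℂ B' B y)
      = flipPairing φ ψ x y := by
  refine LinearMap.congr_fun₂ (flipPairing_ext (f := ((flipPairing ψ φ).comp
    (TensorProduct.comm ℂ A A').toLinearMap).compl₂ (TensorProduct.comm ℂ B' B).toLinearMap)
    (g := flipPairing φ ψ) fun _ _ _ _ a a' b b' _ _ _ _ => ?_) x y
  exact mul_comm (ψ a' b') (φ a b)

theorem flipPairing_map {C D C' D' : WtMod r} (f : C →ₗ[ℂ] A) (g : D →ₗ[ℂ] B) (f' : C' →ₗ[ℂ] A')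
    (g' : D' →ₗ[ℂ] B') (x : C ⊗[ℂ] C') (y : D' ⊗[ℂ] D) :
    flipPairing φ ψ (TensorProduct.map f f' x) (TensorProduct.map g' g y)
      = flipPairing ((φ.comp f).compl₂ g) ((ψ.comp f').compl₂ g') x y := by
  refine LinearMap.congr_fun₂ (flipPairing_ext (f := ((flipPairing φ ψ).comp
    (TensorProduct.map f f')).compl₂ (TensorProduct.map g' g))
    (g := flipPairing ((φ.comp f).compl₂ g) ((ψ.comp f').compl₂ g'))
    fun _ _ _ _ a a' b b' _ _ _ _ => rfl) x y

namespace IsContravariant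

variable {φ ψ} (hφ : IsContravariant φ) (hψ : IsContravariant ψ)

include hφ

theorem K (a : A) (b : B) : φ (A.K a) b = φ a (B.Kinv b) := by
  refine LinearMap.congr_fun₂ (ext_weight₂ (φ := φ.comp A.K) (ψ := φ.compl₂ B.Kinv)
    fun μ ν a b ha hb => ?_) a b
  rw [LinearMap.comp_apply, LinearMap.compl₂_apply, A.K_eq _ _ ha, WtMod.Kinv_apply hb,
    LinearMap.map_smulₛₗ₂, map_smul, conj_qpow]
  by_cases h : conj μ = ν
  · rw [h]
  · rw [hφ.eq_zero_of_weight ha hb h, smul_zero, smul_zero]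

theorem Kinv (a : A) (b : B) : φ (A.Kinv a) b = φ a (B.K b) := by
  have h := hφ.K (A.Kinv a) (B.K b)
  rw [← Module.End.mul_apply, ← Module.End.mul_apply, A.K_Kinv, B.Kinv_K, Module.End.one_apply,
    Module.End.one_apply] at h
  exact h.symm

include hψ

/-- On vectors that pair nontrivially the weights on the two sides are conjugate, and conjugation
inverts q, so the two scalars cancel. -/
theorem flipPairing_qHH (x : A ⊗[ℂ] A') (y : B' ⊗[ℂ] B) :
    UnrolledSl2.flipPairing φ ψ (qHH A A' x) (qHH B' B y) = UnrolledSl2.flipPairing φ ψ x y := by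
  refine LinearMap.congr_fun₂ (flipPairing_ext (f := ((UnrolledSl2.flipPairing φ ψ).comp
    (qHH A A')).compl₂ (qHH B' B)) (g := UnrolledSl2.flipPairing φ ψ)
    fun μ μ' ν ν' a a' b b' ha ha' hb hb' => ?_) x y
  rw [LinearMap.compl₂_apply, LinearMap.comp_apply, qHH_tmul A A' ha ha', qHH_tmul B' B hb' hb,
    LinearMap.map_smulₛₗ₂, map_smul, flipPairing_tmul, conj_qpow, smul_smul, ← qpow_add]
  by_cases h : conj μ = ν
  swap
  · rw [hφ.eq_zero_of_weight ha hb h, zero_mul, smul_zero]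
  by_cases h' : conj μ' = ν'
  swap
  · rw [hψ.eq_zero_of_weight ha' hb' h', mul_zero, smul_zero]
  have e : -conj (μ * μ' / 2) + ν' * ν / 2 = 0 := by
    rw [map_div₀, map_mul, h, h', Complex.conj_ofNat]
    ring
  rw [e, qpow_zero, one_smul]

theorem flipPairing_sum (x : A ⊗[ℂ] A') (y : B' ⊗[ℂ] B) :
    UnrolledSl2.flipPairing φ ψ ((∑ n ∈ Finset.range r,
        rCoeff r n • TensorProduct.map (A.E ^ n) (A'.F ^ n)) x) y
      = UnrolledSl2.flipPairing φ ψ x ((∑ n ∈ Finset.range r,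
        rCoeffInv r n • TensorProduct.map (B'.E ^ n) (B.F ^ n)) y) := by
  have hF : ∀ (n : ℕ) (a : A) (b : B), φ ((A.E ^ n) a) b = φ a ((B.F ^ n) b) := by
    intro n
    induction n with
    | zero => intro a b; rfl
    | succ n ih =>
      intro a b
      rw [pow_succ, Module.End.mul_apply, ih, hφ.F, pow_succ', Module.End.mul_apply]
  have hE : ∀ (n : ℕ) (a : A') (b : B'), ψ ((A'.F ^ n) a) b = ψ a ((B'.E ^ n) b) := by
    intro n
    induction n with
    | zero => intro a b; rfl
    | succ n ih =>
      intro a b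
      rw [pow_succ, Module.End.mul_apply, ih, hψ.E, pow_succ', Module.End.mul_apply]
  rw [LinearMap.sum_apply, LinearMap.sum_apply, map_sum, map_sum, LinearMap.sum_apply]
  refine Finset.sum_congr rfl fun n _ => ?_
  rw [LinearMap.smul_apply, LinearMap.smul_apply, LinearMap.map_smulₛₗ₂, map_smul, conj_rCoeff]
  congr 1
  refine LinearMap.congr_fun₂ (flipPairing_ext (f := (UnrolledSl2.flipPairing φ ψ).comp
    (TensorProduct.map (A.E ^ n) (A'.F ^ n))) (g := (UnrolledSl2.flipPairing φ ψ).compl₂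
    (TensorProduct.map (B'.E ^ n) (B.F ^ n))) fun _ _ _ _ a a' b b' _ _ _ _ => ?_) x y
  rw [LinearMap.compl₂_apply, LinearMap.comp_apply, TensorProduct.map_tmul, TensorProduct.map_tmul,
    flipPairing_tmul, flipPairing_tmul, hF, hE]

variable [r.AtLeastTwo]

/-- The adjoint of K⁻¹ ⊗ F + F ⊗ 1 taken factorwise is K ⊗ E + E ⊗ 1, which is Δ(E) only after
exchanging the factors. This is why the second argument lies in B' ⊗ B. -/
theorem flipPairing : IsContravariant (A := A.tensor A') (B := B'.tensor B)
    (flipPairing φ ψ) where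
  E x y := by
    refine LinearMap.congr_fun₂ (flipPairing_ext (f := (UnrolledSl2.flipPairing φ ψ).comp
      (WtMod.tensorF A A')) (g := (UnrolledSl2.flipPairing φ ψ).compl₂ (WtMod.tensorE B' B))
      fun _ _ _ _ a a' b b' _ _ _ _ => ?_) x y
    simp only [LinearMap.comp_apply, LinearMap.compl₂_apply, WtMod.tensorF, WtMod.tensorE,
      LinearMap.add_apply, TensorProduct.map_tmul, Module.End.one_apply, map_add,
      flipPairing_tmul, hφ.E, hψ.E, hφ.Kinv]
    ring
  F x y := by
    refine LinearMap.congr_fun₂ (flipPairing_ext (f := (UnrolledSl2.flipPairing φ ψ).comp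
      (WtMod.tensorE A A')) (g := (UnrolledSl2.flipPairing φ ψ).compl₂ (WtMod.tensorF B' B))
      fun _ _ _ _ a a' b b' _ _ _ _ => ?_) x y
    simp only [LinearMap.comp_apply, LinearMap.compl₂_apply, WtMod.tensorF, WtMod.tensorE,
      LinearMap.add_apply, TensorProduct.map_tmul, Module.End.one_apply, map_add,
      flipPairing_tmul, hφ.F, hψ.F, hψ.K]
    ring
  H x y := by
    refine LinearMap.congr_fun₂ (flipPairing_ext (f := (UnrolledSl2.flipPairing φ ψ).comp
      (WtMod.tensorH A A')) (g := (UnrolledSl2.flipPairing φ ψ).compl₂ (WtMod.tensorH B' B))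
      fun _ _ _ _ a a' b b' _ _ _ _ => ?_) x y
    simp only [LinearMap.comp_apply, LinearMap.compl₂_apply, WtMod.tensorH,
      LinearMap.add_apply, TensorProduct.map_tmul, Module.End.one_apply, map_add,
      flipPairing_tmul, hφ.H, hψ.H]
    ring

/-- The adjoint of the quasi R-matrix has conjugated coefficients and E, F exchanged; after the flip
it is the inverse of the quasi R-matrix of B' ⊗ B. -/
theorem flipPairing_rMatrix (x : A ⊗[ℂ] A') (y : B' ⊗[ℂ] B) :
    UnrolledSl2.flipPairing φ ψ (rMatrix A A' x) (rMatrix B' B y)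
      = UnrolledSl2.flipPairing φ ψ x y := by
  have h := sum_rCoeffInv_sum_rCoeff (NeZero.ne r) (map_E_F_pow B' B)
  simp only [TensorProduct.map_pow] at h
  rw [rMatrix, rMatrix, Module.End.mul_apply, Module.End.mul_apply, hφ.flipPairing_qHH hψ,
    hφ.flipPairing_sum hψ, ← Module.End.mul_apply, h, Module.End.one_apply]

theorem flipPairing_braiding (x : A ⊗[ℂ] A') (y : B' ⊗[ℂ] B) :
    UnrolledSl2.flipPairing ψ φ (braiding A A' x) (braiding B' B y)
      = UnrolledSl2.flipPairing φ ψ x y :=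
  (flipPairing_comm φ ψ _ _).trans (hφ.flipPairing_rMatrix hψ x y)

theorem flipPairing_X {s : HalfTwist r} (hs : s.IsStandard) (x : A ⊗[ℂ] A') (y : B' ⊗[ℂ] B) :
    UnrolledSl2.flipPairing ψ φ (s.X A A' x) (s.X B' B y) = UnrolledSl2.flipPairing φ ψ x y := by
  -- Uniqueness reduces an arbitrary standard half twist to the explicit one, whose unitarity is
  -- known.
  have happ (V : WtMod r) : s.app V = UnrolledSl2.sqrtTwist V :=
    hs.app_eq isStandard_standardHalfTwist V
  have hinv {M N : WtMod r} {χ : M →ₗ⋆[ℂ] N →ₗ[ℂ] ℂ} (hχ : IsContravariant χ) (m : M) (n : N) :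
      χ (s.inv M m) (s.inv N n) = χ m n := by
    have h := hχ.sqrtTwist (s.inv M m) (s.inv N n)
    rw [← happ, ← happ, s.app_inv, s.app_inv] at h
    exact h.symm
  refine (hinv (hψ.flipPairing hφ) _ _).trans ?_
  refine (hφ.flipPairing_braiding hψ _ _).trans ?_
  rw [flipPairing_map]
  have e {M N : WtMod r} {χ : M →ₗ⋆[ℂ] N →ₗ[ℂ] ℂ} (hχ : IsContravariant χ) :
      (χ.comp (s.app M)).compl₂ (s.app N) = χ :=
    LinearMap.ext₂ fun m n => by
      rw [LinearMap.compl₂_apply, LinearMap.comp_apply, happ, happ, hχ.sqrtTwist]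
  rw [e hφ, e hψ]

end IsContravariant

end FlipPairing

theorem IsHermitianStructure.isContravariant {V : WtMod r} {f : Sesq V}
    (hf : IsHermitianStructure V f) : IsContravariant f := ⟨hf.E, hf.F, hf.H⟩

theorem IsHermitianStructure.bijective {V : WtMod r} {f : Sesq V}
    (hf : IsHermitianStructure V f) : Function.Bijective f := by
  refine ⟨(injective_iff_map_eq_zero f).2 fun v hv => hf.nondegenerate v fun w => by
    rw [hv, LinearMap.zero_apply], ?_⟩
  -- Surjectivity follows by duality: a vector killed by the whole image of f is, by Hermitian
  -- symmetry, in the radical.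
  have h : (LinearMap.range f : Submodule ℂ (Module.Dual ℂ V)).dualCoannihilator = ⊥ := by
    rw [eq_bot_iff]
    intro v hv
    rw [Submodule.mem_dualCoannihilator] at hv
    refine hf.nondegenerate v fun w => ?_
    rw [hf.conj_symm, hv (f w) ⟨w, rfl⟩, map_zero]
  have h2 := Subspace.dualCoannihilator_dualAnnihilator_eq
    (W := (LinearMap.range f : Submodule ℂ (Module.Dual ℂ V)))
  rw [h, Submodule.dualAnnihilator_bot] at h2
  exact LinearMap.range_eq_top.1 h2.symm

/-- Non-degenerate forms identify V and W semilinearly with their duals, and V* ⊗ W* is (V ⊗ W)* in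
finite dimension. -/
theorem flipPairing_injective {V W : WtMod r} {f : Sesq V} {g : Sesq W}
    (hf : IsHermitianStructure V f) (hg : IsHermitianStructure W g) :
    Function.Injective (flipPairing f g) := by
  let e : V ⊗[ℂ] W ≃ₛₗ[conj] Module.Dual ℂ V ⊗[ℂ] Module.Dual ℂ W :=
    TensorProduct.congr (LinearEquiv.ofBijective f hf.bijective)
      (LinearEquiv.ofBijective g hg.bijective)
  intro x y h
  refine e.injective ((TensorProduct.dualDistribEquiv ℂ V W).injective ?_)
  refine LinearMap.ext fun z => ?_
  have := LinearMap.congr_fun h (TensorProduct.comm ℂ V W z)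
  change TensorProduct.dualDistrib ℂ V W (e x)
    (TensorProduct.comm ℂ W V (TensorProduct.comm ℂ V W z))
    = TensorProduct.dualDistrib ℂ V W (e y)
    (TensorProduct.comm ℂ W V (TensorProduct.comm ℂ V W z)) at this
  rwa [← TensorProduct.comm_symm, LinearEquiv.symm_apply_apply] at this

theorem conj_flipPairing {V W : WtMod r} {f : Sesq V} {g : Sesq W}
    (hf : IsHermitianStructure V f) (hg : IsHermitianStructure W g) (x : V ⊗[ℂ] W)
    (y : W ⊗[ℂ] V) : conj (flipPairing f g x y) = flipPairing g f y x := by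
  induction x using TensorProduct.induction_on with
  | zero => simp
  | add x x' hx hx' => rw [map_add, LinearMap.add_apply, map_add, hx, hx', map_add]
  | tmul v w =>
    induction y using TensorProduct.induction_on with
    | zero => simp
    | add y y' hy hy' => rw [map_add, map_add, hy, hy', map_add, LinearMap.add_apply]
    | tmul w' v' =>
      rw [flipPairing_tmul, flipPairing_tmul, map_mul, ← hf.conj_symm, ← hg.conj_symm, mul_comm]

/-! ### The Hermitian structure on tensor products -/

section TensorForm

variable [r.AtLeastTwo]

theorem HalfTwist.X_mem_homs (s : HalfTwist r) (V W : WtMod r) :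
    s.X V W ∈ WtMod.homs (V.tensor W) (W.tensor V) :=
  WtMod.lin_mem (twistedBraiding (fun V => s.iso.hom.app V) (fun V => s.iso.inv.app V) V W)

theorem twist_mul_thetaOp (V : WtMod r) : twist V * thetaOp V = 1 := by
  rw [twist_eq, mul_assoc, sqrtTwist_mul_sqrtTwist_mul_thetaOp]

theorem twist_tensor (V W : WtMod r) (y : V ⊗[ℂ] W) :
    twist (V.tensor W) y
      = braiding W V (braiding V W (TensorProduct.map (twist V) (twist W) y)) := by
  have h := thetaOp_tensor V W (TensorProduct.map (twist V) (twist W) y)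
  have h1 := mul_eq_one_comm.1 (twist_mul_thetaOp V)
  have h2 := mul_eq_one_comm.1 (twist_mul_thetaOp W)
  rw [← LinearMap.comp_apply (TensorProduct.map (thetaOp V) (thetaOp W)),
    ← TensorProduct.map_comp, ← Module.End.mul_eq_comp,
    ← Module.End.mul_eq_comp, h1, h2, TensorProduct.map_one, Module.End.one_apply] at h
  refine (congrArg (twist (V.tensor W)) h.symm).trans ?_
  exact LinearMap.congr_fun (twist_mul_thetaOp (V.tensor W)) _

open MonoidalCategory in
-- X is a twisted braiding with σ = √θ, and the condition on σ² is the balancing identity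
-- `twist_tensor`.
theorem HalfTwist.X_X (s : HalfTwist r) (V W : WtMod r) (y : V ⊗[ℂ] W) :
    s.X W V (s.X V W y) = y := by
  have h := twistedBraiding_comp_twistedBraiding (σ := fun V => s.iso.hom.app V)
    (τ := fun V => s.iso.inv.app V) (fun f => (s.iso.hom.naturality f).symm)
    (fun V => s.iso.hom_inv_id_app V) (fun V => s.iso.inv_hom_id_app V) (V := V) (W := W) ?_
  · exact LinearMap.congr_fun (congrArg WtMod.lin h) y
  · refine WtMod.hom_ext (LinearMap.ext fun y => ?_)
    refine (s.app_app (V.tensor W) y).trans ((twist_tensor V W y).trans ?_)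
    change _ = braiding W V (braiding V W (TensorProduct.map (s.app V ∘ₗ s.app V)
      (s.app W ∘ₗ s.app W) y))
    have e (V : WtMod r) : s.app V ∘ₗ s.app V = twist V := LinearMap.ext fun v => s.app_app V v
    rw [e, e]

theorem isHermitianStructure_tensorForm {s : HalfTwist r} (hs : s.IsStandard) {V W : WtMod r}
    {f : Sesq V} {g : Sesq W} (hf : IsHermitianStructure V f) (hg : IsHermitianStructure W g) :
    IsHermitianStructure (V.tensor W) (tensorForm s f g) := by
  have hc := hf.isContravariant.flipPairing hg.isContravariant
  have hc' : IsContravariant (tensorForm s f g) :=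
    { E := fun v w => (hc.E v _).trans (congrArg (flipPairing f g v)
        (LinearMap.congr_fun (s.X_mem_homs V W).1 w).symm)
      F := fun v w => (hc.F v _).trans (congrArg (flipPairing f g v)
        (LinearMap.congr_fun (s.X_mem_homs V W).2.1 w).symm)
      H := fun v w => (hc.H v _).trans (congrArg (flipPairing f g v)
        (LinearMap.congr_fun (s.X_mem_homs V W).2.2.2 w).symm) }
  refine ⟨fun v w => ?_, fun v h => ?_, hc'.E, hc'.F, hc'.Kinv, hc'.K, hc'.H⟩
  -- Unitarity and X X = id make X self-adjoint for the two flipped pairings; conjugation exchanges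
  -- these pairings, which gives Hermitian symmetry.
  · have h : flipPairing g f (s.X V W v) w = flipPairing f g v (s.X V W w) :=
      (congrArg (flipPairing g f (s.X V W v)) (s.X_X V W w)).symm.trans
        (hf.isContravariant.flipPairing_X hg.isContravariant hs v (s.X V W w))
    exact h.symm.trans (conj_flipPairing hf hg w (s.X V W v)).symm
  -- Every y in W ⊗ V is the image under X of X y, so a vector in the radical of the form pairs to
  -- zero with all of W ⊗ V.
  · refine flipPairing_injective hf hg (Eq.trans ?_ (map_zero (flipPairing f g)).symm)
    exact LinearMap.ext fun y =>
      (congrArg (flipPairing f g v) (s.X_X W V y)).symm.trans (h (s.X W V y))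

end TensorForm

end UnrolledSl2

end

open CategoryTheory TensorProduct Polynomial
noncomputable section
namespace UnrolledSl2

/-! ### The coherence isomorphisms are isometries -/

variable {r : ℕ} [r.AtLeastTwo]

theorem flipPairing_assoc {U V W : WtMod r} (f : Sesq U) (g : Sesq V) (h : Sesq W)
    (x : (U ⊗[ℂ] V) ⊗[ℂ] W) (z : (W ⊗[ℂ] V) ⊗[ℂ] U) :
    flipPairing (A := U.tensor V) (B := V.tensor U) (flipPairing f g) h x
        (TensorProduct.assoc ℂ W V U z)
      = flipPairing (A' := V.tensor W) (B' := W.tensor V) f (flipPairing g h)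
        (TensorProduct.assoc ℂ U V W x) z := by
  refine LinearMap.congr_fun₂ (f := (flipPairing (A := U.tensor V) (B := V.tensor U)
    (flipPairing f g) h).compl₂ (TensorProduct.assoc ℂ W V U).toLinearMap)
    (g := (flipPairing (A' := V.tensor W) (B' := W.tensor V) f (flipPairing g h)).comp
      (TensorProduct.assoc ℂ U V W).toLinearMap) ?_ x z
  refine TensorProduct.ext (TensorProduct.ext' fun u v => LinearMap.ext fun w =>
    TensorProduct.ext_threefold fun w' v' u' => ?_)
  exact mul_assoc (f u u') (g v v') (h w w')

/-- Iterating the construction puts two operators X inside the triple flipped pairing, which is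
itself associative. The two composites from U ⊗ V ⊗ W to W ⊗ V ⊗ U agree by
`twistedBraiding_tensor`. -/
theorem tensorForm_assoc (s : HalfTwist r) {U V W : WtMod r} (f : Sesq U) (g : Sesq V)
    (h : Sesq W) (x y : (U ⊗[ℂ] V) ⊗[ℂ] W) :
    tensorForm s (W := V.tensor W) f (tensorForm s g h) (TensorProduct.assoc ℂ U V W x)
        (TensorProduct.assoc ℂ U V W y)
      = tensorForm s (V := U.tensor V) (tensorForm s f g) h x y := by
  have hX : TensorProduct.map LinearMap.id (s.X U V) (s.X (U.tensor V) W y)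
      = TensorProduct.assoc ℂ W V U (TensorProduct.map (s.X V W) LinearMap.id
        (s.X U (V.tensor W) (TensorProduct.assoc ℂ U V W y))) :=
    LinearMap.congr_fun (congrArg WtMod.lin (twistedBraiding_tensor
      (σ := fun V => s.iso.hom.app V) (τ := fun V => s.iso.inv.app V)
      (fun f => (s.iso.hom.naturality f).symm) (fun V => s.iso.hom_inv_id_app V)
      (fun V => s.iso.inv_hom_id_app V) U V W)) y
  have h1 := flipPairing_map (A := U.tensor V) (B := V.tensor U) (C := U.tensor V)
    (D := U.tensor V) (flipPairing f g) h LinearMap.id (s.X U V) LinearMap.id LinearMap.id x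
    (s.X (U.tensor V) W y)
  have h2 := flipPairing_map (A' := V.tensor W) (B' := W.tensor V) (C' := V.tensor W)
    (D' := V.tensor W) f (flipPairing g h) LinearMap.id LinearMap.id LinearMap.id (s.X V W)
    (TensorProduct.assoc ℂ U V W x) (s.X U (V.tensor W) (TensorProduct.assoc ℂ U V W y))
  rw [TensorProduct.map_id] at h1 h2
  refine h2.symm.trans (Eq.trans ?_ h1)
  exact (flipPairing_assoc f g h _ _).symm.trans (congrArg _ hX.symm)

theorem HalfTwist.X_unit_left (s : HalfTwist r) (V : WtMod r) (a : ℂ) (v : V) :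
    s.X (WtMod.unit r) V (a ⊗ₜ[ℂ] v) = (a • v) ⊗ₜ[ℂ] (1 : ℂ) :=
  LinearMap.congr_fun (congrArg WtMod.lin (twistedBraiding_unit_left
    (σ := fun V => s.iso.hom.app V) (τ := fun V => s.iso.inv.app V)
    (fun f => (s.iso.hom.naturality f).symm) (fun V => s.iso.hom_inv_id_app V)
    (fun V => s.iso.inv_hom_id_app V) s.unit V)) (a ⊗ₜ[ℂ] v)

theorem HalfTwist.X_unit_right (s : HalfTwist r) (V : WtMod r) (a : ℂ) (v : V) :
    s.X V (WtMod.unit r) (v ⊗ₜ[ℂ] a) = (1 : ℂ) ⊗ₜ[ℂ] (a • v) :=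
  LinearMap.congr_fun (congrArg WtMod.lin (twistedBraiding_unit_right
    (σ := fun V => s.iso.hom.app V) (τ := fun V => s.iso.inv.app V)
    (fun f => (s.iso.hom.naturality f).symm) (fun V => s.iso.hom_inv_id_app V)
    (fun V => s.iso.inv_hom_id_app V) s.unit V)) (v ⊗ₜ[ℂ] a)

theorem tensorForm_lid (s : HalfTwist r) {V : WtMod r} (g : Sesq V) (x y : ℂ ⊗[ℂ] V) :
    g (TensorProduct.lid ℂ V x) (TensorProduct.lid ℂ V y)
      = tensorForm s (V := WtMod.unit r) (unitForm r) g x y := by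
  refine LinearMap.congr_fun₂ (f := (g.comp (TensorProduct.lid ℂ V).toLinearMap).compl₂
    (TensorProduct.lid ℂ V).toLinearMap) (g := tensorForm s (V := WtMod.unit r) (unitForm r) g)
    (TensorProduct.ext' fun (a : ℂ) v => TensorProduct.ext' fun (b : ℂ) w => ?_) x y
  refine Eq.trans ?_ (congrArg (flipPairing (A := WtMod.unit r) (B := WtMod.unit r) (unitForm r) g
    (a ⊗ₜ[ℂ] v)) (s.X_unit_left V b w)).symm
  change g (a • v) (b • w) = (starRingEnd ℂ) a * 1 * g v (b • w)
  rw [LinearMap.map_smulₛₗ₂, smul_eq_mul, mul_one]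

theorem tensorForm_rid (s : HalfTwist r) {V : WtMod r} (f : Sesq V) (x y : V ⊗[ℂ] ℂ) :
    f (TensorProduct.rid ℂ V x) (TensorProduct.rid ℂ V y)
      = tensorForm s (W := WtMod.unit r) f (unitForm r) x y := by
  refine LinearMap.congr_fun₂ (f := (f.comp (TensorProduct.rid ℂ V).toLinearMap).compl₂
    (TensorProduct.rid ℂ V).toLinearMap) (g := tensorForm s (W := WtMod.unit r) f (unitForm r))
    (TensorProduct.ext' fun v (a : ℂ) => TensorProduct.ext' fun w (b : ℂ) => ?_) x y
  refine Eq.trans ?_ (congrArg (flipPairing (A' := WtMod.unit r) (B' := WtMod.unit r) f (unitForm r)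
    (v ⊗ₜ[ℂ] a)) (s.X_unit_right V b w)).symm
  change f (a • v) (b • w) = f v (b • w) * ((starRingEnd ℂ) a * 1)
  rw [LinearMap.map_smulₛₗ₂, smul_eq_mul, mul_one, mul_comm]

end UnrolledSl2

end

/-! ### The theorem -/

theorem mainTheorem3 (r : ℕ) [r.AtLeastTwo] :
    (∃ s : HalfTwist r, s.IsStandard) ∧
    ∀ s : HalfTwist r, s.IsStandard →
      ∃ (hH : ∀ W₁ W₂ : DDag r,
          IsHermitianStructure (W₁.toMod.tensor W₂.toMod) (tensorForm s W₁.form W₂.form))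
        (hD : ∀ W₁ W₂ : DDag r, InD (W₁.toMod.tensor W₂.toMod)),
        (∃ M : MonoidalCategory (DDag r),
          M.toMonoidalCategoryStruct = DDag.monoidalStruct s hH hD ∧
          ∃ _ : MonoidalPreadditive (DDag r), MonoidalLinear ℂ (DDag r)) ∧
        (Function.Bijective fun c : ℂ => c • 𝟙 (DDag.unit r)) ∧
        (∀ U V W : DDag r, DDag.IsIsometry (DDag.associator s hH hD U V W).hom) ∧
        (∀ V : DDag r, DDag.IsIsometry (DDag.leftUnitor s hH hD V).hom) ∧
        (∀ V : DDag r, DDag.IsIsometry (DDag.rightUnitor s hH hD V).hom) := by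
  refine ⟨⟨standardHalfTwist r, isStandard_standardHalfTwist⟩, fun s hs =>
    ⟨fun W₁ W₂ => isHermitianStructure_tensorForm hs W₁.isHermitian W₂.isHermitian,
      fun W₁ W₂ => W₁.mem.tensor W₂.mem, DDag.exists_monoidalLinear s _ _,
      DDag.bijective_smul_id_unit, fun U V W x y => ?_, fun V x y => ?_, fun V x y => ?_⟩⟩
  · exact tensorForm_assoc s U.form V.form W.form x y
  · exact tensorForm_lid s V.form x y
  · exact tensorForm_rid s V.form x y
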